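/- A consumption MDP (CMDP) $\mathcal M=(S,A,\Delta,C,R,\mathit{cap})$ consists of finite sets $S$ of states and $A$ of actions, a transition function $\Delta$ assigning to each $(s,a)\in S\times A$ a probability distribution on $S$, a consumption function $C\colon S\times A\to\mathbb N$, a set $R\subseteq S$ of reload states and a capacity $\mathit{cap}\in\mathbb N$. A path is a finite or infinite sequence $s_1a_1s_2a_2\dots$ with $\Delta(s_i,a_i)(s_{i+1})>0$ for all $i$; an infinite path is a run. $\mathcal M$ is decreasing if every simple cycle $s_1a_1s_2\dots a_{k-1}s_k$ (with $k\ge 2$, $s_1=s_k$ and $s_1,\dots,s_{k-1}$ distinct) has some $i<k$ with $C(s_i,a_i)>0$. The resource level along a path, for an initial load $d\in\{0,\dots,\mathit{cap}\}$, starts at $d$; playing $a$ in $s$ changes the level from $\ell$ to $\ell-C(s,a)$ if $s\notin R$ and $C(s,a)\le\ell$, and to $\mathit{cap}-C(s,a)$ if $s\in R$ and $C(s,a)\le\mathit{cap}$; otherwise the level becomes $\bot$ (exhausted) and stays $\bot$ forever. A strategy $\sigma$ maps finite paths to actions. For $T\subseteq S$, $\sigma$ is $T$-Büchi $d$-safe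 in $s$ if on every $\sigma$-compatible run from $s$ the level initialized by $d$ is never $\bot$, and the probability under $\sigma$ and $s$ that $T$ is visited infinitely often is $1$. A counter selector $\Sigma$ assigns to each state $s$ a partial function $\Sigma(s)$ from $\{0,\dots,\mathit{cap}\}$ to $A$. Together with a vector $\vec r\in\{0,\dots,\mathit{cap}\}^S$ and a fixed action $a_0\in A$ it defines the strategy $\Sigma^{\vec r}$ that, started in a state $s$, tracks the resource level initialized by $\vec r(s)$ and, whenever the current state is $q$ and the tracked level is $m$, plays $\Sigma(q)(n)$ for the largest $n\le m$ in the domain of $\Sigma(q)$, and plays $a_0$ if there is no such $n$ or if $m=\bot$. Theorem. Consider inputs consisting of a decreasing CMDP $\mathcal M$ with rational transition probabilities, a state $s$, an initial load $0\le d\le\mathit{cap}$ and a set $T\subseteq S$, with all numbers, in particular $\mathit{cap}$, encoded in binary. (1) It is decidable in time polynomial in the size of the input whether there is a strategy that is $T$-Büchi $d$-safe in $s$. (2) There is an algorithm that, on every input for which such a strategy exists, computes in polynomial time a polynomial-size representation of such a strategy: a counter selector $\Sigma$ (given by the list of the triples $(q,n,a)$ with $\Sigma(q)(n)=a$) and a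 vector $\vec r$, with numbers written in binary, such that $\Sigma^{\vec r}$ is $T$-Büchi $d$-safe in $s$, whichever action is fixed as $a_0$. -/

import Mathlib

open scoped NNReal ENNReal

/-! ### Polynomial time: a random access machine with logarithmic cost

The programs are structured programs over finitely many arrays of natural numbers, each of them
addressed indirectly. Every elementary step is charged the number of bits of all the numbers
(addresses, operands and results) that it touches. This is the usual logarithmic cost measure,
so that polynomial time on this machine is polynomial time on Turing machines. -/

namespace RAM

/-- The memory: `m a i` is the content of cell `i` of array `a`. -/
abbrev Memory : Type := ℕ → ℕ → ℕ

/-- Arithmetic expressions. `cell a e` reads the cell of array `a` with index `e`; `minus` is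
truncated subtraction and `quot` is integer division. -/
inductive Expr : Type
  | lit (n : ℕ)
  | cell (a : ℕ) (e : Expr)
  | plus (e f : Expr)
  | minus (e f : Expr)
  | times (e f : Expr)
  | quot (e f : Expr)

/-- The value of an expression. -/
def Expr.eval (m : Memory) : Expr → ℕ
  | .lit n => n
  | .cell a e => m a (e.eval m)
  | .plus e f => e.eval m + f.eval m
  | .minus e f => e.eval m - f.eval m
  | .times e f => e.eval m * f.eval m
  | .quot e f => e.eval m / f.eval m

/-- The time needed to evaluate an expression (`Nat.size` is the length in binary). -/
def Expr.cost (m : Memory) : Expr → ℕ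
  | .lit n => n.size + 1
  | .cell a e => e.cost m + (e.eval m).size + (m a (e.eval m)).size + 1
  | .plus e f => e.cost m + f.cost m +
      (e.eval m).size + (f.eval m).size + (e.eval m + f.eval m).size + 1
  | .minus e f => e.cost m + f.cost m +
      (e.eval m).size + (f.eval m).size + (e.eval m - f.eval m).size + 1
  | .times e f => e.cost m + f.cost m +
      (e.eval m).size + (f.eval m).size + (e.eval m * f.eval m).size + 1
  | .quot e f => e.cost m + f.cost m +
      (e.eval m).size + (f.eval m).size + (e.eval m / f.eval m).size + 1

/-- Programs. `store a i e` writes the value of `e` to the cell of array `a` with index `i`;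
conditions hold when their value is not `0`. -/
inductive Program : Type
  | skip
  | store (a : ℕ) (i e : Expr)
  | seq (c d : Program)
  | ite (e : Expr) (c d : Program)
  | while (e : Expr) (c : Program)

/-- The memory after writing `v` to cell `i` of array `a`. -/
def Memory.write (m : Memory) (a i v : ℕ) : Memory :=
  Function.update m a (Function.update (m a) i v)

/-- `Exec c m m' t`: the program `c`, started in the memory `m`, halts after exactly `t` time
units in the memory `m'`. -/
inductive Exec : Program → Memory → Memory → ℕ → Prop
  | skip (m : Memory) : Exec .skip m m 1
  | store (m : Memory) (a : ℕ) (i e : Expr) :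
      Exec (.store a i e) m (m.write a (i.eval m) (e.eval m))
        (i.cost m + e.cost m + (i.eval m).size + (e.eval m).size + 1)
  | seq {c d : Program} {m m₁ m₂ : Memory} {t₁ t₂ : ℕ} :
      Exec c m m₁ t₁ → Exec d m₁ m₂ t₂ → Exec (.seq c d) m m₂ (t₁ + t₂)
  | ite_true {e : Expr} {c d : Program} {m m' : Memory} {t : ℕ} :
      e.eval m ≠ 0 → Exec c m m' t → Exec (.ite e c d) m m' (e.cost m + t + 1)
  | ite_false {e : Expr} {c d : Program} {m m' : Memory} {t : ℕ} :
      e.eval m = 0 → Exec d m m' t → Exec (.ite e c d) m m' (e.cost m + t + 1)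
  | while_true {e : Expr} {c : Program} {m m₁ m₂ : Memory} {t₁ t₂ : ℕ} :
      e.eval m ≠ 0 → Exec c m m₁ t₁ → Exec (.while e c) m₁ m₂ t₂ →
        Exec (.while e c) m m₂ (e.cost m + t₁ + t₂ + 1)
  | while_false {e : Expr} {c : Program} {m : Memory} :
      e.eval m = 0 → Exec (.while e c) m m (e.cost m + 1)

/-- The initial memory on the input `x`: array `0` holds the length of `x` and then the entries
of `x`, and all other cells are `0`. -/
def input (x : List ℕ) : Memory :=
  fun a i => if a = 0 then (x.length :: x).getD i 0 else 0

/-- The output is read off array `1`: cell `0` holds its length, the next cells its entries. -/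
def output (m : Memory) : List ℕ :=
  (List.range (m 1 0)).map fun i => m 1 (i + 1)

/-- The size of a list of natural numbers that are written in binary. -/
def bitSize (x : List ℕ) : ℕ := (x.map fun n => n.size + 1).sum

/-- The computational problem "given an instance `I` in `dom`, presented as `enc I`, output some
`y` with `sol I y`" is solvable in polynomial time: there are one program and one polynomial such
that on every instance the program halts with a correct output, and the running time and the
size of the output are bounded by the polynomial in the size of the input. -/
def SolvableInPolyTime {ι : Type} (dom : ι → Prop) (enc : ι → List ℕ)
    (sol : ι → List ℕ → Prop) : Prop :=
  ∃ (c : Program) (p : Polynomial ℕ), ∀ I : ι, dom I →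
    ∃ (m : Memory) (t : ℕ), Exec c (input (enc I)) m t ∧
      t ≤ p.eval (bitSize (enc I)) ∧
      bitSize (output m) ≤ p.eval (bitSize (enc I)) ∧
      sol I (output m)

end RAM

/-! ### Consumption Markov decision processes -/

/-- A consumption MDP with states `S` and actions `A` (finite in all uses below): transition
function, consumption function, reload states and capacity. -/
structure CMDP (S A : Type) where
  trans : S → A → PMF S
  cons : S → A → ℕ
  reload : Finset S
  cap : ℕ

/-- State-action sequences `s₁ a₁ s₂ … aₙ₋₁ sₙ`. -/
inductive History (S A : Type) : Type
  | start (s : S)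
  | step (h : History S A) (a : A) (t : S)

namespace History

variable {S A : Type}

/-- The first state. -/
def first : History S A → S
  | start s => s
  | step h _ _ => h.first

/-- The last state. -/
def last : History S A → S
  | start s => s
  | step _ _ t => t

/-- The pairs `(sᵢ, aᵢ)`, `i < n`, in order. -/
def steps : History S A → List (S × A)
  | start _ => []
  | step h a _ => h.steps ++ [(h.last, a)]

/-- The finite prefix `s₀ a₀ s₁ … sₙ` of an infinite state-action sequence (indexed from `0`). -/
def pref (ρ : ℕ → S × A) : ℕ → History S A
  | 0 => start (ρ 0).1
  | n + 1 => step (pref ρ n) (ρ n).2 (ρ (n + 1)).1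

end History

/-- A strategy. Only its values on histories that are paths of the CMDP at hand matter. -/
abbrev Strategy (S A : Type) : Type := History S A → A

/-- A memory structure: a finite transducer that encodes a strategy. -/
structure MemoryStructure (S A : Type) where
  Mem : Type
  finite : Finite Mem
  next : Mem → S → A
  update : Mem → S → A → S → Mem
  initial : S → Mem

namespace MemoryStructure

variable {S A : Type}

/-- The memory element reached from `m` along a history. -/
def updateStar (μ : MemoryStructure S A) (m : μ.Mem) : History S A → μ.Mem
  | .start _ => m
  | .step h a t => μ.update (μ.updateStar m h) h.last a t

/-- The strategy encoded by a memory structure. -/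
def strategy (μ : MemoryStructure S A) : Strategy S A :=
  fun h => μ.next (μ.updateStar (μ.initial h.first) h) h.last

end MemoryStructure

namespace CMDP

variable {S A : Type} (M : CMDP S A)

/-- The possible successors of an action. -/
def Succ (s : S) (a : A) : Set S := {t | 0 < M.trans s a t}

/-- A state-action sequence is a (finite) path. -/
def IsPath : History S A → Prop
  | .start _ => True
  | .step h a t => IsPath h ∧ t ∈ M.Succ h.last a

/-- Every simple cycle contains an action of positive consumption. -/
def Decreasing : Prop :=
  ∀ h : History S A, M.IsPath h → h.steps ≠ [] → h.first = h.last →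
    (h.steps.map Prod.fst).Nodup → ∃ p ∈ h.steps, 0 < M.cons p.1 p.2

/-- Infinite paths. -/
def IsRun (ρ : ℕ → S × A) : Prop :=
  ∀ i, (ρ (i + 1)).1 ∈ M.Succ (ρ i).1 (ρ i).2

/-- The `s`-initiated runs that are compatible with the strategy `σ`. -/
def Comp (σ : Strategy S A) (s : S) : Set (ℕ → S × A) :=
  {ρ | M.IsRun ρ ∧ (ρ 0).1 = s ∧ ∀ i, (ρ i).2 = σ (History.pref ρ i)}

/-- Non-exhausted resource levels `0, …, cap`. In `Option M.Level`, `none` is exhaustion. -/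
abbrev Level : Type := Fin (M.cap + 1)

/-- The resource level after playing the action `a` in the state `s`. -/
def levelStep [DecidableEq S] (s : S) (a : A) : Option M.Level → Option M.Level
  | none => none
  | some l =>
    if s ∈ M.reload then
      if M.cons s a ≤ M.cap then some ⟨M.cap - M.cons s a, by omega⟩ else none
    else
      if M.cons s a ≤ l then some ⟨l - M.cons s a, by omega⟩ else none

/-- The resource level after a history initialized by the load `d`. -/
def level [DecidableEq S] (d : M.Level) : History S A → Option M.Level
  | .start _ => some d
  | .step h a _ => M.levelStep h.last a (level d h)

/-- The `d`-safe runs: the resource is never exhausted. -/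
def SafeRuns [DecidableEq S] (d : M.Level) : Set (ℕ → S × A) :=
  {ρ | M.IsRun ρ ∧ ∀ i, M.level d (History.pref ρ i) ≠ none}

/-- The runs that visit `T` infinitely often. -/
def BuchiRuns (T : Finset S) : Set (ℕ → S × A) :=
  {ρ | M.IsRun ρ ∧ ∃ᶠ i in Filter.atTop, (ρ i).1 ∈ T}

section Probability

variable [Finite S] [Finite A] [MeasurableSpace S] [MeasurableSpace A]
  [DiscreteMeasurableSpace S] [DiscreteMeasurableSpace A]

/-- The history `s₀ a₀ … sₙ aₙ t` given by the pairs `(sᵢ, aᵢ)`, `i ≤ n`, and by a state `t`. -/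
def extend {S A : Type} {n : ℕ} (x : Finset.Iic n → S × A) (t : S) : History S A :=
  .step (History.pref (fun i => x ⟨min i n, Finset.mem_Iic.2 (min_le_right i n)⟩) n)
    (x ⟨n, Finset.mem_Iic.2 le_rfl⟩).2 t

/-- One step of the process under `σ`: the next state `t` is drawn from the distribution of the
current state and action, and then the strategy chooses the next action. -/
noncomputable def stepKernel (σ : Strategy S A) (n : ℕ) :
    ProbabilityTheory.Kernel (Finset.Iic n → S × A) (S × A) :=
  ProbabilityTheory.Kernel.ofFunOfCountable fun x =>
    ((M.trans (x ⟨n, Finset.mem_Iic.2 le_rfl⟩).1 (x ⟨n, Finset.mem_Iic.2 le_rfl⟩).2).map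
      fun t => (t, σ (extend x t))).toMeasure

instance (σ : Strategy S A) (n : ℕ) :
    ProbabilityTheory.IsMarkovKernel (M.stepKernel σ n) :=
  ⟨fun _ => PMF.toMeasure.isProbabilityMeasure _⟩

/-- The probability measure on state-action sequences induced by the strategy `σ` and the initial
state `s` (by the theorem of Ionescu-Tulcea). -/
noncomputable def prob (σ : Strategy S A) (s : S) : MeasureTheory.Measure (ℕ → S × A) :=
  ProbabilityTheory.Kernel.traj (X := fun _ => S × A) (M.stepKernel σ) 0
    (fun _ => (s, σ (.start s)))

/-- The strategy `σ` is `T`-Büchi `d`-safe in the state `s`. -/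
def IsBuchiSafe [DecidableEq S] (T : Finset S) (d : M.Level) (s : S) (σ : Strategy S A) : Prop :=
  M.Comp σ s ⊆ M.SafeRuns d ∧ M.prob σ s (M.BuchiRuns T) = 1

end Probability

/-! ### Counter selectors -/

/-- A selection rule: a partial function from `{0, …, cap}` to the actions. -/
abbrev SelectionRule : Type := M.Level → Option A

/-- A counter selector assigns a selection rule to every state. -/
abbrev CounterSelector : Type := S → M.SelectionRule

variable {M} in
/-- The action selected by a rule at a resource level: the value at the largest element of the
domain that does not exceed the level, and the fixed action `a₀` if there is none. -/
def SelectionRule.select (φ : M.SelectionRule) (a₀ : A) : Option M.Level → A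
  | none => a₀
  | some l =>
    let D := Finset.univ.filter fun n : M.Level => (φ n).isSome ∧ n ≤ l
    if h : D.Nonempty then (φ (D.max' h)).getD a₀ else a₀

/-- The memory structure given by a counter selector `Γ`, a vector `r` of initial resource levels
and a fixed action `a₀`; its memory tracks the resource level. -/
def counterStructure [DecidableEq S] (Γ : M.CounterSelector) (r : S → M.Level) (a₀ : A) :
    MemoryStructure S A where
  Mem := Option M.Level
  finite := inferInstance
  next m s := SelectionRule.select (Γ s) a₀ m
  update m s a _ := M.levelStep s a m
  initial s := some (r s)

/-- The finite counter strategy given by `Γ` and `r`. -/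
def counterStrategy [DecidableEq S] (Γ : M.CounterSelector) (r : S → M.Level) (a₀ : A) :
    Strategy S A :=
  (M.counterStructure Γ r a₀).strategy

end CMDP

/-! ### Encodings -/

/-- An instance of the consumption-Büchi problem: a CMDP with states `Fin n`, actions `Fin k` and
rational transition probabilities, an initial state, an initial load and the accepting states. -/
structure BuchiInstance where
  n : ℕ
  k : ℕ
  M : CMDP (Fin n) (Fin k)
  rat : Fin n → Fin k → Fin n → ℚ≥0
  trans_eq : ∀ s a t, M.trans s a t = ((rat s a t : ℝ≥0) : ℝ≥0∞)
  initial : Fin n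
  load : M.Level
  target : Finset (Fin n)

namespace BuchiInstance

variable (I : BuchiInstance)

/-- The encoding of an instance: the list of all its numbers (numerators and denominators for the
probabilities, characteristic vectors for the sets). They are written in binary, see `bitSize`. -/
def encode : List ℕ :=
  [I.n, I.k, I.M.cap, I.initial, I.load] ++
  ((List.finRange I.n).flatMap fun s => (List.finRange I.k).map fun a => I.M.cons s a) ++
  ((List.finRange I.n).flatMap fun s => (List.finRange I.k).flatMap fun a =>
    (List.finRange I.n).flatMap fun t => [(I.rat s a t).num, (I.rat s a t).den]) ++
  ((List.finRange I.n).map fun s => if s ∈ I.M.reload then 1 else 0) ++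
  ((List.finRange I.n).map fun s => if s ∈ I.target then 1 else 0)

/-- The strategy satisfies the consumption-Büchi objectives of the instance. -/
def IsWinning (σ : Strategy (Fin I.n) (Fin I.k)) : Prop :=
  I.M.IsBuchiSafe I.target I.load I.initial σ

/-- The list `y` represents the counter selector `Γ` together with the vector `r` of initial
levels: it consists of the entries of `r`, followed by the triples (state, level, action) of the
graph of `Γ`, in any order. -/
def Represents (y : List ℕ) (Γ : I.M.CounterSelector) (r : Fin I.n → I.M.Level) : Prop :=
  ∃ L : List (Fin I.n × I.M.Level × Fin I.k),
    (∀ s l a, Γ s l = some a ↔ (s, l, a) ∈ L) ∧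
    y = ((List.finRange I.n).map fun s => (r s : ℕ)) ++
      L.flatMap fun e => [(e.1 : ℕ), (e.2.1 : ℕ), (e.2.2 : ℕ)]

end BuchiInstance

/-! Winning is characterised by two value iterations whose number of rounds does not depend on
`cap`. Fix a set `K` of reload states that may be used. The safe load `safeVal` is the least load
from which `K` can surely be reached before exhaustion, avoiding the other reload states; it is the
limit of `safeStep` started from `cap + 1`, which stands for "no load suffices". The load `posVal`
is the least one that allows to visit `T` later with positive probability while every successor
keeps its safe load. Reload states that fail this even with a full load are useless; `prune` removes
them, and repetition leads to the stable set `kept`.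

Necessity: in a decreasing CMDP a run cannot go on without reloading, so levels under a winning
strategy dominate the safe loads (`IsBuchiSafe.safeVal_le`). Every compatible path continues to a
run that meets `T` later, and reading that run backwards bounds `posVal` by the level
(`IsBuchiSafe.posVal_le`). Hence no visited reload state is ever pruned, and the initial load is at
least the safe load for `kept`.

Sufficiency: for a stable `K` one has `posVal ≤ safeVal` (`posVal_le_safeVal`), so each safe level
has a rank, the first round of the positive iteration whose value it meets. The selector stores an
action whenever a value drops, and the rule "largest level in the domain" retrieves the action of
the rank (`IsSelectorFor.select`). Each step keeps the level safe and has a chance, bounded from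
below, to enter `T` or to lower the rank; so `T` recurs almost surely (`prob_buchiRuns_eq_one`).

Complexity: as for shortest paths, the value of a state that is not a reload state depends only on
entries that are not larger, so each round makes one more state final (`iterate_card_le`). In the
positive iteration reload states break this, but each of them drops only once, and `(|S| + 1) ^ 2`
rounds suffice (`posVal_le_iter`); this also bounds the number of stored triples. The iterations are
run by nested loops with small constant bounds that never produce longer numbers (`exec_of_static`).
-/

namespace History

variable {S A : Type}

theorem pref_congr {ρ ρ' : ℕ → S × A} {n : ℕ} (h : ∀ i ≤ n, ρ i = ρ' i) :
    pref ρ n = pref ρ' n := by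
  induction n with
  | zero => simp [pref, h 0 le_rfl]
  | succ n ih =>
    simp only [pref, ih fun i hi => h i (by omega), h n (by omega), h (n + 1) le_rfl]

@[simp]
theorem last_pref (ρ : ℕ → S × A) (n : ℕ) : (pref ρ n).last = (ρ n).1 := by
  cases n <;> rfl

/-- The number of steps. -/
def length : History S A → ℕ
  | start _ => 0
  | step h _ _ => h.length + 1

@[simp]
theorem length_pref (ρ : ℕ → S × A) (n : ℕ) : (pref ρ n).length = n := by
  induction n with
  | zero => rfl
  | succ n ih => simp [pref, length, ih]

end History

/-! ### The measure on runs and almost sure recurrence -/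

namespace CMDP
open MeasureTheory ProbabilityTheory Preorder

variable {S A : Type} (M : CMDP S A)

/-- The finite paths that start in `s` and are compatible with `σ`. -/
def CompHist (σ : Strategy S A) (s : S) : History S A → Prop
  | .start t => t = s
  | .step h a t => CompHist σ s h ∧ a = σ h ∧ t ∈ M.Succ h.last a

theorem compHist_pref {σ : Strategy S A} {s : S} {ρ : ℕ → S × A} (h : ρ ∈ M.Comp σ s) (n : ℕ) :
    M.CompHist σ s (History.pref ρ n) := by
  induction n with
  | zero => exact h.2.1
  | succ n ih => exact ⟨ih, h.2.2 n, by simpa using h.1 n⟩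

section Probability

variable [Finite S] [Finite A] [MeasurableSpace S] [MeasurableSpace A]
  [DiscreteMeasurableSpace S] [DiscreteMeasurableSpace A]

instance (σ : Strategy S A) (s : S) : IsProbabilityMeasure (M.prob σ s) := by
  unfold prob; infer_instance

/-- The Markov property in integrated form: the law of a prefix of length `m + 2` is the
composition-product of the law of the shorter prefix with the step kernel. Prefix spaces are finite
and discrete, so every `f` is measurable. -/
theorem lintegral_prob_succ (σ : Strategy S A) (s : S) (m : ℕ)
    (f : (Finset.Iic m → S × A) × (S × A) → ℝ≥0∞) :
    ∫⁻ ρ, f (frestrictLe (π := fun _ => S × A) m ρ, ρ (m + 1)) ∂(M.prob σ s) =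
      ∫⁻ ρ, ∫⁻ y, f (frestrictLe (π := fun _ => S × A) m ρ, y)
        ∂(M.stepKernel σ m (frestrictLe (π := fun _ => S × A) m ρ)) ∂(M.prob σ s) := by
  have hf : Measurable f := Measurable.of_discrete
  have h := Kernel.partialTraj_compProd_eq_map_traj (X := fun _ => S × A)
    (κ := M.stepKernel σ) (Nat.zero_le m) (x₀ := fun _ => (s, σ (.start s)))
  have h' := congrArg (fun μ => ∫⁻ y, f y ∂μ) h
  rw [lintegral_map hf (by fun_prop), Measure.lintegral_compProd hf,
    ← Kernel.traj_map_frestrictLe_apply, lintegral_map Measurable.of_discrete (by fun_prop)] at h'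
  exact h'.symm

omit [Finite S] [Finite A] [MeasurableSpace S] [MeasurableSpace A]
  [DiscreteMeasurableSpace S] [DiscreteMeasurableSpace A] in
theorem extend_frestrictLe (ρ : ℕ → S × A) (m : ℕ) (t : S) :
    extend (frestrictLe (π := fun _ => S × A) m ρ) t = .step (History.pref ρ m) (ρ m).2 t := by
  unfold extend
  congr 1
  exact History.pref_congr fun i hi => by simp [hi]

theorem lintegral_stepKernel [Fintype S] (σ : Strategy S A) (m : ℕ) (ρ : ℕ → S × A)
    (f : S × A → ℝ≥0∞) :
    ∫⁻ y, f y ∂(M.stepKernel σ m (frestrictLe (π := fun _ => S × A) m ρ)) =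
      ∑ t, M.trans (ρ m).1 (ρ m).2 t * f (t, σ (.step (History.pref ρ m) (ρ m).2 t)) := by
  classical
  have : (M.stepKernel σ m (frestrictLe (π := fun _ => S × A) m ρ)) =
    ((M.trans (ρ m).1 (ρ m).2).map
      fun t => (t, σ (.step (History.pref ρ m) (ρ m).2 t))).toMeasure := by
    simp only [← extend_frestrictLe]
    rfl
  rw [this, ← PMF.toMeasure_map _ _ Measurable.of_discrete, lintegral_map Measurable.of_discrete Measurable.of_discrete,
    lintegral_fintype]
  refine Finset.sum_congr rfl fun t _ => ?_
  rw [PMF.toMeasure_apply_singleton _ _ (MeasurableSet.singleton _), mul_comm]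

/-- One step of the process. -/
theorem lintegral_pref_succ [Fintype S] (σ : Strategy S A) (s : S) (m : ℕ)
    (f : History S A → ℝ≥0∞) :
    ∫⁻ ρ, f (History.pref ρ (m + 1)) ∂(M.prob σ s) =
      ∫⁻ ρ, ∑ t, M.trans (ρ m).1 (ρ m).2 t * f (.step (History.pref ρ m) (ρ m).2 t)
        ∂(M.prob σ s) := by
  have h := M.lintegral_prob_succ σ s m fun p => f (extend p.1 p.2.1)
  simp only [lintegral_stepKernel, extend_frestrictLe] at h
  exact h

theorem ae_fst_zero (σ : Strategy S A) (s : S) :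
    ∀ᵐ ρ ∂(M.prob σ s), ρ 0 = (s, σ (.start s)) := by
  have h := Kernel.traj_map_frestrictLe_apply (X := fun _ => S × A) (κ := M.stepKernel σ) 0 0
    (fun _ => (s, σ (.start s)))
  rw [Kernel.partialTraj_self, Kernel.id_apply] at h
  have h2 : ∀ᵐ x ∂(Measure.dirac (fun _ : Finset.Iic 0 => (s, σ (.start s)))),
      x ⟨0, Finset.mem_Iic.2 le_rfl⟩ = (s, σ (.start s)) := by
    rw [ae_dirac_eq]; rfl
  rw [← h] at h2
  exact ae_of_ae_map (by fun_prop) h2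

/-- The indicator of a wrong step has integral zero, because the step kernel charges only possible
successors paired with the action that `σ` prescribes. -/
theorem ae_succ (σ : Strategy S A) (s : S) (m : ℕ) :
    ∀ᵐ ρ ∂(M.prob σ s), (ρ (m + 1)).1 ∈ M.Succ (ρ m).1 (ρ m).2 ∧
      (ρ (m + 1)).2 = σ (History.pref ρ (m + 1)) := by
  classical
  cases nonempty_fintype S
  have h := M.lintegral_prob_succ σ s m fun p =>
    if p.2.1 ∈ M.Succ (p.1 ⟨m, Finset.mem_Iic.2 le_rfl⟩).1 (p.1 ⟨m, Finset.mem_Iic.2 le_rfl⟩).2 ∧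
      p.2.2 = σ (extend p.1 p.2.1) then 0 else 1
  simp only [lintegral_stepKernel, extend_frestrictLe] at h
  have hz : ∀ ρ : ℕ → S × A, (∑ t, M.trans (ρ m).1 (ρ m).2 t *
      if t ∈ M.Succ (ρ m).1 (ρ m).2 ∧ True then 0 else 1) = 0 := by
    intro ρ
    refine Finset.sum_eq_zero fun t _ => ?_
    by_cases ht : t ∈ M.Succ (ρ m).1 (ρ m).2
    · rw [if_pos ⟨ht, trivial⟩, mul_zero]
    · have : M.trans (ρ m).1 (ρ m).2 t = 0 := by simpa [Succ] using ht
      rw [this, zero_mul]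
  replace h := h.trans ((lintegral_congr hz).trans lintegral_zero)
  rw [lintegral_eq_zero_iff'] at h
  · filter_upwards [h] with ρ hρ
    by_contra hc
    rw [if_neg] at hρ
    · exact one_ne_zero hρ
    · exact hc
  · simp only [← extend_frestrictLe]
    refine Measurable.aemeasurable (Measurable.comp (g := fun p : (Finset.Iic m → S × A) × (S × A) =>
      if p.2.1 ∈ M.Succ (p.1 ⟨m, Finset.mem_Iic.2 le_rfl⟩).1 (p.1 ⟨m, Finset.mem_Iic.2 le_rfl⟩).2 ∧
        p.2.2 = σ (extend p.1 p.2.1) then 0 else 1)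
      (f := fun ρ => (frestrictLe (π := fun _ => S × A) m ρ, ρ (m + 1)))
      Measurable.of_discrete (by fun_prop))

theorem ae_comp (σ : Strategy S A) (s : S) : ∀ᵐ ρ ∂(M.prob σ s), ρ ∈ M.Comp σ s := by
  filter_upwards [M.ae_fst_zero σ s, ae_all_iff.2 (M.ae_succ σ s)] with ρ h0 h
  refine ⟨fun i => (h i).1, by simp [h0], fun i => ?_⟩
  cases i with
  | zero => simp [h0, History.pref]
  | succ i => exact (h i).2

theorem measurable_pref (f : History S A → ℝ≥0∞) (m : ℕ) :
    Measurable fun ρ : ℕ → S × A => f (History.pref ρ m) := by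
  have : (fun ρ : ℕ → S × A => f (History.pref ρ m)) =
      (fun x : Finset.Iic m → S × A =>
        f (History.pref (fun i => x ⟨min i m, Finset.mem_Iic.2 (min_le_right i m)⟩) m)) ∘
      frestrictLe (π := fun _ => S × A) m := by
    ext ρ
    simp only [Function.comp]
    congr 1
    exact History.pref_congr fun i hi => by simp [hi]
  rw [this]
  exact Measurable.of_discrete.comp (by fun_prop)

omit [Finite S] [Finite A] [MeasurableSpace S] [MeasurableSpace A]
  [DiscreteMeasurableSpace S] [DiscreteMeasurableSpace A] in
open Classical in
/-- The indicator function of a single path. -/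
noncomputable def pathIndicator (h g : History S A) : ℝ≥0∞ := if g = h then 1 else 0

/-- Every compatible path has positive probability. -/
theorem lintegral_pref_pos {σ : Strategy S A} {s : S} {h : History S A} (hc : M.CompHist σ s h) :
    0 < ∫⁻ ρ, pathIndicator h (History.pref ρ h.length) ∂(M.prob σ s) := by
  classical
  cases nonempty_fintype S
  induction h with
  | start t =>
    obtain rfl : t = s := hc
    have : ∀ᵐ ρ ∂(M.prob σ t), pathIndicator (.start t)
        (History.pref ρ (History.length (.start t : History S A))) = 1 := by
      filter_upwards [M.ae_fst_zero σ t] with ρ hρ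
      simp [History.pref, History.length, hρ, pathIndicator]
    rw [lintegral_congr_ae this]
    simp
  | step h a t ih =>
    obtain ⟨h1, rfl, h3⟩ := hc
    have hle : ∀ᵐ ρ ∂(M.prob σ s), M.trans h.last (σ h) t *
        pathIndicator h (History.pref ρ h.length) ≤
        ∑ u, M.trans (ρ h.length).1 (ρ h.length).2 u *
          pathIndicator (.step h (σ h) t)
            (.step (History.pref ρ h.length) (ρ h.length).2 u) := by
      filter_upwards [M.ae_comp σ s] with ρ hρ
      refine le_trans ?_ (Finset.single_le_sum (fun _ _ => zero_le) (Finset.mem_univ t))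
      by_cases hh : History.pref ρ h.length = h
      · have e1 : (ρ h.length).1 = h.last := by rw [← History.last_pref, hh]
        have e2 : (ρ h.length).2 = σ h := by rw [hρ.2.2, hh]
        rw [e1, e2, hh]
        simp [pathIndicator]
      · simp [pathIndicator, hh]
    have := lintegral_mono_ae hle
    rw [← M.lintegral_pref_succ σ s h.length (pathIndicator (.step h (σ h) t)),
      lintegral_const_mul _ (measurable_pref _ _)] at this
    exact lt_of_lt_of_le (ENNReal.mul_pos h3.ne' (ih h1).ne') this

/-- Every compatible path is continued by a compatible run with an almost sure property. -/
theorem exists_comp_of_ae {σ : Strategy S A} {s : S} {h : History S A} (hc : M.CompHist σ s h)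
    {p : (ℕ → S × A) → Prop} (hp : ∀ᵐ ρ ∂(M.prob σ s), p ρ) :
    ∃ ρ ∈ M.Comp σ s, p ρ ∧ History.pref ρ h.length = h := by
  by_contra hne
  push Not at hne
  have h0 : ∀ᵐ ρ ∂(M.prob σ s),
      pathIndicator h (History.pref ρ h.length) = 0 := by
    filter_upwards [hp, M.ae_comp σ s] with ρ h1 h2
    simpa [pathIndicator] using hne ρ h2 h1
  have := M.lintegral_pref_pos hc
  rw [lintegral_congr_ae h0] at this
  simp at this

/-- The states at the times after `i` are not in `T`. -/
def Avoids (T : Finset S) (i : ℕ) : History S A → Prop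
  | .start _ => True
  | .step h _ t => Avoids T i h ∧ (i ≤ h.length → t ∉ T)

omit [Finite A] [MeasurableSpace S] [MeasurableSpace A]
  [DiscreteMeasurableSpace S] [DiscreteMeasurableSpace A] in
theorem exists_trans_lower_bound [Finite A] : ∃ δ : ℝ, 0 < δ ∧ δ ≤ 1 ∧
    ∀ s a, ∀ t ∈ M.Succ s a, δ ≤ (M.trans s a t).toReal := by
  classical
  have h : ∀ p : S × A × S, ∃ δ : ℝ, 0 < δ ∧ δ ≤ 1 ∧
      (p.2.2 ∈ M.Succ p.1 p.2.1 → δ ≤ (M.trans p.1 p.2.1 p.2.2).toReal) := by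
    intro p
    by_cases hp : p.2.2 ∈ M.Succ p.1 p.2.1
    · have h0 : 0 < (M.trans p.1 p.2.1 p.2.2).toReal :=
        ENNReal.toReal_pos (ne_of_gt hp) (PMF.apply_ne_top _ _)
      exact ⟨min 1 _, lt_min one_pos h0, min_le_left _ _, fun _ => min_le_right _ _⟩
    · exact ⟨1, one_pos, le_rfl, fun h => absurd h hp⟩
  choose δ h0 h1 h2 using h
  cases nonempty_fintype S
  cases nonempty_fintype A
  -- A product of finitely many numbers in `(0, 1]` is below each factor, so it replaces the
  -- minimum.
  refine ⟨∏ p, δ p, Finset.prod_pos fun p _ => h0 p,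
    Finset.prod_le_one (fun p _ => (h0 p).le) fun p _ => h1 p, fun s a t ht => ?_⟩
  refine le_trans ?_ (h2 (s, a, t) ht)
  rw [← Finset.mul_prod_erase _ _ (Finset.mem_univ (s, a, t))]
  exact mul_le_of_le_one_right (h0 _).le
    (Finset.prod_le_one (fun p _ => (h0 p).le) fun p _ => h1 p)

omit [Finite S] [Finite A] [MeasurableSpace S] [MeasurableSpace A]
  [DiscreteMeasurableSpace S] [DiscreteMeasurableSpace A] in
theorem sum_trans_toReal [Fintype S] (s : S) (a : A) :
    ∑ t, (M.trans s a t).toReal = 1 := by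
  have h := (M.trans s a).tsum_coe
  rw [tsum_fintype] at h
  rw [← ENNReal.toReal_sum fun t _ => PMF.apply_ne_top _ _, h, ENNReal.toReal_one]

/-- If the next state has a chance to be in `T` or to decrease a bounded rank, then `T` is visited
infinitely often almost surely. -/
theorem prob_buchiRuns_eq_one {σ : Strategy S A} {s : S} {T : Finset S} {N : ℕ}
    {rk : History S A → ℕ} (hN : ∀ h, M.CompHist σ s h → rk h ≤ N)
    (hrk : ∀ h, M.CompHist σ s h →
      ∃ t ∈ M.Succ h.last (σ h), t ∈ T ∨ rk (.step h (σ h) t) < rk h) :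
    M.prob σ s (M.BuchiRuns T) = 1 := by
  classical
  cases nonempty_fintype S
  obtain ⟨δ, hδ0, hδ1, hδ⟩ := M.exists_trans_lower_bound
  -- Rank `j` gets the weight `1 - β ^ (j + 1)`. With `β = δ / 2` one has `δ * β ^ j = 2 * β ^ (j +
  -- 1)`: one copy pays for the weight of the present rank, the other for the contraction factor
  -- `θ`.
  set β := δ / 2 with hβ
  have hβ0 : 0 < β := by positivity
  have hβ1 : β ≤ 1 / 2 := by rw [hβ]; linarith
  set g : ℕ → ℝ := fun j => 1 - β ^ (j + 1) with hg
  set θ : ℝ := 1 - β ^ (N + 1) with hθ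
  have hpow : ∀ j, β ^ j ≤ 1 := fun j => pow_le_one₀ hβ0.le (by linarith)
  have hpow0 : ∀ j, 0 < β ^ j := fun j => by positivity
  have hθ0 : 0 ≤ θ := sub_nonneg.2 (hpow _)
  have hg0 : ∀ j, 0 ≤ g j := fun j => sub_nonneg.2 (hpow _)
  have hg1 : ∀ j, g j ≤ 1 := fun j => by have := hpow0 (j + 1); simp only [hg]; linarith
  have hgβ : ∀ j, 1 / 2 ≤ g j := fun j => by
    have : β ^ (j + 1) ≤ β := pow_le_of_le_one hβ0.le (by linarith) (by omega)
    simp only [hg]; linarith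
  -- The expected weight after a step, counted as `0` on `T`, contracts by `θ`: no successor weighs
  -- more than `1`, and the distinguished one weighs at most `1 - β ^ rk h`.
  have key : ∀ h, M.CompHist σ s h →
      ∑ t, (M.trans h.last (σ h) t).toReal * (if t ∈ T then 0 else g (rk (.step h (σ h) t))) ≤
        θ * g (rk h) := by
    intro h hh
    obtain ⟨u, hu, hu'⟩ := hrk h hh
    have hsum := M.sum_trans_toReal h.last (σ h)
    have h1 : ∑ t, (M.trans h.last (σ h) t).toReal *
        (if t ∈ T then 0 else g (rk (.step h (σ h) t))) ≤
        ∑ t, ((M.trans h.last (σ h) t).toReal - if t = u then δ * β ^ (rk h) else 0) := by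
      refine Finset.sum_le_sum fun t _ => ?_
      have hp0 : 0 ≤ (M.trans h.last (σ h) t).toReal := ENNReal.toReal_nonneg
      by_cases htu : t = u
      · subst htu
        have h2 : (if t ∈ T then 0 else g (rk (.step h (σ h) t))) ≤ 1 - β ^ (rk h) := by
          split_ifs with hT
          · exact sub_nonneg.2 (hpow _)
          · have := hu'.resolve_left hT
            have := pow_le_pow_of_le_one hβ0.le (by linarith : β ≤ 1) this
            simp only [hg]
            simp only [Nat.succ_eq_add_one] at this
            linarith
        have h3 := mul_le_mul_of_nonneg_left h2 hp0
        have h4 := mul_le_mul_of_nonneg_right (hδ _ _ _ hu) (hpow0 (rk h)).le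
        simp only [if_true]
        linarith
      · rw [if_neg htu, sub_zero]
        refine mul_le_of_le_one_right hp0 ?_
        split_ifs
        · exact zero_le_one
        · exact hg1 _
    rw [Finset.sum_sub_distrib, hsum, Finset.sum_ite_eq' _ u, if_pos (Finset.mem_univ u)] at h1
    refine h1.trans ?_
    have h5 : δ * β ^ (rk h) = 2 * β ^ (rk h + 1) := by rw [pow_succ, hβ]; ring
    have h6 : β ^ (N + 1) ≤ β ^ (rk h + 1) :=
      pow_le_pow_of_le_one hβ0.le (by linarith) (Nat.succ_le_succ (hN h hh))
    have h7 := mul_pos (hpow0 (N + 1)) (hpow0 (rk h + 1))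
    simp only [hθ, hg, h5]
    nlinarith
  -- As long as `T` is avoided after time `i`, the expected weight decays geometrically; all weights
  -- are at least `1 / 2`, so avoiding `T` forever has probability `0`.
  have main : ∀ i, ∀ᵐ ρ ∂(M.prob σ s), ¬ ∀ m, Avoids T i (History.pref ρ m) := by
    intro i
    set Z : History S A → ℝ≥0∞ := fun h =>
      if Avoids T i h then ENNReal.ofReal (g (rk h)) else 0 with hZ
    have hstep : ∀ m, i ≤ m → ∫⁻ ρ, Z (History.pref ρ (m + 1)) ∂(M.prob σ s) ≤
        ENNReal.ofReal θ * ∫⁻ ρ, Z (History.pref ρ m) ∂(M.prob σ s) := by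
      intro m hm
      rw [M.lintegral_pref_succ, ← lintegral_const_mul _ (measurable_pref _ _)]
      refine lintegral_mono_ae ?_
      filter_upwards [M.ae_comp σ s] with ρ hρ
      have hc := M.compHist_pref hρ m
      have k := key _ hc
      by_cases hav : Avoids T i (History.pref ρ m)
      · have e : ∀ t, M.trans (ρ m).1 (ρ m).2 t * Z (.step (History.pref ρ m) (ρ m).2 t) =
            ENNReal.ofReal ((M.trans (History.pref ρ m).last (σ (History.pref ρ m)) t).toReal *
              (if t ∈ T then 0 else
                g (rk (.step (History.pref ρ m) (σ (History.pref ρ m)) t)))) := by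
          intro t
          rw [ENNReal.ofReal_mul ENNReal.toReal_nonneg,
            ENNReal.ofReal_toReal (PMF.apply_ne_top _ _), History.last_pref, ← hρ.2.2 m]
          congr 1
          by_cases ht : t ∈ T
          · simp [hZ, Avoids, ht, hm]
          · simp [hZ, Avoids, ht, hav]
        rw [Finset.sum_congr rfl fun t _ => e t, ← ENNReal.ofReal_sum_of_nonneg]
        · rw [hZ]
          simp only [if_pos hav]
          rw [← ENNReal.ofReal_mul hθ0]
          exact ENNReal.ofReal_le_ofReal k
        · intro t _
          refine mul_nonneg ENNReal.toReal_nonneg ?_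
          split_ifs
          · exact le_rfl
          · exact hg0 _
      · simp [hZ, Avoids, hav]
    have hpowers : ∀ k, ∫⁻ ρ, Z (History.pref ρ (i + k)) ∂(M.prob σ s) ≤
        ENNReal.ofReal θ ^ k := by
      intro k
      induction k with
      | zero =>
        calc _ ≤ ∫⁻ _, 1 ∂(M.prob σ s) := lintegral_mono fun ρ => by
              simp only [hZ]
              split_ifs
              · exact ENNReal.ofReal_le_one.2 (hg1 _)
              · exact zero_le_one
          _ = _ := by simp
      | succ k ih =>
        rw [pow_succ']
        exact (hstep (i + k) (by omega)).trans (mul_le_mul_right ih _)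
    rw [ae_iff]
    simp only [not_not]
    set D := {ρ : ℕ → S × A | ∀ m, Avoids T i (History.pref ρ m)}
    have hD : ∀ k, ENNReal.ofReal (1 / 2) * M.prob σ s D ≤ ENNReal.ofReal θ ^ k := by
      intro k
      refine le_trans ?_ (hpowers k)
      refine le_trans ?_ (mul_meas_ge_le_lintegral (measurable_pref Z (i + k))
        (ENNReal.ofReal (1 / 2)))
      refine mul_le_mul_right (measure_mono fun ρ hρ => ?_) _
      simp only [Set.mem_ofPred_eq, hZ, if_pos (hρ (i + k))]
      exact ENNReal.ofReal_le_ofReal (hgβ _)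
    have hθ1 : ENNReal.ofReal θ < 1 := by
      rw [ENNReal.ofReal_lt_one]
      have := hpow0 (N + 1)
      linarith
    have := ge_of_tendsto' (ENNReal.tendsto_pow_atTop_nhds_zero_of_lt_one hθ1) hD
    simpa using this
  have hae : ∀ᵐ ρ ∂(M.prob σ s), ρ ∈ M.BuchiRuns T := by
    filter_upwards [M.ae_comp σ s, ae_all_iff.2 main] with ρ hρ hm
    refine ⟨hρ.1, ?_⟩
    rw [Filter.frequently_atTop]
    intro i
    by_contra hne
    push Not at hne
    refine hm i fun m => ?_
    induction m with
    | zero => trivial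
    | succ m ih => exact ⟨ih, fun h => hne (m + 1) (by simp at h; omega)⟩
  exact (measure_congr (Filter.eventuallyEq_univ.2
    (show M.BuchiRuns T ∈ ae (M.prob σ s) from hae))).trans measure_univ

end Probability

end CMDP

/-! ### Fixed point iterations -/

section Iteration

variable {S : Type} {f : (S → ℕ) → S → ℕ} {b : ℕ}

theorem iterate_const_le (hb : ∀ v s, f v s ≤ b) (i : ℕ) (s : S) :
    f^[i] (fun _ => b) s ≤ b := by
  cases i with
  | zero => exact le_rfl
  | succ i => rw [Function.iterate_succ_apply']; exact hb _ _

theorem iterate_const_antitone (hf : Monotone f) (hb : ∀ v s, f v s ≤ b) :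
    Antitone fun i => f^[i] fun _ => b :=
  hf.antitone_iterate_of_map_le fun s => hb _ s

/-- Iterations of operators whose values depend only on the smaller entries are stable after as
many steps as there are entries. -/
theorem iterate_card_le [Fintype S] (hf : Monotone f) (hb : ∀ v s, f v s ≤ b)
    (hsup : ∀ v w s, f v s < b → (∀ t, v t ≤ f v s → w t ≤ v t) → f w s ≤ f v s) (j : ℕ) :
    f^[Fintype.card S] (fun _ => b) ≤ f^[j] fun _ => b := by
  classical
  set v : ℕ → S → ℕ := fun i => f^[i] fun _ => b with hv
  have hanti : Antitone v := iterate_const_antitone hf hb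
  have hsucc : ∀ i, v (i + 1) = f (v i) := fun i => Function.iterate_succ_apply' f i _
  -- The states whose value is final at time `i`; each round adds at least one until all are final.
  set fin : ℕ → Finset S := fun i => Finset.univ.filter fun s => ∀ j, v i s ≤ v j s with hfin
  have hcard : ∀ i, i ≤ Fintype.card S → i ≤ (fin i).card := by
    intro i
    induction i with
    | zero => intro _; exact Nat.zero_le _
    | succ i ih =>
      intro hi
      have hsub : fin i ⊆ fin (i + 1) := by
        intro s hs
        simp only [hfin, Finset.mem_filter, Finset.mem_univ, true_and] at hs ⊢
        exact fun j => (hanti (Nat.le_succ i) s).trans (hs j)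
      by_cases hall : fin i = Finset.univ
      · have : fin (i + 1) = Finset.univ := Finset.univ_subset_iff.1 (hall ▸ hsub)
        rw [this, Finset.card_univ]
        exact hi
      · obtain ⟨s₀, hs₀⟩ : ∃ s, s ∉ fin i := by
          by_contra hc
          push Not at hc
          exact hall (Finset.eq_univ_iff_forall.2 hc)
        -- Among the values that still improve on time `i`, the least one is chosen, and for it the
        -- earliest time at which it appears.
        have hex : ∃ p : ℕ ×ₗ ℕ, ∃ s, v (ofLex p).2 s = (ofLex p).1 ∧ (ofLex p).1 < v i s := by
          simp only [hfin, Finset.mem_filter, Finset.mem_univ, true_and, not_forall,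
            not_le] at hs₀
          obtain ⟨j, hj⟩ := hs₀
          exact ⟨toLex (v j s₀, j), s₀, rfl, hj⟩
        obtain ⟨p, ⟨s, hs1, hs2⟩, hmin⟩ := WellFounded.has_min
          (wellFounded_lt (α := ℕ ×ₗ ℕ))
          {p | ∃ s, v (ofLex p).2 s = (ofLex p).1 ∧ (ofLex p).1 < v i s} hex
        obtain ⟨⟨c, j⟩, rfl⟩ := toLex.surjective p
        simp only [ofLex_toLex] at hs1 hs2
        subst hs1
        have hij : i < j := by
          by_contra hc
          exact absurd (hanti (not_lt.1 hc) s) (not_le.2 hs2)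
        obtain ⟨j, rfl⟩ := Nat.exists_eq_succ_of_ne_zero (by omega : j ≠ 0)
        simp only [Nat.succ_eq_add_one] at *
        have hlt : f (v j) s < b := by
          rw [← hsucc]
          exact hs2.trans_le (iterate_const_le hb _ _)
        have hle : v (i + 1) s ≤ v (j + 1) s := by
          rw [hsucc, hsucc]
          -- An entry at time `j` that is at most the new value is already met at time `i`;
          -- otherwise it would give a lexicographically smaller pair.
          refine hsup _ _ _ hlt fun t ht => ?_
          by_contra hc
          refine hmin (toLex (v j t, j)) ⟨t, rfl, not_le.1 hc⟩ ?_
          rw [Prod.Lex.toLex_lt_toLex]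
          rw [← hsucc] at ht
          rcases ht.lt_or_eq with h | h
          · exact Or.inl h
          · exact Or.inr ⟨h, Nat.lt_succ_self j⟩
        have hs : s ∈ fin (i + 1) := by
          simp only [hfin, Finset.mem_filter, Finset.mem_univ, true_and]
          intro j'
          by_cases hj' : v j' s < v i s
          · refine hle.trans ?_
            by_contra hc
            exact hmin (toLex (v j' s, j')) ⟨s, rfl, hj'⟩
              (Prod.Lex.toLex_lt_toLex.2 (Or.inl (not_le.1 hc)))
          · exact (hanti (Nat.le_succ i) s).trans (not_lt.1 hj')
        have hs' : s ∉ fin i := by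
          simp only [hfin, Finset.mem_filter, Finset.mem_univ, true_and, not_forall, not_le]
          exact ⟨_, hs2⟩
        have := Finset.card_le_card (Finset.insert_subset hs hsub)
        rw [Finset.card_insert_of_notMem hs'] at this
        have := ih (by omega)
        omega
  intro s
  have hu : fin (Fintype.card S) = Finset.univ :=
    (Finset.card_eq_iff_eq_univ _).1 (le_antisymm (Finset.card_le_univ _) (hcard _ le_rfl))
  have hs : s ∈ fin (Fintype.card S) := hu ▸ Finset.mem_univ s
  simp only [hfin, Finset.mem_filter, Finset.mem_univ, true_and] at hs
  exact hs j

/-- An increasing sequence of sets has two equal consecutive terms. -/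
theorem exists_succ_subset [Fintype S] {P : ℕ → Finset S} (hP : Monotone P) :
    ∃ i ≤ Fintype.card S, P (i + 1) = P i := by
  by_contra hc
  push Not at hc
  have h : ∀ i, i ≤ Fintype.card S + 1 → i ≤ (P i).card := by
    intro i
    induction i with
    | zero => intro _; exact Nat.zero_le _
    | succ i ih =>
      intro hi
      have h1 := ih (by omega)
      have h2 := Finset.card_lt_card ((hP (Nat.le_succ i)).lt_of_ne (hc i (by omega)).symm)
      rw [Nat.succ_eq_add_one] at h2
      omega
  have h1 := h _ le_rfl
  have h2 := Finset.card_le_univ (P (Fintype.card S + 1))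
  omega

/-- A decreasing iteration on sets is stable after as many steps as there are elements. -/
theorem iterate_card_fixed [Fintype S] {g : Finset S → Finset S} (hg : ∀ K, g K ⊆ K)
    (K : Finset S) : g (g^[Fintype.card S] K) = g^[Fintype.card S] K := by
  classical
  have hmono : Monotone fun i => (g^[i] K)ᶜ := by
    refine monotone_nat_of_le_succ fun i => ?_
    rw [Function.iterate_succ_apply']
    exact Finset.compl_subset_compl.2 (hg _)
  obtain ⟨i, hi, h⟩ := exists_succ_subset hmono
  have h := compl_injective h
  rw [Function.iterate_succ_apply'] at h
  obtain ⟨j, hj⟩ := Nat.exists_eq_add_of_le' hi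
  have : g^[Fintype.card S] K = g^[i] K := by
    rw [hj, Function.iterate_add_apply]
    exact Function.iterate_fixed h j
  rw [this, h]

end Iteration

/-! ### Safe loads and loads for positive reachability of the target -/

namespace CMDP

section Basic

variable {S A : Type} (M : CMDP S A) (T : Finset S)

/-- Playing `a` in `s` with the load `l` leads only to states whose safe load `v` is met, and
possibly to `T` or to a state where the load `x` is met. -/
def Good (v x : S → ℕ) (s : S) (a : A) (l : ℕ) : Prop :=
  (∀ t ∈ M.Succ s a, M.cons s a + v t ≤ l) ∧ ∃ t ∈ M.Succ s a, t ∈ T ∨ M.cons s a + x t ≤ l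

variable {M T} in
theorem Good.mono {v x v' x' : S → ℕ} {s : S} {a : A} {l l' : ℕ} (h : M.Good T v x s a l)
    (hv : ∀ t, v' t ≤ v t) (hx : ∀ t, x' t ≤ x t) (hl : l ≤ l') : M.Good T v' x' s a l' := by
  obtain ⟨h1, t, ht, h2⟩ := h
  refine ⟨fun u hu => ?_, t, ht, h2.imp id fun h => ?_⟩
  · have := h1 u hu; have := hv u; omega
  · have := hx t; omega

/-- The least load below the capacity that makes some action good, and `cap + 1` if there is
none. -/
noncomputable def best (v x : S → ℕ) (s : S) : ℕ :=
  sInf {l | l = M.cap + 1 ∨ ∃ a, M.Good T v x s a l}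

theorem best_le_succ (v x : S → ℕ) (s : S) : M.best T v x s ≤ M.cap + 1 :=
  Nat.sInf_le (Or.inl rfl)

theorem best_le_iff {v x : S → ℕ} {s : S} {l : ℕ} (hl : l ≤ M.cap) :
    M.best T v x s ≤ l ↔ ∃ a, M.Good T v x s a l := by
  constructor
  · intro h
    have hmem : M.best T v x s ∈ {l | l = M.cap + 1 ∨ ∃ a, M.Good T v x s a l} :=
      Nat.sInf_mem ⟨_, Or.inl rfl⟩
    rcases hmem with h' | ⟨a, ha⟩
    · omega
    · exact ⟨a, ha.mono (fun _ => le_rfl) (fun _ => le_rfl) h⟩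
  · exact fun h => Nat.sInf_le (Or.inr h)

/-- `best` is the only function with the property `best_le_iff`. -/
theorem best_eq {v x : S → ℕ} {s : S} {b : ℕ} (hb : b ≤ M.cap + 1)
    (h : ∀ l ≤ M.cap, b ≤ l ↔ ∃ a, M.Good T v x s a l) : M.best T v x s = b := by
  have h1 := M.best_le_succ T v x s
  apply le_antisymm
  · by_cases hc : b ≤ M.cap
    · exact (M.best_le_iff T hc).2 ((h b hc).1 le_rfl)
    · omega
  · by_cases hc : M.best T v x s ≤ M.cap
    · exact (h _ hc).2 ((M.best_le_iff T hc).1 le_rfl)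
    · omega

theorem best_mono {v x v' x' : S → ℕ} (hv : v ≤ v') (hx : x ≤ x') (s : S) :
    M.best T v x s ≤ M.best T v' x' s := by
  by_cases hc : M.best T v' x' s ≤ M.cap
  · obtain ⟨a, ha⟩ := (M.best_le_iff T hc).1 le_rfl
    exact (M.best_le_iff T hc).2 ⟨a, ha.mono hv hx le_rfl⟩
  · exact (M.best_le_succ T v x s).trans (by omega)

end Basic

section Steps

variable {S A : Type} [DecidableEq S] (M : CMDP S A) (T K : Finset S)

/-- One step of the iteration for the safe loads, when only the reload states in `K` are kept. -/
noncomputable def safeStep (v : S → ℕ) (s : S) : ℕ :=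
  if s ∈ M.reload then (if s ∈ K then 0 else M.cap + 1) else M.best T v v s

/-- One step of the iteration for positive reachability of `T`, given the safe loads `v`. -/
noncomputable def posStep (v x : S → ℕ) (s : S) : ℕ :=
  if s ∈ M.reload then (if s ∈ K ∧ M.best T v x s ≤ M.cap then 0 else M.cap + 1)
  else M.best T v x s

theorem safeStep_le (v : S → ℕ) (s : S) : M.safeStep T K v s ≤ M.cap + 1 := by
  have := M.best_le_succ T v v s
  unfold safeStep
  split_ifs <;> omega

theorem posStep_le (v x : S → ℕ) (s : S) : M.posStep T K v x s ≤ M.cap + 1 := by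
  have := M.best_le_succ T v x s
  unfold posStep
  split_ifs <;> omega

theorem safeStep_mono : Monotone (M.safeStep T K) := by
  intro v w h s
  have := M.best_mono T h h s
  simp only [safeStep]
  split_ifs <;> first | exact le_rfl | exact this

theorem posStep_mono (v : S → ℕ) : Monotone (M.posStep T K v) := by
  intro x y h s
  have h1 := M.best_mono T le_rfl h s (v := v)
  by_cases hs : s ∈ M.reload
  · by_cases hy : s ∈ K ∧ M.best T v y s ≤ M.cap
    · simp [posStep, hs, hy, h1.trans hy.2]
    · have := M.posStep_le T K v x s
      simpa [posStep, hs, hy] using this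
  · simpa [posStep, hs] using h1

end Steps

section Iterates

variable {S A : Type} [DecidableEq S] [Fintype S] (M : CMDP S A) (T K : Finset S)

omit [Fintype S] in
/-- The iterates for the safe loads. -/
noncomputable def safeIter (i : ℕ) : S → ℕ := (M.safeStep T K)^[i] fun _ => M.cap + 1

/-- The safe loads. -/
noncomputable def safeVal : S → ℕ := M.safeIter T K (Fintype.card S)

/-- The iterates for positive reachability of `T`. -/
noncomputable def posIter (j : ℕ) : S → ℕ :=
  (M.posStep T K (M.safeVal T K))^[j] fun _ => M.cap + 1

/-- The number of steps of the iteration for positive reachability. -/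
abbrev rounds (S : Type) [Fintype S] : ℕ := (Fintype.card S + 1) * (Fintype.card S + 1)

/-- The loads for positive reachability of `T`. -/
noncomputable def posVal : S → ℕ := M.posIter T K (rounds S)

/-- The reload states in `K` from which `T` is reachable. -/
noncomputable def prune : Finset S := K.filter fun s => M.posVal T K s ≤ M.cap

/-- The reload states that are kept in the end. -/
noncomputable def kept : Finset S := (M.prune T)^[Fintype.card S] M.reload

theorem prune_kept : M.prune T (M.kept T) = M.kept T :=
  iterate_card_fixed (fun _ => Finset.filter_subset _ _) _

omit [Fintype S] in
theorem safeIter_succ (i : ℕ) :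
    M.safeIter T K (i + 1) = M.safeStep T K (M.safeIter T K i) :=
  Function.iterate_succ_apply' _ _ _

theorem posIter_succ (j : ℕ) :
    M.posIter T K (j + 1) = M.posStep T K (M.safeVal T K) (M.posIter T K j) :=
  Function.iterate_succ_apply' _ _ _

theorem posIter_le (j : ℕ) (s : S) : M.posIter T K j s ≤ M.cap + 1 :=
  iterate_const_le (fun x s => M.posStep_le T K _ x s) j s

theorem posIter_antitone : Antitone (M.posIter T K) :=
  iterate_const_antitone (M.posStep_mono T K _) fun x s => M.posStep_le T K _ x s

theorem posIter_le_of_le {i j : ℕ} (h : i ≤ j) (s : S) :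
    M.posIter T K j s ≤ M.posIter T K i s :=
  M.posIter_antitone T K h s

/-- At a state that is not a reload state, the optimal action involves only entries below the value
that it yields, so `iterate_card_le` applies: `|S|` rounds reach the limit whatever `cap` is. -/
theorem safeVal_le_iter (j : ℕ) : M.safeVal T K ≤ M.safeIter T K j := by
  refine iterate_card_le (M.safeStep_mono T K) (M.safeStep_le T K) ?_ j
  intro v w s hlt h
  by_cases hs : s ∈ M.reload
  · simp [safeStep, hs]
  · simp only [safeStep, hs, if_false] at *
    have hc : M.best T v v s ≤ M.cap := by omega
    obtain ⟨a, h1, t, ht, h2⟩ := (M.best_le_iff T hc).1 le_rfl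
    refine (M.best_le_iff T hc).2 ⟨a, fun u hu => ?_, t, ht, Or.inr ?_⟩
    · have := h1 u hu
      have := h u (by omega)
      omega
    · have := h1 t ht
      have := h t (by omega)
      omega

theorem safeStep_safeVal : M.safeStep T K (M.safeVal T K) = M.safeVal T K := by
  apply le_antisymm
  · have h := iterate_const_antitone (M.safeStep_mono T K) (M.safeStep_le T K)
      (Nat.le_succ (Fintype.card S))
    simp only [Function.iterate_succ_apply'] at h
    exact h
  · have h := M.safeVal_le_iter T K (Fintype.card S + 1)
    rwa [safeIter_succ] at h

/-- A reload state drops to `0` on account of larger entries, so `iterate_card_le` does not apply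
directly. Cut the iteration into blocks of `n + 1` rounds. In one of the first `n + 1` blocks no
further reload state drops; there the reload states can be frozen, and the resulting operator `g`
stabilises within `n` rounds. Its limit `w` turns out to be below all iterates. -/
theorem posVal_le_iter (j : ℕ) : M.posVal T K ≤ M.posIter T K j := by
  set v := M.safeVal T K with hv
  set n := Fintype.card S with hn
  set P : ℕ → Finset S := fun i =>
    K.filter fun s => s ∈ M.reload ∧ M.posIter T K (i * (n + 1)) s ≤ M.cap with hP
  have hPmono : Monotone P := by
    intro i i' h s
    simp only [hP, Finset.mem_filter]
    exact fun ⟨h1, h2, h3⟩ =>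
      ⟨h1, h2, (M.posIter_antitone T K (Nat.mul_le_mul_right (n + 1) h) s).trans h3⟩
  obtain ⟨i, hi, hPi⟩ := exists_succ_subset hPmono
  set m := i * (n + 1) with hm
  set g : (S → ℕ) → S → ℕ := fun x s =>
    if s ∈ M.reload then (if s ∈ P i then 0 else M.cap + 1) else M.best T v x s with hg
  have hgmono : Monotone g := by
    intro x y h s
    have := M.best_mono T le_rfl h s (v := v)
    simp only [hg]
    split_ifs <;> first | exact le_rfl | exact this
  have hgle : ∀ x s, g x s ≤ M.cap + 1 := by
    intro x s
    have := M.best_le_succ T v x s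
    simp only [hg]
    split_ifs <;> omega
  set w := g^[n] fun _ => M.cap + 1 with hw
  have hwg : w ≤ g w := by
    have := iterate_card_le hgmono hgle (fun x y s hlt h => ?_) (n + 1)
    · rwa [Function.iterate_succ_apply'] at this
    · by_cases hs : s ∈ M.reload
      · simp [hg, hs]
      · simp only [hg, hs, if_false] at *
        have hc : M.best T v x s ≤ M.cap := by omega
        obtain ⟨a, h1, t, ht, h2⟩ := (M.best_le_iff T hc).1 le_rfl
        refine (M.best_le_iff T hc).2 ⟨a, h1, t, ht, h2.imp id fun h2 => ?_⟩
        have := h t (by omega)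
        omega
  have hzero : ∀ r ∈ P i, ∀ k, m ≤ k → M.posIter T K k r = 0 := by
    intro r hr k hk
    simp only [hP, Finset.mem_filter] at hr
    have h1 := (M.posIter_antitone T K hk r).trans hr.2.2
    cases k with
    | zero =>
      change M.cap + 1 ≤ M.cap at h1
      omega
    | succ k =>
      rw [posIter_succ] at h1 ⊢
      unfold posStep at h1 ⊢
      rw [if_pos hr.2.1] at h1 ⊢
      by_cases hc : r ∈ K ∧ M.best T (M.safeVal T K) (M.posIter T K k) r ≤ M.cap
      · rw [if_pos hc]
      · rw [if_neg hc] at h1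
        exact absurd h1 (Nat.not_succ_le_self _)
  have hupper : ∀ k, M.posIter T K (m + k) ≤ g^[k] fun _ => M.cap + 1 := by
    intro k
    induction k with
    | zero => exact fun s => M.posIter_le T K _ s
    | succ k ih =>
      intro s
      rw [Function.iterate_succ_apply']
      simp only [hg]
      by_cases hs : s ∈ M.reload
      · rw [if_pos hs]
        split_ifs with hp
        · exact (hzero s hp _ (by omega)).le
        · exact M.posIter_le T K _ s
      · rw [if_neg hs, ← add_assoc, posIter_succ]
        simp only [posStep, hs, if_false]
        exact M.best_mono T le_rfl ih s
  have hlower : ∀ j, w ≤ M.posIter T K j := by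
    intro j
    induction j with
    | zero => exact fun s => iterate_const_le hgle _ _
    | succ j ih =>
      intro s
      refine (hwg s).trans ?_
      rw [posIter_succ]
      by_cases hs : s ∈ M.reload
      · simp only [hg, posStep, hs, if_true]
        by_cases hp : s ∈ P i
        · simp [hp]
        · rw [if_neg hp, if_neg]
          -- Such a state would also have `best` at most `cap` in round `m + n`, whose entries are
          -- below `w`; it would drop by round `m + n + 1`, the end of the block, against the choice
          -- of `i`.
          rintro ⟨hK, hb⟩
          apply hp
          rw [← hPi]
          simp only [hP, Finset.mem_filter]
          refine ⟨hK, hs, ?_⟩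
          have e : (i + 1) * (n + 1) = m + n + 1 := by rw [hm]; ring
          rw [e, posIter_succ]
          have hle : M.best T v (M.posIter T K (m + n)) s ≤ M.cap :=
            (M.best_mono T le_rfl ((hupper n).trans ih) s).trans hb
          simp [posStep, hs, hK, ← hv, hle]
      · simp only [hg, posStep, hs, if_false]
        exact M.best_mono T le_rfl ih s
  refine le_trans (le_trans (M.posIter_antitone T K ?_) (hupper n)) (hlower j)
  have : m ≤ n * (n + 1) := Nat.mul_le_mul_right _ hi
  simp only [rounds]
  nlinarith

theorem posStep_posVal : M.posStep T K (M.safeVal T K) (M.posVal T K) = M.posVal T K := by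
  apply le_antisymm
  · have h := M.posIter_antitone T K (Nat.le_succ (rounds S))
    simp only [Nat.succ_eq_add_one, posIter_succ] at h
    exact h
  · have h := M.posVal_le_iter T K (rounds S + 1)
    rwa [posIter_succ] at h

end Iterates

end CMDP

namespace CMDP

/-! ### Paths without consumption in decreasing CMDPs -/

section ZeroCost

variable {S A : Type} (M : CMDP S A)

/-- There is an action without consumption that may lead from the second state to the first. -/
def ZeroStep (t s : S) : Prop := ∃ a, M.cons s a = 0 ∧ t ∈ M.Succ s a

/-- Paths without consumption. -/
def IsZeroPath (h : History S A) : Prop :=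
  M.IsPath h ∧ ∀ p ∈ h.steps, M.cons p.1 p.2 = 0

variable {M}

theorem IsZeroPath.exists_suffix {h : History S A} (hz : M.IsZeroPath h) {t : S}
    (ht : t ∈ h.steps.map Prod.fst ++ [h.last]) :
    ∃ g, M.IsZeroPath g ∧ g.first = t ∧ g.last = h.last ∧ g.steps <:+ h.steps := by
  induction h with
  | start s =>
    simp only [History.steps, History.last, List.map_nil, List.nil_append,
      List.mem_singleton] at ht
    subst ht
    exact ⟨.start t, hz, rfl, rfl, List.suffix_rfl⟩
  | step h a u ih =>
    obtain ⟨⟨hp, hu⟩, hc⟩ := hz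
    rw [List.mem_append, List.mem_singleton] at ht
    rcases ht with ht | rfl
    · simp only [History.steps, List.map_append, List.map_cons, List.map_nil] at ht
      obtain ⟨g, ⟨g1, g2⟩, g3, g4, g5⟩ :=
        ih ⟨hp, fun p hp => hc p (by simp [History.steps, hp])⟩ ht
      have h6 : (History.step g a u).steps <:+ (History.step h a u).steps := by
        simp only [History.steps, g4]
        obtain ⟨l, hl⟩ := g5
        exact ⟨l, by rw [← List.append_assoc, hl]⟩
      exact ⟨.step g a u, ⟨⟨g1, g4 ▸ hu⟩, fun p hp => hc p (h6.mem hp)⟩, g3, rfl, h6⟩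
    · exact ⟨.start t, ⟨trivial, by simp [History.steps]⟩, rfl, rfl, List.nil_suffix⟩

/-- If the last state has occurred before, the part from that occurrence on is a cycle without
consumption; it is simple by the induction hypothesis, so `Decreasing` excludes it. -/
theorem IsZeroPath.nodup (hM : M.Decreasing) {h : History S A} (hz : M.IsZeroPath h) :
    (h.steps.map Prod.fst ++ [h.last]).Nodup := by
  induction h with
  | start s => simp [History.steps]
  | step h a t ih =>
    have hz' : M.IsZeroPath h := ⟨hz.1.1, fun p hp => hz.2 p (by simp [History.steps, hp])⟩
    have hn := ih hz'
    simp only [History.steps, History.last, List.map_append, List.map_cons, List.map_nil]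
    rw [List.nodup_append']
    refine ⟨hn, List.nodup_singleton t, ?_⟩
    rw [List.disjoint_singleton]
    intro ht
    obtain ⟨g, g1, g2, g3, g4⟩ := hz'.exists_suffix ht
    obtain ⟨p, hp, hpos⟩ := hM (.step g a t) ⟨g1.1, g3 ▸ hz.1.2⟩ (by simp [History.steps]) g2
      (by
        simp only [History.steps, List.map_append, List.map_cons, List.map_nil, g3]
        obtain ⟨l, hl⟩ := g4
        rw [← hl, List.map_append, List.append_assoc] at hn
        exact (List.nodup_append'.1 hn).2.1)
    simp only [History.steps, List.mem_append, List.mem_singleton] at hp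
    have : M.cons p.1 p.2 = 0 := by
      rcases hp with hp | rfl
      · exact g1.2 p hp
      · exact hz.2 _ (by simp [History.steps, g3])
    omega

theorem first_mem_steps {h : History S A} (hs : h.steps ≠ []) :
    h.first ∈ h.steps.map Prod.fst := by
  induction h with
  | start s => exact absurd rfl hs
  | step h a t ih =>
    simp only [History.steps, History.first, List.map_append, List.mem_append]
    cases h with
    | start s => right; simp [History.first, History.last]
    | step h b u => exact Or.inl (ih (by simp [History.steps]))

theorem exists_isZeroPath {s t : S} (h : Relation.TransGen M.ZeroStep t s) :
    ∃ g : History S A, M.IsZeroPath g ∧ g.first = s ∧ g.last = t ∧ g.steps ≠ [] := by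
  induction h using Relation.TransGen.head_induction_on with
  | single h =>
    rename_i t
    obtain ⟨a, h1, h2⟩ := h
    exact ⟨.step (.start s) a t, ⟨⟨trivial, h2⟩, by simp [History.steps, History.last, h1]⟩,
      rfl, rfl, by simp [History.steps]⟩
  | head h _ ih =>
    rename_i t u _
    obtain ⟨a, h1, h2⟩ := h
    obtain ⟨g, g1, g2, rfl, g4⟩ := ih
    refine ⟨.step g a t, ⟨⟨g1.1, h2⟩, fun p hp => ?_⟩, g2, rfl, by simp [History.steps]⟩
    simp only [History.steps, List.mem_append, List.mem_singleton] at hp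
    rcases hp with hp | rfl
    · exact g1.2 p hp
    · exact h1

/-- A cycle of zero steps would be a zero path with a repeated state. The smaller element of
`ZeroStep` is the successor, so induction may assume a claim for the states reached next without
consumption. -/
theorem wellFounded_zeroStep [Finite S] (hM : M.Decreasing) : WellFounded M.ZeroStep := by
  have : Std.Irrefl (Relation.TransGen M.ZeroStep) := ⟨fun s h => by
    obtain ⟨g, g1, g2, g3, g4⟩ := exists_isZeroPath h
    have hn := g1.nodup hM
    have h1 := first_mem_steps g4
    rw [List.nodup_append'] at hn
    exact (List.disjoint_singleton.1 hn.2.2) (by rw [g3, ← g2]; exact h1)⟩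
  exact Subrelation.wf (fun h => Relation.TransGen.single h)
    (Finite.wellFounded_of_trans_of_irrefl (Relation.TransGen M.ZeroStep))

end ZeroCost

section Levels

variable {S A : Type} [DecidableEq S] (M : CMDP S A)

/-- The load that is available in the state `s` at the level `l`. -/
def available (s : S) (l : ℕ) : ℕ := if s ∈ M.reload then M.cap else l

/-- The additive form keeps truncated subtraction out of the later arguments; exhaustion means that
no such `l'` exists. -/
theorem levelStep_eq_some {s : S} {a : A} {l l' : M.Level} :
    M.levelStep s a (some l) = some l' ↔ M.cons s a + l' = M.available s l := by
  unfold levelStep available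
  simp only
  split_ifs with h1 h2 h2
  · simp only [Option.some.injEq, Fin.ext_iff]; omega
  · simp only [false_iff]; omega
  · simp only [Option.some.injEq, Fin.ext_iff]; omega
  · simp only [false_iff]; omega

theorem available_le (s : S) (l : M.Level) : M.available s l ≤ M.cap := by
  unfold available
  split_ifs <;> omega

end Levels

/-! ### Necessity: levels under a winning strategy dominate the computed loads -/

section Completeness

variable {S A : Type} [DecidableEq S] [Finite S] [Finite A] [MeasurableSpace S]
  [MeasurableSpace A] [DiscreteMeasurableSpace S] [DiscreteMeasurableSpace A] {M : CMDP S A}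
  {T : Finset S} {d : M.Level} {s : S} {σ : Strategy S A}

omit [DecidableEq S] in
-- Needed to turn probability `1` into an almost sure statement.
theorem measurableSet_buchiRuns (M : CMDP S A) (T : Finset S) :
    MeasurableSet (M.BuchiRuns T) := by
  have : M.BuchiRuns T = (⋂ i, {ρ : ℕ → S × A | (ρ (i + 1)).1 ∈ M.Succ (ρ i).1 (ρ i).2}) ∩
      ⋂ i, ⋃ j, ⋃ (_ : i ≤ j), {ρ : ℕ → S × A | (ρ j).1 ∈ T} := by
    ext ρ
    simp [BuchiRuns, IsRun, Filter.frequently_atTop]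
  rw [this]
  refine (MeasurableSet.iInter fun i => ?_).inter (MeasurableSet.iInter fun i =>
    MeasurableSet.iUnion fun j => MeasurableSet.iUnion fun _ => ?_)
  · have h : Measurable fun ρ : ℕ → S × A => (ρ (i + 1), ρ i) := by fun_prop
    exact h (t := {p | p.1.1 ∈ M.Succ p.2.1 p.2.2}) (MeasurableSet.of_discrete)
  · have h : Measurable fun ρ : ℕ → S × A => ρ j := by fun_prop
    exact h (t := {p | p.1 ∈ T}) (MeasurableSet.of_discrete)

/-- A compatible path has positive probability, so some continuation of it shares the almost sure
behaviour. -/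
theorem IsBuchiSafe.exists_run (hσ : M.IsBuchiSafe T d s σ) {h : History S A}
    (hc : M.CompHist σ s h) :
    ∃ ρ ∈ M.Comp σ s, ρ ∈ M.BuchiRuns T ∧ History.pref ρ h.length = h :=
  M.exists_comp_of_ae hc
    ((MeasureTheory.mem_ae_iff_prob_eq_one (measurableSet_buchiRuns M T)).2 hσ.2)

theorem IsBuchiSafe.exists_level (hσ : M.IsBuchiSafe T d s σ) {h : History S A}
    (hc : M.CompHist σ s h) : ∃ l, M.level d h = some l := by
  obtain ⟨ρ, h1, -, h2⟩ := hσ.exists_run hc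
  rw [← h2]
  exact Option.ne_none_iff_exists'.1 ((hσ.1 h1).2 _)

variable [Fintype S] {K : Finset S}

/-- Induction on the level and, within a level, along `ZeroStep`: a step with consumption lowers the
level, a step without it descends in a well-founded relation, and reload states stop the descent
because they lie in `K`. The bounds at the successors then give the bound at the present state
through the fixed point equation. -/
theorem IsBuchiSafe.safeVal_le (hσ : M.IsBuchiSafe T d s σ) (hM : M.Decreasing)
    (hK : ∀ h, M.CompHist σ s h → h.last ∈ M.reload → h.last ∈ K) :
    ∀ (n : ℕ) (u : S) (h : History S A), M.CompHist σ s h → h.last = u →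
      ∀ l : M.Level, M.level d h = some l → (l : ℕ) = n → M.safeVal T K u ≤ n := by
  intro n
  induction n using Nat.strong_induction_on with
  | _ n ihn =>
  intro u
  induction u using (wellFounded_zeroStep hM).induction with
  | _ u ihu =>
  intro h hc hu l hl hn
  rw [← M.safeStep_safeVal]
  by_cases hr : u ∈ M.reload
  · simp [safeStep, hr, hu ▸ hK h hc (hu ▸ hr)]
  · simp only [safeStep, hr, if_false]
    refine (M.best_le_iff T (by omega)).2 ⟨σ h, ?_⟩
    have hall : ∀ t ∈ M.Succ u (σ h), M.cons u (σ h) + M.safeVal T K t ≤ n := by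
      intro t ht
      have hc' : M.CompHist σ s (.step h (σ h) t) := ⟨hc, rfl, hu ▸ ht⟩
      obtain ⟨l', hl'⟩ := hσ.exists_level hc'
      have he : M.levelStep h.last (σ h) (M.level d h) = some l' := hl'
      rw [hl, levelStep_eq_some, hu] at he
      simp only [available, hr, if_false] at he
      by_cases h0 : M.cons u (σ h) = 0
      · have := ihu t ⟨_, h0, ht⟩ _ hc' rfl l' hl' (by omega)
        omega
      · have := ihn (l' : ℕ) (by omega) t _ hc' rfl l' hl' rfl
        omega
    -- With both load vectors equal, the second half of `Good` follows from the first at any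
    -- successor.
    obtain ⟨t, ht⟩ := (M.trans u (σ h)).support_nonempty
    have ht : t ∈ M.Succ u (σ h) := pos_iff_ne_zero.2 ht
    exact ⟨hall, t, ht, Or.inr (hall t ht)⟩

/-- Backward induction along one run from its visit of `T` at time `m`; the other successors are
covered by `safeVal_le`. The visit has to be strictly later than `i`, since `Good` speaks of
successors only. -/
theorem IsBuchiSafe.posVal_le (hσ : M.IsBuchiSafe T d s σ) (hM : M.Decreasing)
    (hK : ∀ h, M.CompHist σ s h → h.last ∈ M.reload → h.last ∈ K) {ρ : ℕ → S × A}
    (hρ : ρ ∈ M.Comp σ s) {m : ℕ} (hm : (ρ m).1 ∈ T) (k : ℕ) :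
    ∀ i, i + k + 1 = m → ∀ l : M.Level, M.level d (History.pref ρ i) = some l →
      M.posVal T K (ρ i).1 ≤ l := by
  induction k with
  | zero =>
    intro i hi l hl
    exact posVal_le_aux i l hl (Or.inl (by rwa [← hi] at hm))
  | succ k ih =>
    intro i hi l hl
    exact posVal_le_aux i l hl (Or.inr (ih (i + 1) (by omega)))
where
  posVal_le_aux (i : ℕ) (l : M.Level) (hl : M.level d (History.pref ρ i) = some l)
    (hnext : (ρ (i + 1)).1 ∈ T ∨ ∀ l' : M.Level, M.level d (History.pref ρ (i + 1)) = some l' →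
      M.posVal T K (ρ (i + 1)).1 ≤ l') : M.posVal T K (ρ i).1 ≤ l := by
    have hc := M.compHist_pref hρ i
    have ha := hρ.2.2 i
    have hgood : M.Good T (M.safeVal T K) (M.posVal T K) (ρ i).1 (ρ i).2
        (M.available (ρ i).1 l) := by
      have hsucc : ∀ t ∈ M.Succ (ρ i).1 (ρ i).2, ∃ l' : M.Level,
          M.level d (.step (History.pref ρ i) (ρ i).2 t) = some l' ∧
          M.CompHist σ s (.step (History.pref ρ i) (ρ i).2 t) ∧
          M.cons (ρ i).1 (ρ i).2 + l' = M.available (ρ i).1 l := by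
        intro t ht
        have hc' : M.CompHist σ s (.step (History.pref ρ i) (ρ i).2 t) :=
          ⟨hc, ha, by simpa using ht⟩
        obtain ⟨l', hl'⟩ := hσ.exists_level hc'
        refine ⟨l', hl', hc', ?_⟩
        have he : M.levelStep (History.pref ρ i).last (ρ i).2 (M.level d (History.pref ρ i)) =
          some l' := hl'
        rwa [hl, levelStep_eq_some, History.last_pref] at he
      refine ⟨fun t ht => ?_, (ρ (i + 1)).1, hρ.1 i, ?_⟩
      · obtain ⟨l', h1, h2, h3⟩ := hsucc t ht
        have := hσ.safeVal_le hM hK _ _ _ h2 rfl l' h1 rfl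
        simp only [History.last] at this
        omega
      · obtain ⟨l', h1, h2, h3⟩ := hsucc _ (hρ.1 i)
        exact hnext.imp id fun h => by have := h l' h1; omega
    rw [← M.posStep_posVal]
    by_cases hr : (ρ i).1 ∈ M.reload
    · have hk : (ρ i).1 ∈ K := by simpa using hK _ hc (by simpa using hr)
      have hb : M.best T (M.safeVal T K) (M.posVal T K) (ρ i).1 ≤ M.cap :=
        (M.best_le_iff T le_rfl).2 ⟨_, hgood.mono (fun _ => le_rfl) (fun _ => le_rfl)
          (M.available_le _ _)⟩
      simp [posStep, hr, hk, hb]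
    · simp only [posStep, hr, if_false]
      refine (M.best_le_iff T (by omega)).2 ⟨(ρ i).2, ?_⟩
      simpa [available, hr] using hgood

/-- From a visited reload state some compatible run goes on to `T`, so `posVal` is at most a genuine
level there, and a level never exceeds `cap`. -/
theorem IsBuchiSafe.mem_prune (hσ : M.IsBuchiSafe T d s σ) (hM : M.Decreasing)
    (hK : ∀ h, M.CompHist σ s h → h.last ∈ M.reload → h.last ∈ K) :
    ∀ h, M.CompHist σ s h → h.last ∈ M.reload → h.last ∈ M.prune T K := by
  intro h hc hr
  obtain ⟨ρ, h1, h2, h3⟩ := hσ.exists_run hc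
  obtain ⟨l, hl⟩ := hσ.exists_level hc
  obtain ⟨m, hm, hT⟩ := Filter.frequently_atTop.1 h2.2 (h.length + 1)
  obtain ⟨k, rfl⟩ := Nat.exists_eq_add_of_le hm
  have := hσ.posVal_le hM hK h1 hT k h.length (by omega) l (by rw [h3, hl])
  rw [← History.last_pref, h3] at this
  exact Finset.mem_filter.2 ⟨hK h hc hr, by omega⟩

/-- If a strategy satisfies the objective, then the initial load is at least the safe load. -/
theorem IsBuchiSafe.safeVal_kept_le (hσ : M.IsBuchiSafe T d s σ) (hM : M.Decreasing) :
    M.safeVal T (M.kept T) s ≤ d := by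
  have h : ∀ i, ∀ h, M.CompHist σ s h → h.last ∈ M.reload →
      h.last ∈ (M.prune T)^[i] M.reload := by
    intro i
    induction i with
    | zero => exact fun _ _ h => h
    | succ i ih =>
      rw [Function.iterate_succ_apply']
      exact hσ.mem_prune hM ih
  exact hσ.safeVal_le hM (h _) _ _ (.start s) rfl rfl d rfl rfl

end Completeness

/-! ### Sufficiency: the selector read off the iteration is winning -/

section Soundness

variable {S A : Type} [DecidableEq S] [Fintype S] {M : CMDP S A} {T K : Finset S}

/-- Compare with each iterate of the safe loads. A reload state in `K` survives pruning, so its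
`posVal` is `0`; outside the reload states both operators are `best`. Thus a safe level always
permits progress towards `T`. -/
theorem posVal_le_safeVal (hK : M.prune T K = K) : M.posVal T K ≤ M.safeVal T K := by
  have h : ∀ i, M.posVal T K ≤ M.safeIter T K i := by
    intro i
    induction i with
    | zero => exact fun s => M.posIter_le T K _ s
    | succ i ih =>
      intro s
      rw [safeIter_succ]
      by_cases hr : s ∈ M.reload
      · by_cases hs : s ∈ K
        · have hle : M.posVal T K s ≤ M.cap := by
            rw [← hK] at hs
            exact (Finset.mem_filter.1 hs).2
          rw [← M.posStep_posVal] at hle ⊢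
          simp only [posStep, safeStep, hr, hs, if_true, true_and] at hle ⊢
          split_ifs at hle ⊢
          · exact le_rfl
          · exact absurd hle (Nat.not_succ_le_self _)
        · exact (M.posIter_le T K _ s).trans_eq (by simp [safeStep, hr, hs])
      · rw [← M.posStep_posVal]
        simp only [posStep, safeStep, hr, if_false]
        exact M.best_mono T (M.safeVal_le_iter T K i) ih s
  exact h _

/-- The counter selector picks good actions of the iteration for positive reachability. -/
structure IsSelectorFor (M : CMDP S A) (T K : Finset S) (Γ : M.CounterSelector) : Prop where
  good : ∀ s l a, Γ s l = some a → ∃ j, M.posIter T K (j + 1) s = l ∧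
    (l : ℕ) < M.posIter T K j s ∧
    M.Good T (M.safeVal T K) (M.posIter T K j) s a
      (M.best T (M.safeVal T K) (M.posIter T K j) s)
  isSome : ∀ s, ∀ j < rounds S, ∀ l : M.Level, M.posIter T K (j + 1) s = l →
    (l : ℕ) < M.posIter T K j s → (Γ s l).isSome

/-- The number of steps after which the iteration allows the level `l` in the state `s`. -/
noncomputable def rank (M : CMDP S A) (T K : Finset S) (s : S) (l : ℕ) : ℕ :=
  sInf {j | M.posIter T K j s ≤ l}

/-- The domain of `Γ s` consists of values to which the antitone iterates drop. The largest one up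
to `l` is the value in round `rank`, and the action stored there is good for the values of the round
before. -/
theorem IsSelectorFor.select {Γ : M.CounterSelector} (hΓ : M.IsSelectorFor T K Γ) (a₀ : A)
    {s : S} {l : M.Level} (hl : M.posVal T K s ≤ l) :
    ∃ j, M.rank T K s l = j + 1 ∧ M.Good T (M.safeVal T K) (M.posIter T K j) s
      (SelectionRule.select (Γ s) a₀ (some l)) (M.available s l) := by
  have hle : M.posIter T K (M.rank T K s l) s ≤ l :=
    Nat.sInf_mem (s := {j | M.posIter T K j s ≤ l}) ⟨_, hl⟩
  have hN : M.rank T K s l ≤ rounds S := Nat.sInf_le (m := rounds S) hl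
  obtain ⟨j, hj⟩ : ∃ j, M.rank T K s l = j + 1 := by
    refine Nat.exists_eq_succ_of_ne_zero fun h0 => ?_
    rw [h0] at hle
    have : M.cap + 1 ≤ l := hle
    omega
  rw [hj] at hle hN
  have hlt : (l : ℕ) < M.posIter T K j s := by
    by_contra hc
    have : M.rank T K s l ≤ j := Nat.sInf_le (not_lt.1 hc)
    omega
  refine ⟨j, hj, ?_⟩
  set n : M.Level := ⟨M.posIter T K (j + 1) s, by omega⟩ with hn
  have hnsome := hΓ.isSome s j (by omega) n rfl (by simp only [hn]; omega)
  set D := Finset.univ.filter fun n : M.Level => (Γ s n).isSome ∧ n ≤ l with hD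
  have hnD : n ∈ D := by
    simp only [hD, Finset.mem_filter, Finset.mem_univ, true_and]
    exact ⟨hnsome, hle⟩
  -- An element of the domain up to `l` is a value from the round of the rank or a later one, hence
  -- at most `n`.
  have hmax : D.max' ⟨n, hnD⟩ = n := by
    refine le_antisymm (Finset.max'_le _ _ _ fun n' hn' => ?_) (Finset.le_max' _ _ hnD)
    simp only [hD, Finset.mem_filter, Finset.mem_univ, true_and] at hn'
    obtain ⟨a, ha⟩ := Option.isSome_iff_exists.1 hn'.1
    obtain ⟨j', h1, h2, -⟩ := hΓ.good _ _ _ ha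
    have h3 : (n' : ℕ) ≤ l := hn'.2
    have h4 : M.rank T K s l ≤ j' + 1 := Nat.sInf_le (m := j' + 1) (by
      simp only [Set.mem_ofPred_eq]; omega)
    have := M.posIter_le_of_le T K (by omega : j + 1 ≤ j' + 1) s
    rw [Fin.le_def]
    simp only [hn]
    omega
  obtain ⟨a, ha⟩ := Option.isSome_iff_exists.1 hnsome
  have hsel : SelectionRule.select (Γ s) a₀ (some l) = a := by
    simp only [SelectionRule.select]
    rw [dif_pos ⟨n, hnD⟩, hmax, ha, Option.getD_some]
  obtain ⟨j', h1, h2, h3⟩ := hΓ.good _ _ _ ha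
  -- The iterates drop to a given value only once, so the stored action belongs to this very round.
  have hjj : j' = j := by
    have h4 : M.rank T K s l ≤ j' + 1 := Nat.sInf_le (m := j' + 1) (by
      simp only [Set.mem_ofPred_eq]; simp only [hn] at h1; omega)
    by_contra hc
    have := M.posIter_le_of_le T K (by omega : j + 1 ≤ j') s
    simp only [hn] at h2
    omega
  subst hjj
  rw [hsel]
  refine h3.mono (fun _ => le_rfl) (fun _ => le_rfl) ?_
  -- In a reload state the stored level is `0`, but the action is paid from the full capacity.
  by_cases hr : s ∈ M.reload
  · simp only [available, hr, if_true]
    have h5 : M.posIter T K (j' + 1) s ≤ M.cap := by omega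
    rw [posIter_succ] at h5
    simp only [posStep, hr, if_true] at h5
    split_ifs at h5 with h6
    · exact h6.2
    · exact absurd h5 (Nat.not_succ_le_self _)
  · rw [posIter_succ] at hle
    simpa [posStep, available, hr] using hle

omit [Fintype S] in
theorem updateStar_counterStructure (Γ : M.CounterSelector) (r : S → M.Level) (a₀ : A)
    (d : M.Level) (h : History S A) :
    (M.counterStructure Γ r a₀).updateStar (some d) h = M.level d h := by
  induction h with
  | start s => rfl
  | step h a t ih => exact congrArg (M.levelStep h.last a) ih

omit [Fintype S] in
theorem counterStrategy_apply (Γ : M.CounterSelector) (d : M.Level) (a₀ : A)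
    (h : History S A) : M.counterStrategy Γ (fun _ => d) a₀ h =
      SelectionRule.select (Γ h.last) a₀ (M.level d h) := by
  rw [← updateStar_counterStructure Γ (fun _ => d) a₀ d h]
  rfl

variable {Γ : M.CounterSelector} {a₀ : A} {d : M.Level} {s : S}

/-- The invariant of the play: a good action leaves every successor with its safe load, and a safe
level again selects a good action. -/
theorem IsSelectorFor.exists_level (hΓ : M.IsSelectorFor T K Γ) (hK : M.prune T K = K)
    (hd : M.safeVal T K s ≤ d) {h : History S A}
    (hc : M.CompHist (M.counterStrategy Γ (fun _ => d) a₀) s h) :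
    ∃ l : M.Level, M.level d h = some l ∧ M.safeVal T K h.last ≤ l := by
  induction h with
  | start t => exact ⟨d, rfl, (show t = s from hc) ▸ hd⟩
  | step h a t ih =>
    obtain ⟨h1, h2, h3⟩ := hc
    obtain ⟨l, hl, hv⟩ := ih h1
    obtain ⟨j, -, hg⟩ := hΓ.select a₀ ((posVal_le_safeVal hK h.last).trans hv)
    rw [counterStrategy_apply, hl] at h2
    rw [← h2] at hg
    have h4 := hg.1 t h3
    have h5 := M.available_le h.last l
    refine ⟨⟨M.available h.last l - M.cons h.last a, by omega⟩, ?_, ?_⟩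
    · change M.levelStep h.last a (M.level d h) = _
      rw [hl, levelStep_eq_some]
      simp only
      omega
    · change M.safeVal T K t ≤ M.available h.last l - M.cons h.last a
      omega

variable [Finite A] [MeasurableSpace S]
  [MeasurableSpace A] [DiscreteMeasurableSpace S] [DiscreteMeasurableSpace A]

/-- If the initial load is at least the safe load, then the counter selector works. -/
theorem IsSelectorFor.isBuchiSafe (hΓ : M.IsSelectorFor T K Γ) (hK : M.prune T K = K)
    (hd : M.safeVal T K s ≤ d) :
    M.IsBuchiSafe T d s (M.counterStrategy Γ (fun _ => d) a₀) := by
  set σ := M.counterStrategy Γ (fun _ => d) a₀ with hσ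
  refine ⟨fun ρ hρ => ⟨hρ.1, fun i => ?_⟩, ?_⟩
  · obtain ⟨l, hl, -⟩ := hΓ.exists_level hK hd (M.compHist_pref hρ i)
    simp [hl]
  -- The rank of the current level serves as the bounded rank; the default `0` for exhaustion does
  -- not arise on compatible paths.
  · refine M.prob_buchiRuns_eq_one (N := rounds S)
      (rk := fun h => ((M.level d h).map fun l : M.Level => M.rank T K h.last l).getD 0) ?_ ?_
    · intro h hc
      obtain ⟨l, hl, hv⟩ := hΓ.exists_level hK hd hc
      simp only [hl, Option.map_some, Option.getD_some]
      exact Nat.sInf_le (m := rounds S) ((posVal_le_safeVal hK h.last).trans hv)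
    · intro h hc
      obtain ⟨l, hl, hv⟩ := hΓ.exists_level hK hd hc
      obtain ⟨j, hj, hg⟩ := hΓ.select a₀ ((posVal_le_safeVal hK h.last).trans hv)
      have ha : σ h = SelectionRule.select (Γ h.last) a₀ (some l) := by
        rw [hσ, counterStrategy_apply, hl]
      rw [← ha] at hg
      obtain ⟨hg1, t, ht, hg2⟩ := hg
      refine ⟨t, ht, hg2.imp id fun hx => ?_⟩
      obtain ⟨l', hl', -⟩ := hΓ.exists_level hK hd
        (show M.CompHist σ s (.step h (σ h) t) from ⟨hc, rfl, ht⟩)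
      simp only [hl, hl', Option.map_some, Option.getD_some, hj]
      refine Nat.lt_succ_of_le (Nat.sInf_le (m := j) ?_)
      have he : M.levelStep h.last (σ h) (M.level d h) = some l' := hl'
      rw [hl, levelStep_eq_some] at he
      change M.posIter T K j t ≤ l'
      omega

end Soundness

end CMDP

namespace RAM

/-! ### A language of bounded loops -/

/-- Programs with bounded loops: `loop x b c` runs `c` for `x = 0, …, b - 1`, where `x` and `b` are
the cells `0` of the arrays with these numbers. -/
inductive Code : Type
  | skip
  | store (a : ℕ) (i e : Expr)
  | seq (c d : Code)
  | ite (e : Expr) (c d : Code)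
  | loop (x b : ℕ) (c : Code)

/-- Cell `0` of an array, used as a variable. -/
abbrev Expr.var (a : ℕ) : Expr := .cell a (.lit 0)

namespace Code

/-- The translation to programs. -/
def compile : Code → Program
  | skip => .skip
  | store a i e => .store a i e
  | seq c d => .seq c.compile d.compile
  | ite e c d => .ite e c.compile d.compile
  | loop x b c => .seq (.store x (.lit 0) (.lit 0))
      (.while (.minus (.var b) (.var x))
        (.seq c.compile (.store x (.lit 0) (.plus (.var x) (.lit 1)))))

/-- The memory after `i` rounds of a loop. -/
def iterLoop (f : Memory → Memory) (x : ℕ) (m : Memory) : ℕ → Memory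
  | 0 => m.write x 0 0
  | i + 1 => (f (iterLoop f x m i)).write x 0 (i + 1)

/-- The first memory if `v` is not `0`, and the second otherwise. -/
def branch (v : ℕ) (m m' : Memory) : Memory := if v = 0 then m' else m

/-- The effect of a program on the memory. -/
def run : Code → Memory → Memory
  | skip, m => m
  | store a i e, m => m.write a (i.eval m) (e.eval m)
  | seq c d, m => d.run (c.run m)
  | ite e c d, m => branch (e.eval m) (c.run m) (d.run m)
  | loop x b c, m => iterLoop c.run x m (m b 0)

/-- The arrays that are written. -/
def touches : Code → ℕ → Bool
  | skip, _ => false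
  | store a _ _, b => a == b
  | seq c d, b => c.touches b || d.touches b
  | ite _ c d, b => c.touches b || d.touches b
  | loop x _ c, b => x == b || c.touches b

end Code

theorem Memory.write_same (m : Memory) (a i v : ℕ) : m.write a i v a i = v := by
  simp [Memory.write]

theorem Memory.write_of_ne (m : Memory) {a b : ℕ} (h : b ≠ a) (i v : ℕ) :
    m.write a i v b = m b := by
  simp [Memory.write, h]

theorem Memory.write_apply (m : Memory) (a i v b j : ℕ) :
    m.write a i v b j = if b = a ∧ j = i then v else m b j := by
  unfold Memory.write
  by_cases h : b = a
  · subst h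
    by_cases hj : j = i <;> simp [hj]
  · simp [h]

namespace Code

theorem branch_apply (v : ℕ) (m m' : Memory) (a i : ℕ) :
    branch v m m' a i = if v = 0 then m' a i else m a i := by
  unfold branch
  split_ifs <;> rfl

theorem iterLoop_of_ne {f : Memory → Memory} {x a : ℕ} (hx : x ≠ a) (hf : ∀ m, f m a = m a)
    (m : Memory) (i : ℕ) : iterLoop f x m i a = m a := by
  induction i with
  | zero => exact Memory.write_of_ne _ hx.symm _ _
  | succ i ih => rw [iterLoop, Memory.write_of_ne _ hx.symm, hf, ih]

theorem iterLoop_counter (f : Memory → Memory) (x : ℕ) (m : Memory) (i : ℕ) :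
    iterLoop f x m i x 0 = i := by
  cases i <;> exact Memory.write_same _ _ _ _

/-- Arrays that are not written keep their content. -/
theorem run_eq_of_not_touches {c : Code} {a : ℕ} (h : c.touches a = false) (m : Memory) :
    c.run m a = m a := by
  induction c generalizing m with
  | skip => rfl
  | store b i e =>
    simp only [touches, beq_eq_false_iff_ne] at h
    exact Memory.write_of_ne _ h.symm _ _
  | seq c d ihc ihd =>
    simp only [touches, Bool.or_eq_false_iff] at h
    rw [run, ihd h.2, ihc h.1]
  | ite e c d ihc ihd =>
    simp only [touches, Bool.or_eq_false_iff] at h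
    rw [run, branch]
    split_ifs
    · exact ihd h.2 m
    · exact ihc h.1 m
  | loop x b c ih =>
    simp only [touches, Bool.or_eq_false_iff, beq_eq_false_iff_ne] at h
    exact iterLoop_of_ne h.1 (ih h.2) _ _

/-- The rule for loops: besides the invariant, the body may use that the arrays that are not
written have their original content. -/
theorem loop_inv {x b : ℕ} {c : Code} {m : Memory} (I : ℕ → Memory → Prop)
    (h0 : I 0 (m.write x 0 0))
    (hs : ∀ i < m b 0, ∀ m', m' x 0 = i →
      (∀ a, (loop x b c).touches a = false → m' a = m a) → I i m' →
      I (i + 1) ((c.run m').write x 0 (i + 1))) :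
    I (m b 0) ((loop x b c).run m) := by
  have h : ∀ i ≤ m b 0, I i (iterLoop c.run x m i) := by
    intro i
    induction i with
    | zero => exact fun _ => h0
    | succ i ih =>
      intro hi
      refine hs i (by omega) _ (iterLoop_counter _ _ _ _) (fun a ha => ?_) (ih (by omega))
      simp only [touches, Bool.or_eq_false_iff, beq_eq_false_iff_ne] at ha
      exact iterLoop_of_ne ha.1 (run_eq_of_not_touches ha.2) _ _
  exact h _ le_rfl

end Code

/-! ### Time bounds -/

/-- All numbers in the memory have at most `B` bits. -/
def Memory.Bounded (m : Memory) (B : ℕ) : Prop := ∀ a i, (m a i).size ≤ B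

theorem size_add_le (a b : ℕ) : (a + b).size ≤ a.size + b.size + 1 := by
  rw [Nat.size_le]
  have h1 := Nat.lt_size_self a
  have h2 := Nat.lt_size_self b
  have h3 : 2 ^ a.size ≤ 2 ^ (a.size + b.size) := Nat.pow_le_pow_right (by omega) (by omega)
  have h4 : 2 ^ b.size ≤ 2 ^ (a.size + b.size) := Nat.pow_le_pow_right (by omega) (by omega)
  rw [pow_succ]
  omega

theorem size_mul_le (a b : ℕ) : (a * b).size ≤ a.size + b.size := by
  rw [Nat.size_le, pow_add]
  exact Nat.mul_lt_mul'' (Nat.lt_size_self a) (Nat.lt_size_self b)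

/-- A factor for the size of the value and for the cost of an expression. -/
def Expr.weight : Expr → ℕ
  | .lit n => n.size + 1
  | .cell _ e => 2 * e.weight + 2
  | .plus e f | .minus e f | .times e f | .quot e f => 4 * (e.weight + f.weight) + 2

theorem Expr.size_eval_le {m : Memory} {B : ℕ} (hm : m.Bounded B) (e : Expr) :
    (e.eval m).size ≤ e.weight * (B + 1) := by
  induction e with
  | lit n => simp only [eval, weight]; nlinarith
  | cell a e ih => simp only [eval, weight]; have := hm a (e.eval m); nlinarith
  | plus e f ihe ihf =>
    simp only [eval, weight]
    have := size_add_le (e.eval m) (f.eval m)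
    nlinarith
  | minus e f ihe ihf =>
    simp only [eval, weight]
    have := Nat.size_le_size (Nat.sub_le (e.eval m) (f.eval m))
    nlinarith
  | times e f ihe ihf =>
    simp only [eval, weight]
    have := size_mul_le (e.eval m) (f.eval m)
    nlinarith
  | quot e f ihe ihf =>
    simp only [eval, weight]
    have := Nat.size_le_size (Nat.div_le_self (e.eval m) (f.eval m))
    nlinarith

theorem Expr.cost_le {m : Memory} {B : ℕ} (hm : m.Bounded B) (e : Expr) :
    e.cost m ≤ e.weight * (B + 1) := by
  induction e with
  | lit n => simp only [cost, weight]; nlinarith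
  | cell a e ih =>
    simp only [cost, weight]
    have := hm a (e.eval m)
    have := e.size_eval_le hm
    nlinarith
  | plus e f ihe ihf =>
    simp only [cost, weight]
    have := size_add_le (e.eval m) (f.eval m)
    have := e.size_eval_le hm
    have := f.size_eval_le hm
    nlinarith
  | minus e f ihe ihf =>
    simp only [cost, weight]
    have := Nat.size_le_size (Nat.sub_le (e.eval m) (f.eval m))
    have := e.size_eval_le hm
    have := f.size_eval_le hm
    nlinarith
  | times e f ihe ihf =>
    simp only [cost, weight]
    have := size_mul_le (e.eval m) (f.eval m)
    have := e.size_eval_le hm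
    have := f.size_eval_le hm
    nlinarith
  | quot e f ihe ihf =>
    simp only [cost, weight]
    have := Nat.size_le_size (Nat.div_le_self (e.eval m) (f.eval m))
    have := e.size_eval_le hm
    have := f.size_eval_le hm
    nlinarith

/-- Expressions whose value is never larger than all numbers in the memory (and `3`). -/
def Expr.bounded : Expr → Bool
  | .lit n => decide (n ≤ 3)
  | .cell _ _ => true
  | .minus e _ | .quot e _ => e.bounded
  | _ => false

theorem Expr.size_eval_le_of_bounded {m : Memory} {B : ℕ} (hm : m.Bounded B) (hB : 2 ≤ B)
    {e : Expr} (he : e.bounded = true) : (e.eval m).size ≤ B := by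
  induction e with
  | lit n =>
    simp only [bounded, decide_eq_true_eq] at he
    exact (Nat.size_le_size he).trans ((Nat.size_le.2 (by norm_num : 3 < 2 ^ 2)).trans hB)
  | cell a e ih => exact hm _ _
  | plus e f ihe ihf => simp [bounded] at he
  | minus e f ihe ihf => exact (Nat.size_le_size (Nat.sub_le _ _)).trans (ihe he)
  | times e f ihe ihf => simp [bounded] at he
  | quot e f ihe ihf => exact (Nat.size_le_size (Nat.div_le_self _ _)).trans (ihe he)

theorem Memory.Bounded.write {m : Memory} {B : ℕ} (hm : m.Bounded B) {v : ℕ} (hv : v.size ≤ B)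
    (a i : ℕ) : (m.write a i v).Bounded B := by
  intro b j
  rw [Memory.write_apply]
  split_ifs
  · exact hv
  · exact hm b j

theorem Memory.Bounded.mono {m : Memory} {B B' : ℕ} (hm : m.Bounded B) (h : B ≤ B') :
    m.Bounded B' := fun a i => (hm a i).trans h

/-- The arrays whose cells `0` serve as bounds of loops. -/
def isSmall (a : ℕ) : Bool := decide (2 ≤ a ∧ a ≤ 4)

namespace Code

/-- Programs that store only values of bounded expressions and use small loop bounds. -/
def static : Code → Bool
  | skip => true
  | store a _ e => e.bounded && !isSmall a
  | seq c d | ite _ c d => c.static && d.static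
  | loop x b c => isSmall b && !isSmall x && !c.touches x && c.static

/-- Loop bounds therefore stay constant during a static program, which makes the time of nested
loops polynomial. -/
theorem not_touches_of_static {c : Code} (hc : c.static = true) {a : ℕ}
    (ha : isSmall a = true) : c.touches a = false := by
  induction c with
  | skip => rfl
  | store b i e =>
    simp only [static, Bool.and_eq_true, Bool.not_eq_true'] at hc
    simp only [touches, beq_eq_false_iff_ne]
    rintro rfl
    simp [ha] at hc
  | seq c d ihc ihd | ite _ c d ihc ihd =>
    simp only [static, Bool.and_eq_true] at hc
    simp [touches, ihc hc.1, ihd hc.2]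
  | loop x b c ih =>
    simp only [static, Bool.and_eq_true, Bool.not_eq_true'] at hc
    simp only [touches, ih hc.2, Bool.or_false, beq_eq_false_iff_ne]
    rintro rfl
    simp [ha] at hc

theorem exec_store {m : Memory} {B : ℕ} (hm : m.Bounded B) (a : ℕ) (i e : Expr) :
    ∃ t ≤ (2 * i.weight + 2 * e.weight + 1) * (B + 1),
      Exec (.store a i e) m (m.write a (i.eval m) (e.eval m)) t := by
  refine ⟨_, ?_, Exec.store m a i e⟩
  have := i.size_eval_le hm
  have := e.size_eval_le hm
  have := i.cost_le hm
  have := e.cost_le hm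
  nlinarith

/-- Static programs run in polynomial time. -/
theorem exec_of_static {c : Code} (hc : c.static = true) (P Q : Polynomial ℕ) :
    ∃ T : Polynomial ℕ, ∀ (y : ℕ) (m : Memory), m.Bounded (Q.eval y) → 2 ≤ Q.eval y →
      (∀ b, isSmall b = true → m b 0 ≤ P.eval y) →
      ∃ t ≤ T.eval y, Exec c.compile m (c.run m) t ∧ (c.run m).Bounded (Q.eval y) := by
  induction c with
  | skip => exact ⟨1, fun y m hm _ _ => ⟨1, by simp, Exec.skip m, hm⟩⟩
  | store a i e =>
    simp only [static, Bool.and_eq_true] at hc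
    refine ⟨Polynomial.C (2 * i.weight + 2 * e.weight + 1) * (Q + 1), fun y m hm hB _ => ?_⟩
    obtain ⟨t, ht, hE⟩ := exec_store hm a i e
    exact ⟨t, by simpa using ht, hE, hm.write (Expr.size_eval_le_of_bounded hm hB hc.1) _ _⟩
  | seq c d ihc ihd =>
    simp only [static, Bool.and_eq_true] at hc
    obtain ⟨T₁, h₁⟩ := ihc hc.1
    obtain ⟨T₂, h₂⟩ := ihd hc.2
    refine ⟨T₁ + T₂, fun y m hm hB hP => ?_⟩
    obtain ⟨t₁, ht₁, hE₁, hb₁⟩ := h₁ y m hm hB hP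
    obtain ⟨t₂, ht₂, hE₂, hb₂⟩ := h₂ y _ hb₁ hB fun b hb => by
      rw [run_eq_of_not_touches (not_touches_of_static hc.1 hb)]; exact hP b hb
    exact ⟨t₁ + t₂, by rw [Polynomial.eval_add]; omega, Exec.seq hE₁ hE₂, hb₂⟩
  | ite e c d ihc ihd =>
    simp only [static, Bool.and_eq_true] at hc
    obtain ⟨T₁, h₁⟩ := ihc hc.1
    obtain ⟨T₂, h₂⟩ := ihd hc.2
    refine ⟨Polynomial.C e.weight * (Q + 1) + T₁ + T₂ + 1, fun y m hm hB hP => ?_⟩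
    have hcost := e.cost_le hm
    simp only [Polynomial.eval_add, Polynomial.eval_mul, Polynomial.eval_C, Polynomial.eval_one]
    by_cases he : e.eval m = 0
    · obtain ⟨t, ht, hE, hb⟩ := h₂ y m hm hB hP
      refine ⟨e.cost m + t + 1, by omega, ?_, ?_⟩
      · rw [run, branch, if_pos he]; exact Exec.ite_false he hE
      · rw [run, branch, if_pos he]; exact hb
    · obtain ⟨t, ht, hE, hb⟩ := h₁ y m hm hB hP
      refine ⟨e.cost m + t + 1, by omega, ?_, ?_⟩
      · rw [run, branch, if_neg he]; exact Exec.ite_true he hE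
      · rw [run, branch, if_neg he]; exact hb
  | loop x b c ih =>
    simp only [static, Bool.and_eq_true, Bool.not_eq_true'] at hc
    obtain ⟨⟨⟨hb, hx⟩, hcx⟩, hcs⟩ := hc
    obtain ⟨T, hT⟩ := ih hcs
    set e : Expr := .minus (.var b) (.var x) with he
    set inc : Expr := .plus (.var x) (.lit 1) with hinc
    set w : ℕ := e.weight + 2 * (Expr.lit 0).weight + 2 * inc.weight + 2 with hw
    set w₀ : ℕ := 2 * (Expr.lit 0).weight + 2 * (Expr.lit 0).weight + 1 with hw₀
    refine ⟨P * (T + Polynomial.C w * (Q + 1)) + Polynomial.C (e.weight + w₀ + 1) * (Q + 1),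
      fun y m hm hB hP => ?_⟩
    set B := Q.eval y with hBdef
    set N := m b 0 with hN
    have hNP : N ≤ P.eval y := hP b hb
    have hbx : x ≠ b := by rintro rfl; simp [hb] at hx
    have hcb : c.touches b = false := not_touches_of_static hcs hb
    set f : ℕ → Memory := iterLoop c.run x m with hf
    have hsmall : ∀ i a, isSmall a = true → f i a = m a := fun i a ha =>
      iterLoop_of_ne (by rintro rfl; simp [ha] at hx)
        (run_eq_of_not_touches (not_touches_of_static hcs ha)) m i
    -- The increment of the counter is not a bounded expression, but the counter never exceeds the
    -- loop bound, which is itself a number in the memory.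
    have hNb : N.size ≤ B := hm b 0
    have hfb : ∀ i ≤ N, (f i).Bounded B := by
      intro i
      induction i with
      | zero => exact fun _ => hm.write (by simp) _ _
      | succ i ih =>
        intro hi
        obtain ⟨t, -, -, h⟩ := hT y (f i) (ih (by omega)) hB fun a ha => by
          rw [hsmall i a ha]; exact hP a ha
        exact h.write ((Nat.size_le_size hi).trans hNb) _ _
    have hcond : ∀ i, e.eval (f i) = N - i := by
      intro i
      simp only [he, Expr.eval, hf]
      rw [iterLoop_counter, iterLoop_of_ne hbx (run_eq_of_not_touches hcb)]
    -- Induction on the number `k` of remaining rounds, since the derivation for a `while` is built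
    -- from its end.
    have hloop : ∀ k ≤ N, ∃ t ≤ k * (T.eval y + w * (B + 1)) + (e.weight + 1) * (B + 1),
        Exec (.while e (.seq c.compile (.store x (.lit 0) inc))) (f (N - k)) (f N) t := by
      intro k
      induction k with
      | zero =>
        intro _
        have h0 : e.eval (f N) = 0 := by rw [hcond]; omega
        refine ⟨_, ?_, Exec.while_false h0⟩
        have : e.cost (f (N - 0)) ≤ _ := e.cost_le (hfb N le_rfl)
        nlinarith
      | succ k ihk =>
        intro hk
        obtain ⟨t, ht, hE⟩ := ihk (by omega)
        set i := N - (k + 1) with hi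
        have hi' : N - k = i + 1 := by omega
        have h0 : e.eval (f i) ≠ 0 := by rw [hcond]; omega
        obtain ⟨t₁, ht₁, hE₁, hb₁⟩ := hT y (f i) (hfb i (by omega)) hB fun a ha => by
          rw [hsmall i a ha]; exact hP a ha
        obtain ⟨t₂, ht₂, hE₂⟩ := exec_store hb₁ x (.lit 0) inc
        have hstep : (c.run (f i)).write x ((Expr.lit 0).eval (c.run (f i)))
            (inc.eval (c.run (f i))) = f (i + 1) := by
          have : (c.run (f i)) x 0 = i := by
            rw [run_eq_of_not_touches hcx]
            exact iterLoop_counter _ _ _ _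
          simp only [hinc, Expr.eval, this]
          rfl
        rw [hstep] at hE₂
        rw [hi'] at hE
        refine ⟨_, ?_, Exec.while_true h0 (Exec.seq hE₁ hE₂) hE⟩
        have := e.cost_le (hfb i (by omega))
        have ht₂' : t₂ ≤ (2 * (Expr.lit 0).weight + 2 * inc.weight + 1) * (B + 1) := ht₂
        have e1 : (k + 1) * (T.eval y + w * (B + 1)) =
          k * (T.eval y + w * (B + 1)) + (T.eval y + w * (B + 1)) := by ring
        have e2 : w * (B + 1) = e.weight * (B + 1) +
          (2 * (Expr.lit 0).weight + 2 * inc.weight + 1) * (B + 1) + (B + 1) := by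
          rw [hw]; ring
        rw [e1]
        omega
    obtain ⟨t, ht, hE⟩ := hloop N le_rfl
    obtain ⟨t₀, ht₀, hE₀⟩ := exec_store hm x (.lit 0) (.lit 0)
    rw [Nat.sub_self] at hE
    have ht₀' : t₀ ≤ w₀ * (B + 1) := ht₀
    refine ⟨t₀ + t, ?_, Exec.seq hE₀ hE, hfb N le_rfl⟩
    simp only [Polynomial.eval_add, Polynomial.eval_mul, Polynomial.eval_C, Polynomial.eval_one,
      ← hBdef]
    have h1 : N * (T.eval y + w * (B + 1)) ≤ P.eval y * (T.eval y + w * (B + 1)) :=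
      Nat.mul_le_mul_right _ hNP
    have h2 : (e.weight + w₀ + 1) * (B + 1) = (e.weight + 1) * (B + 1) + w₀ * (B + 1) := by ring
    omega

/-- Programs without loops. -/
def straight : Code → Bool
  | skip | store _ _ _ => true
  | seq c d | ite _ c d => c.straight && d.straight
  | loop _ _ _ => false

/-- Programs without loops run in polynomial time. -/
theorem exec_of_straight {c : Code} (hc : c.straight = true) (Q : Polynomial ℕ) :
    ∃ T : Polynomial ℕ, ∀ (y : ℕ) (m : Memory), m.Bounded (Q.eval y) →
      ∃ t ≤ T.eval y, Exec c.compile m (c.run m) t ∧ (c.run m).Bounded (T.eval y) := by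
  induction c generalizing Q with
  | skip =>
    exact ⟨1 + Q, fun y m hm => ⟨1, by simp, Exec.skip m, hm.mono (by simp)⟩⟩
  | store a i e =>
    refine ⟨Polynomial.C (2 * i.weight + 2 * e.weight + 1) * (Q + 1), fun y m hm => ?_⟩
    obtain ⟨t, ht, hE⟩ := exec_store hm a i e
    have := e.size_eval_le hm
    simp only [Polynomial.eval_add, Polynomial.eval_mul, Polynomial.eval_C, Polynomial.eval_one]
    exact ⟨t, ht, hE, (hm.mono (by nlinarith)).write (by nlinarith) _ _⟩
  | seq c d ihc ihd =>
    simp only [straight, Bool.and_eq_true] at hc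
    obtain ⟨T₁, h₁⟩ := ihc hc.1 Q
    obtain ⟨T₂, h₂⟩ := ihd hc.2 T₁
    refine ⟨T₁ + T₂, fun y m hm => ?_⟩
    obtain ⟨t₁, ht₁, hE₁, hb₁⟩ := h₁ y m hm
    obtain ⟨t₂, ht₂, hE₂, hb₂⟩ := h₂ y _ hb₁
    rw [Polynomial.eval_add]
    exact ⟨t₁ + t₂, by omega, Exec.seq hE₁ hE₂, hb₂.mono (by omega)⟩
  | ite e c d ihc ihd =>
    simp only [straight, Bool.and_eq_true] at hc
    obtain ⟨T₁, h₁⟩ := ihc hc.1 Q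
    obtain ⟨T₂, h₂⟩ := ihd hc.2 Q
    refine ⟨Polynomial.C e.weight * (Q + 1) + T₁ + T₂ + 1, fun y m hm => ?_⟩
    have hcost := e.cost_le hm
    simp only [Polynomial.eval_add, Polynomial.eval_mul, Polynomial.eval_C, Polynomial.eval_one]
    by_cases he : e.eval m = 0
    · obtain ⟨t, ht, hE, hb⟩ := h₂ y m hm
      refine ⟨e.cost m + t + 1, by omega, ?_, ?_⟩
      · rw [run, branch, if_pos he]; exact Exec.ite_false he hE
      · rw [run, branch, if_pos he]; exact hb.mono (by omega)
    · obtain ⟨t, ht, hE, hb⟩ := h₁ y m hm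
      refine ⟨e.cost m + t + 1, by omega, ?_, ?_⟩
      · rw [run, branch, if_neg he]; exact Exec.ite_true he hE
      · rw [run, branch, if_neg he]; exact hb.mono (by omega)
  | loop x b c ih => simp [straight] at hc

end Code

end RAM

namespace RAM
open CMDP

/-! ### The program

The input is in array `0`. Arrays `2` to `4` hold the number of states, the number of actions and
the number of rounds, array `5` holds the capacity plus one, arrays `6` to `8` hold the positions of
the transition probabilities, the reload states and the target states in the input, and array `9`
holds a bound on the number of selected actions. Loop variables are in the arrays `11` to `15`.
Array `16` says for each state whether it is not a reload state (`0`), a kept reload state (`1`) or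
a removed reload state (`2`). Arrays `17` and `18` hold the safe loads and the loads for positive
reachability, array `19` the result of the current iteration step, and the arrays `20` to `25` are
local variables. -/

namespace Code

open RAM.Expr

/-- The number of the state-action pair given by the arrays `13` and `14`. -/
def pairIndex : Expr := .plus (.times (.var 13) (.var 3)) (.var 14)

/-- Update the maximum of the safe loads and the minimum of the loads for positive reachability
with a successor. -/
def scanBody (xa : ℕ) : Code :=
  .ite (.cell 0 (.plus (.var 6)
      (.times (.lit 2) (.plus (.times pairIndex (.var 2)) (.var 15)))))
    (.seq
      (.ite (.minus (.cell 17 (.var 15)) (.var 22)) (.store 22 (.lit 0) (.cell 17 (.var 15))) .skip)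
      (.ite (.cell 0 (.plus (.var 8) (.var 15))) (.store 23 (.lit 0) (.lit 0))
        (.ite (.minus (.var 23) (.cell xa (.var 15))) (.store 23 (.lit 0) (.cell xa (.var 15)))
          .skip)))
    .skip

/-- Scan the successors of a state-action pair. -/
def scan (xa : ℕ) : Code :=
  .seq (.store 22 (.lit 0) (.lit 0)) (.seq (.store 23 (.lit 0) (.var 5)) (.loop 15 2 (scanBody xa)))

/-- Compute the load that makes an action good. -/
def actionLoad : Code :=
  .seq (.ite (.minus (.var 23) (.var 22)) (.store 22 (.lit 0) (.var 23)) .skip)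
    (.store 24 (.lit 0) (.minus (.var 5) (.minus (.var 5)
      (.plus (.cell 0 (.plus (.lit 6) pairIndex)) (.var 22)))))

/-- Compare an action with the best one so far. -/
def bestBody (xa : ℕ) : Code :=
  .seq (scan xa) (.seq actionLoad (.ite (.minus (.var 20) (.var 24))
    (.seq (.store 20 (.lit 0) (.var 24)) (.store 21 (.lit 0) (.var 14))) .skip))

/-- Find the best action of a state. -/
def best (xa : ℕ) : Code :=
  .seq (.store 20 (.lit 0) (.var 5)) (.seq (.store 21 (.lit 0) (.lit 0))
    (.loop 14 3 (bestBody xa)))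

end Code

/-- The memory holds the instance. -/
structure Env {n k : ℕ} (M : CMDP (Fin n) (Fin k)) (T : Finset (Fin n)) (m : Memory) : Prop where
  states : m 2 0 = n
  actions : m 3 0 = k
  rounds : m 4 0 = CMDP.rounds (Fin n)
  cap : m 5 0 = M.cap + 1
  limit : m 9 0 = CMDP.rounds (Fin n) * n
  cons : ∀ (s : Fin n) (a : Fin k), m 0 (6 + ((s : ℕ) * k + a)) = M.cons s a
  succ : ∀ (s : Fin n) (a : Fin k) (t : Fin n),
    m 0 (m 6 0 + 2 * (((s : ℕ) * k + a) * n + t)) ≠ 0 ↔ t ∈ M.Succ s a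
  reload : ∀ s : Fin n, m 0 (m 7 0 + s) = if s ∈ M.reload then 1 else 0
  target : ∀ s : Fin n, m 0 (m 8 0 + s) ≠ 0 ↔ s ∈ T

/-- The arrays that describe the instance. -/
def isInput (a : ℕ) : Bool := a == 0 || decide (2 ≤ a ∧ a ≤ 9)

variable {n k : ℕ} {M : CMDP (Fin n) (Fin k)} {T : Finset (Fin n)} {m m' : Memory}

theorem Env.congr (h : Env M T m) (he : ∀ a, isInput a = true → m' a = m a) : Env M T m' := by
  have e0 := he 0 rfl
  have e2 := he 2 rfl
  have e3 := he 3 rfl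
  have e4 := he 4 rfl
  have e5 := he 5 rfl
  have e6 := he 6 rfl
  have e7 := he 7 rfl
  have e8 := he 8 rfl
  have e9 := he 9 rfl
  obtain ⟨h1, h2, h3, h4, h5, h6, h7, h8, h9⟩ := h
  constructor <;> simpa only [e0, e2, e3, e4, e5, e6, e7, e8, e9]

/-- The program does not write the arrays that describe the instance. -/
def Code.KeepsInput (c : Code) : Prop := ∀ a, isInput a = true → c.touches a = false

theorem Env.run (h : Env M T m) {c : Code} (hc : c.KeepsInput) : Env M T (c.run m) :=
  h.congr fun a ha => Code.run_eq_of_not_touches (hc a ha) m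

/-- These nine arrays are all that `isInput` accepts; for a concrete program each condition holds by
`rfl`. -/
theorem Code.KeepsInput.of_lt {c : Code} (h0 : c.touches 0 = false) (h2 : c.touches 2 = false)
    (h3 : c.touches 3 = false) (h4 : c.touches 4 = false) (h5 : c.touches 5 = false)
    (h6 : c.touches 6 = false) (h7 : c.touches 7 = false) (h8 : c.touches 8 = false)
    (h9 : c.touches 9 = false) : c.KeepsInput := by
  intro a ha
  simp only [isInput, Bool.or_eq_true, beq_iff_eq, decide_eq_true_eq] at ha
  rcases ha with rfl | ⟨hl, hu⟩
  · exact h0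
  · interval_cases a <;> assumption

theorem scan_keepsInput (xa : ℕ) : (Code.scan xa).KeepsInput :=
  .of_lt rfl rfl rfl rfl rfl rfl rfl rfl rfl

theorem best_keepsInput (xa : ℕ) : (Code.best xa).KeepsInput :=
  .of_lt rfl rfl rfl rfl rfl rfl rfl rfl rfl

variable {v x : Fin n → ℕ} {xa : ℕ} {s : Fin n} {a : Fin k}

/-- The maximum and the minimum are described by the loads above them, the form in which `Good` uses
them. The minimum starts at `cap + 1`, hence the restriction to `l ≤ cap`. -/
theorem run_scan (hE : Env M T m) (hs : m 13 0 = s) (ha : m 14 0 = a)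
    (hv : ∀ t : Fin n, m 17 t = v t) (hxa : xa = 17 ∨ xa = 18) (hx : ∀ t : Fin n, m xa t = x t) :
    (∀ l, (Code.scan xa).run m 22 0 ≤ l ↔ ∀ t ∈ M.Succ s a, v t ≤ l) ∧
    (∀ l ≤ M.cap, (Code.scan xa).run m 23 0 ≤ l ↔ ∃ t ∈ M.Succ s a, t ∈ T ∨ x t ≤ l) := by
  set m₁ := (m.write 22 0 0).write 23 0 (m 5 0) with hm₁
  have h1 : ∀ b, b ≠ 22 → b ≠ 23 → m₁ b = m b := fun b h h' => by
    rw [hm₁, Memory.write_of_ne _ h', Memory.write_of_ne _ h]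
  have hrun : (Code.scan xa).run m = (Code.loop 15 2 (Code.scanBody xa)).run m₁ := by
    simp [Code.scan, Code.run, Expr.eval, hm₁, Memory.write_of_ne]
  rw [hrun]
  have hn : m₁ 2 0 = n := by rw [h1 2 (by simp) (by simp)]; exact hE.states
  have key := Code.loop_inv (x := 15) (b := 2) (c := Code.scanBody xa) (m := m₁)
    (fun i m' => (∀ l, m' 22 0 ≤ l ↔ ∀ t : Fin n, (t : ℕ) < i → t ∈ M.Succ s a → v t ≤ l) ∧
      (∀ l ≤ M.cap, m' 23 0 ≤ l ↔ ∃ t : Fin n, (t : ℕ) < i ∧ t ∈ M.Succ s a ∧ (t ∈ T ∨ x t ≤ l)))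
    ?_ ?_
  · rw [hn] at key
    refine ⟨fun l => (key.1 l).trans ⟨fun h t ht => h t t.2 ht, fun h t _ ht => h t ht⟩,
      fun l hl => (key.2 l hl).trans ⟨?_, ?_⟩⟩
    · rintro ⟨t, -, h⟩
      exact ⟨t, h⟩
    · rintro ⟨t, h⟩
      exact ⟨t, t.2, h⟩
  · have hc := hE.cap
    simp only [Memory.write_apply, hm₁]
    simp
    intro l hl
    omega
  · intro i hi m' hi' hf ⟨I1, I2⟩
    rw [hn] at hi
    have e0 : m' 0 = m 0 := (hf 0 rfl).trans (h1 0 (by simp) (by simp))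
    have e2 : m' 2 = m 2 := (hf 2 rfl).trans (h1 2 (by simp) (by simp))
    have e3 : m' 3 = m 3 := (hf 3 rfl).trans (h1 3 (by simp) (by simp))
    have e6 : m' 6 = m 6 := (hf 6 rfl).trans (h1 6 (by simp) (by simp))
    have e8 : m' 8 = m 8 := (hf 8 rfl).trans (h1 8 (by simp) (by simp))
    have e13 : m' 13 = m 13 := (hf 13 rfl).trans (h1 13 (by simp) (by simp))
    have e14 : m' 14 = m 14 := (hf 14 rfl).trans (h1 14 (by simp) (by simp))
    have e17 : m' 17 = m 17 := (hf 17 rfl).trans (h1 17 (by simp) (by simp))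
    have exa : m' xa = m xa := by
      rcases hxa with rfl | rfl
      · exact e17
      · exact (hf 18 rfl).trans (h1 18 (by simp) (by simp))
    have hxa22 : xa ≠ 22 := by omega
    set u : Fin n := ⟨i, hi⟩ with hu
    have hsucc := hE.succ s a u
    have htarget := hE.target u
    have hvu : m 17 i = v u := hv u
    have hxu : m xa i = x u := hx u
    have hlt : ∀ t : Fin n, (t : ℕ) < i + 1 ↔ (t : ℕ) < i ∨ t = u := fun t => by
      rw [Fin.ext_iff]; simp only [hu]; omega
    have hv' : ∀ l, (∀ t : Fin n, (t : ℕ) < i + 1 → t ∈ M.Succ s a → v t ≤ l) ↔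
        (m' 22 0 ≤ l ∧ (u ∈ M.Succ s a → v u ≤ l)) := fun l => by
      rw [I1]
      constructor
      · exact fun h => ⟨fun t ht => h t (by omega), h u (by simp [hu])⟩
      · rintro ⟨h, h'⟩ t ht
        rcases (hlt t).1 ht with ht | rfl
        · exact h t ht
        · exact h'
    have hx' : ∀ l ≤ M.cap, (∃ t : Fin n, (t : ℕ) < i + 1 ∧ t ∈ M.Succ s a ∧ (t ∈ T ∨ x t ≤ l)) ↔
        (m' 23 0 ≤ l ∨ (u ∈ M.Succ s a ∧ (u ∈ T ∨ x u ≤ l))) := fun l hl => by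
      rw [I2 l hl]
      constructor
      · rintro ⟨t, ht, h⟩
        rcases (hlt t).1 ht with ht | rfl
        · exact Or.inl ⟨t, ht, h⟩
        · exact Or.inr h
      · rintro (⟨t, ht, h⟩ | h)
        · exact ⟨t, by omega, h⟩
        · exact ⟨u, by simp [hu], h⟩
    replace hsucc : m 0 (m 6 0 + 2 * ((m 13 0 * m 3 0 + m 14 0) * m 2 0 + i)) ≠ 0 ↔
        u ∈ M.Succ s a := by
      rw [hs, ha, hE.actions, hE.states]
      exact hsucc
    replace htarget : m 0 (m 8 0 + i) ≠ 0 ↔ u ∈ T := htarget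
    clear I1 I2 hlt h1
    simp only [Memory.write_of_ne _ (show (22 : ℕ) ≠ 15 by decide),
      Memory.write_of_ne _ (show (23 : ℕ) ≠ 15 by decide)]
    refine ⟨fun l => (?_ : _ ↔ _).trans (hv' l).symm, fun l hl => (?_ : _ ↔ _).trans (hx' l hl).symm⟩
    all_goals
      simp only [Code.scanBody, Code.run, Expr.eval, Code.pairIndex, Code.branch_apply,
        Memory.write_apply]
      simp only [e0, e2, e3, e6, e8, e13, e14, e17, exa, hi', hvu, hxa22, reduceIte,
        Nat.reduceEqDiff, false_and, and_true]
      by_cases hS : u ∈ M.Succ s a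
      · have h0 := hsucc.2 hS
        by_cases hT : u ∈ T
        · have h0 := htarget.2 hT
          simp only [hS, hT, true_or, true_and, or_true, forall_const]
          split_ifs <;> first | omega | simp
        · have h0 := not_not.1 (mt htarget.1 hT)
          simp only [hS, hT, false_or, true_and, forall_const]
          split_ifs <;> omega
      · have h0 := not_not.1 (mt hsucc.1 hS)
        simp only [hS, h0, if_true, false_and, or_false, and_true, false_imp_iff]

/-- The least good load is the consumption plus the larger of the two scan results. Writing `min z
(cap + 1)` as `(cap + 1) - ((cap + 1) - z)` makes it a bounded expression, as a static program
requires. -/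
theorem run_actionLoad (hE : Env M T m) (hs : m 13 0 = s) (ha : m 14 0 = a)
    (h22 : ∀ l, m 22 0 ≤ l ↔ ∀ t ∈ M.Succ s a, v t ≤ l)
    (h23 : ∀ l ≤ M.cap, m 23 0 ≤ l ↔ ∃ t ∈ M.Succ s a, t ∈ T ∨ x t ≤ l) :
    Code.actionLoad.run m 24 0 ≤ M.cap + 1 ∧
      ∀ l ≤ M.cap, Code.actionLoad.run m 24 0 ≤ l ↔ M.Good T v x s a l := by
  have hrun : Code.actionLoad.run m 24 0 =
      (M.cap + 1) - ((M.cap + 1) - (M.cons s a + max (m 22 0) (m 23 0))) := by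
    simp only [Code.actionLoad, Code.run, Expr.eval, Code.pairIndex, Code.branch_apply,
      Memory.write_apply]
    simp only [reduceIte, Nat.reduceEqDiff, false_and, and_true, if_false, ite_self]
    rw [hs, ha, hE.actions, hE.cap, hE.cons]
    split_ifs with h
    · rw [max_eq_left (by omega)]
    · rw [max_eq_right (by omega)]
  rw [hrun]
  refine ⟨Nat.sub_le _ _, fun l hl => ?_⟩
  have h1 : (M.cap + 1) - ((M.cap + 1) - (M.cons s a + max (m 22 0) (m 23 0))) ≤ l ↔
      M.cons s a ≤ l ∧ m 22 0 ≤ l - M.cons s a ∧ m 23 0 ≤ l - M.cons s a := by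
    rcases max_cases (m 22 0) (m 23 0) with h | h <;> omega
  rw [h1, h22, h23 _ (by omega)]
  -- Because a successor exists, the first half of `Good` already forces the consumption to be at
  -- most `l`.
  obtain ⟨u, hu⟩ := (M.trans s a).support_nonempty
  have hu : u ∈ M.Succ s a := pos_iff_ne_zero.2 hu
  constructor
  · rintro ⟨h2, h3, t, ht, h4⟩
    refine ⟨fun t ht => ?_, t, ht, h4.imp id fun h4 => by omega⟩
    have := h3 t ht
    omega
  · rintro ⟨h3, t, ht, h4⟩
    refine ⟨?_, fun t ht => ?_, t, ht, h4.imp id fun h4 => by omega⟩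
    · have := h3 u hu
      omega
    · have := h3 t ht
      omega

/-- Array `20` holds the least good load among the actions tried so far, and array `21` an action
attaining it; in case of a tie the earlier action stays. -/
theorem run_best (hE : Env M T m) (hs : m 13 0 = s)
    (hv : ∀ t : Fin n, m 17 t = v t) (hxa : xa = 17 ∨ xa = 18) (hx : ∀ t : Fin n, m xa t = x t) :
    (Code.best xa).run m 20 0 = M.best T v x s ∧
      (M.best T v x s ≤ M.cap → ∃ a : Fin k, (Code.best xa).run m 21 0 = a ∧
        M.Good T v x s a (M.best T v x s)) := by
  set m₁ := (m.write 20 0 (m 5 0)).write 21 0 0 with hm₁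
  have h1 : ∀ b, b ≠ 20 → b ≠ 21 → m₁ b = m b := fun b h h' => by
    rw [hm₁, Memory.write_of_ne _ h', Memory.write_of_ne _ h]
  have hrun : (Code.best xa).run m = (Code.loop 14 3 (Code.bestBody xa)).run m₁ := rfl
  have hk : m₁ 3 0 = k := by rw [h1 3 (by simp) (by simp)]; exact hE.actions
  have key := Code.loop_inv (x := 14) (b := 3) (c := Code.bestBody xa) (m := m₁)
    (fun i m' => m' 20 0 ≤ M.cap + 1 ∧
      (∀ l ≤ M.cap, m' 20 0 ≤ l ↔ ∃ a : Fin k, (a : ℕ) < i ∧ M.Good T v x s a l) ∧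
      (m' 20 0 ≤ M.cap → ∃ a : Fin k, m' 21 0 = a ∧ M.Good T v x s a (m' 20 0)))
    ?_ ?_
  · rw [← hrun, hk] at key
    have hb : M.best T v x s = (Code.best xa).run m 20 0 := by
      refine M.best_eq T key.1 fun l hl => (key.2.1 l hl).trans ⟨?_, ?_⟩
      · rintro ⟨a, -, h⟩
        exact ⟨a, h⟩
      · rintro ⟨a, h⟩
        exact ⟨a, a.2, h⟩
    rw [hb]
    exact ⟨rfl, key.2.2⟩
  · have hc := hE.cap
    have e20 : m₁.write 14 0 0 20 0 = M.cap + 1 := by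
      simp [hm₁, Memory.write_apply, hc]
    rw [e20]
    refine ⟨le_rfl, fun l hl => ?_, fun h => ?_⟩
    · simp only [Nat.not_lt_zero, false_and, exists_false, iff_false]
      omega
    · omega
  · intro i hi m' hi' hf ⟨I0, I1, I2⟩
    rw [hk] at hi
    have he : ∀ a, (Code.loop 14 3 (Code.bestBody xa)).touches a = false →
        a ≠ 20 → a ≠ 21 → m' a = m a := fun a h h' h'' => (hf a h).trans (h1 a h' h'')
    have hE' : Env M T m' := hE.congr fun a ha =>
      he a (Code.KeepsInput.of_lt (c := Code.loop 14 3 (Code.bestBody xa))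
        rfl rfl rfl rfl rfl rfl rfl rfl rfl a ha)
        (by rintro rfl; simp [isInput] at ha) (by rintro rfl; simp [isInput] at ha)
    have e13 : m' 13 = m 13 := he 13 rfl (by simp) (by simp)
    have e17 : m' 17 = m 17 := he 17 rfl (by simp) (by simp)
    have exa : m' xa = m xa := by
      rcases hxa with rfl | rfl
      · exact e17
      · exact he 18 rfl (by simp) (by simp)
    set a : Fin k := ⟨i, hi⟩ with ha
    set m₂ := (Code.scan xa).run m' with hm₂
    have hs₂ : ∀ b, (Code.scan xa).touches b = false → m₂ b = m' b := fun b hb =>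
      Code.run_eq_of_not_touches hb m'
    obtain ⟨h22, h23⟩ := run_scan (xa := xa) (v := v) (x := x) (a := a) hE' (e13 ▸ hs) hi'
      (fun t => by rw [e17]; exact hv t) hxa (fun t => by rw [exa]; exact hx t)
    have hE₂ : Env M T m₂ := hE'.run (scan_keepsInput xa)
    obtain ⟨hq, hq'⟩ := run_actionLoad (v := v) (x := x) hE₂
      (by rw [hs₂ 13 rfl, e13, hs]) (by rw [hs₂ 14 rfl, hi']) h22 h23
    set m₃ := Code.actionLoad.run m₂ with hm₃
    have hs₃ : ∀ b, Code.actionLoad.touches b = false → m₃ b = m₂ b := fun b hb =>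
      Code.run_eq_of_not_touches hb m₂
    have e14 : m₃ 14 0 = a := by rw [hs₃ 14 rfl, hs₂ 14 rfl, hi']
    have e20 : m₃ 20 0 = m' 20 0 := by rw [hs₃ 20 rfl, hs₂ 20 rfl]
    have e21 : m₃ 21 0 = m' 21 0 := by rw [hs₃ 21 rfl, hs₂ 21 rfl]
    have r20 : ((Code.bestBody xa).run m').write 14 0 (i + 1) 20 0 =
        min (m' 20 0) (m₃ 24 0) := by
      rw [Memory.write_of_ne _ (show (20 : ℕ) ≠ 14 by decide)]
      simp only [Code.bestBody, Code.run, Expr.eval, Code.branch_apply, Memory.write_apply,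
        ← hm₂, ← hm₃, e20, e14]
      simp only [reduceIte, Nat.reduceEqDiff, and_true, if_false]
      split_ifs <;> omega
    have r21 : ((Code.bestBody xa).run m').write 14 0 (i + 1) 21 0 =
        if m' 20 0 ≤ m₃ 24 0 then m' 21 0 else a := by
      rw [Memory.write_of_ne _ (show (21 : ℕ) ≠ 14 by decide)]
      simp only [Code.bestBody, Code.run, Expr.eval, Code.branch_apply, Memory.write_apply,
        ← hm₂, ← hm₃, e20, e21, e14]
      simp only [reduceIte, Nat.reduceEqDiff, and_true, if_false]
      split_ifs <;> omega
    rw [r20, r21]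
    have hlt : ∀ b : Fin k, (b : ℕ) < i + 1 ↔ (b : ℕ) < i ∨ b = a := fun t => by
      rw [Fin.ext_iff]; simp only [ha]; omega
    refine ⟨(min_le_left _ _).trans I0, fun l hl => ?_, fun hle => ?_⟩
    · rw [min_le_iff, I1 l hl, hq' l hl]
      constructor
      · rintro (⟨b, hb, h⟩ | h)
        · exact ⟨b, by omega, h⟩
        · exact ⟨a, by simp [ha], h⟩
      · rintro ⟨b, hb, h⟩
        rcases (hlt b).1 hb with hb | rfl
        · exact Or.inl ⟨b, hb, h⟩
        · exact Or.inr h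
    · by_cases hc : m' 20 0 ≤ m₃ 24 0
      · rw [min_eq_left hc] at hle ⊢
        rw [if_pos hc]
        exact I2 hle
      · rw [min_eq_right (by omega)] at hle ⊢
        rw [if_neg hc]
        exact ⟨a, rfl, (hq' _ hle).1 le_rfl⟩

end RAM

/-! ### The list of selected triples -/

namespace CMDP

/-- The list consists of the actions selected in the first `J` rounds, and in round `J` for the
states before `i`. -/
structure SelList {n k : ℕ} (M : CMDP (Fin n) (Fin k)) (T K : Finset (Fin n)) (J i : ℕ)
    (L : List (Fin n × M.Level × Fin k)) : Prop where
  good : ∀ e ∈ L, ∃ j, (j < J ∨ j = J ∧ (e.1 : ℕ) < i) ∧ M.posIter T K (j + 1) e.1 = e.2.1 ∧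
    (e.2.1 : ℕ) < M.posIter T K j e.1 ∧ M.Good T (M.safeVal T K) (M.posIter T K j) e.1 e.2.2
      (M.best T (M.safeVal T K) (M.posIter T K j) e.1)
  complete : ∀ (s : Fin n) (j : ℕ), (j < J ∨ j = J ∧ (s : ℕ) < i) →
    M.posIter T K (j + 1) s < M.posIter T K j s →
    ∃ e ∈ L, e.1 = s ∧ (e.2.1 : ℕ) = M.posIter T K (j + 1) s
  unique : ∀ e ∈ L, ∀ e' ∈ L, e.1 = e'.1 → e.2.1 = e'.2.1 → e = e'
  length : L.length ≤ J * n + i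

namespace SelList

variable {n k : ℕ} {M : CMDP (Fin n) (Fin k)} {T K : Finset (Fin n)} {J i : ℕ}
  {L : List (Fin n × M.Level × Fin k)}

theorem nil : SelList M T K 0 0 [] where
  good := by simp
  complete := by intro s j h; omega
  unique := by simp
  length := by simp

theorem next_round (h : SelList M T K J n L) : SelList M T K (J + 1) 0 L where
  good e he := by
    obtain ⟨j, h1, h2⟩ := h.good e he
    exact ⟨j, by omega, h2⟩
  complete s j hj := h.complete s j (by have := s.2; omega)
  unique := h.unique
  length := by have := h.length; rw [add_mul]; omega

theorem skip (h : SelList M T K J i L) (hi : i < n)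
    (hx : ¬ M.posIter T K (J + 1) ⟨i, hi⟩ < M.posIter T K J ⟨i, hi⟩) :
    SelList M T K J (i + 1) L where
  good e he := by
    obtain ⟨j, h1, h2⟩ := h.good e he
    exact ⟨j, by omega, h2⟩
  complete s j hj hlt := by
    refine h.complete s j ?_ hlt
    rcases hj with hj | ⟨rfl, hj⟩
    · exact Or.inl hj
    · by_cases hs : (s : ℕ) = i
      · subst hs
        exact absurd hlt hx
      · omega
  unique := h.unique
  length := by have := h.length; omega

theorem append (h : SelList M T K J i L) (hi : i < n) {l : M.Level} {a : Fin k}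
    (hl : M.posIter T K (J + 1) ⟨i, hi⟩ = l) (hlt : (l : ℕ) < M.posIter T K J ⟨i, hi⟩)
    (hg : M.Good T (M.safeVal T K) (M.posIter T K J) ⟨i, hi⟩ a
      (M.best T (M.safeVal T K) (M.posIter T K J) ⟨i, hi⟩)) :
    SelList M T K J (i + 1) (L ++ [(⟨i, hi⟩, l, a)]) where
  good e he := by
    rw [List.mem_append, List.mem_singleton] at he
    rcases he with he | rfl
    · obtain ⟨j, h1, h2⟩ := h.good e he
      exact ⟨j, by omega, h2⟩
    · exact ⟨J, by simp, hl, hlt, hg⟩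
  complete s j hj hlt' := by
    by_cases hs : j = J ∧ (s : ℕ) = i
    · obtain ⟨rfl, rfl⟩ := hs
      exact ⟨_, List.mem_append_right _ (List.mem_singleton_self _), rfl, hl.symm⟩
    · obtain ⟨e, he, h1⟩ := h.complete s j (by omega) hlt'
      exact ⟨e, List.mem_append_left _ he, h1⟩
  unique := by
    -- An older triple of this state carries a value from a round up to `J`, which is larger than
    -- the new one.
    have hnew : ∀ e ∈ L, ¬ (e.1 = ⟨i, hi⟩ ∧ e.2.1 = l) := by
      rintro ⟨s, l', b⟩ he ⟨rfl, rfl⟩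
      obtain ⟨j, h1, h2, -⟩ := h.good _ he
      simp only [lt_irrefl, and_false, or_false] at h1
      replace hlt : (l' : ℕ) < M.posIter T K J ⟨i, hi⟩ := hlt
      replace h2 : M.posIter T K (j + 1) ⟨i, hi⟩ = l' := h2
      have := M.posIter_le_of_le T K (show j + 1 ≤ J from h1) ⟨i, hi⟩
      omega
    intro e he e' he' h1 h2
    rw [List.mem_append, List.mem_singleton] at he he'
    rcases he with he | rfl <;> rcases he' with he' | rfl
    · exact h.unique e he e' he' h1 h2
    · exact absurd ⟨h1, h2⟩ (hnew e he)
    · exact absurd ⟨h1.symm, h2.symm⟩ (hnew e' he')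
    · rfl
  length := by have := h.length; simp; omega

/-- The counter selector given by a list of selected actions. -/
theorem exists_selector (h : SelList M T K (rounds (Fin n)) 0 L) :
    ∃ Γ : M.CounterSelector, (∀ s l a, Γ s l = some a ↔ (s, l, a) ∈ L) ∧
      M.IsSelectorFor T K Γ := by
  classical
  set Γ : M.CounterSelector := fun s l =>
    (L.find? fun e => e.1 = s ∧ e.2.1 = l).map fun e => e.2.2 with hΓ
  have hmem : ∀ s l a, Γ s l = some a ↔ (s, l, a) ∈ L := by
    intro s l a
    simp only [hΓ, Option.map_eq_some_iff]
    constructor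
    · rintro ⟨e, he, rfl⟩
      have h1 := List.find?_some he
      have h2 := List.mem_of_find?_eq_some he
      simp only [decide_eq_true_eq] at h1
      obtain ⟨rfl, rfl⟩ := h1
      exact h2
    · intro ha
      have h1 : (L.find? fun e => e.1 = s ∧ e.2.1 = l).isSome := by
        rw [List.find?_isSome]
        exact ⟨_, ha, by simp⟩
      obtain ⟨e, he⟩ := Option.isSome_iff_exists.1 h1
      have h1 := List.find?_some he
      have h2 := List.mem_of_find?_eq_some he
      simp only [decide_eq_true_eq] at h1
      have := h.unique e h2 _ ha h1.1 h1.2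
      exact ⟨e, he, by rw [this]⟩
  refine ⟨Γ, hmem, ⟨fun s l a hsa => ?_, fun s j hj l hl hlt => ?_⟩⟩
  · obtain ⟨j, -, h2⟩ := h.good _ ((hmem s l a).1 hsa)
    exact ⟨j, h2⟩
  · obtain ⟨⟨s', l', a⟩, he, h1, h2⟩ := h.complete s j (Or.inl hj) (hl ▸ hlt)
    simp only at h1 h2
    have h3 : l' = l := Fin.ext (by omega)
    subst h1 h3
    rw [(hmem s' l' a).2 he]
    rfl

end SelList

end CMDP

/-! ### The main program and its correctness -/

namespace RAM
open CMDP

namespace Code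

open RAM.Expr

/-- Store the value of an expression for each state. -/
def perState (d : ℕ) (e : Expr) : Code := .loop 13 2 (.store d (.var 13) e)

/-- The value of the safe step for a state. -/
def safeResult : Code :=
  .ite (.cell 16 (.var 13))
    (.ite (.minus (.cell 16 (.var 13)) (.lit 1)) (.store 19 (.var 13) (.var 5))
      (.store 19 (.var 13) (.lit 0)))
    (.store 19 (.var 13) (.var 20))

/-- The value of the step for positive reachability for a state. -/
def posResult : Code :=
  .ite (.cell 16 (.var 13))
    (.ite (.minus (.cell 16 (.var 13)) (.lit 1)) (.store 19 (.var 13) (.var 5))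
      (.ite (.minus (.var 5) (.var 20)) (.store 19 (.var 13) (.lit 0))
        (.store 19 (.var 13) (.var 5))))
    (.store 19 (.var 13) (.var 20))

/-- The position of the next triple in the output. -/
def nextTriple : Expr := .plus (.plus (.var 2) (.lit 1)) (.times (.lit 3) (.var 25))

/-- Append a triple to the output. -/
def appendTriple : Code :=
  .seq (.store 1 nextTriple (.var 13))
    (.seq (.store 1 (.plus nextTriple (.lit 1)) (.cell 19 (.var 13)))
      (.seq (.store 1 (.plus nextTriple (.lit 2)) (.var 21))
        (.store 25 (.lit 0) (.minus (.var 9) (.minus (.var 9) (.plus (.var 25) (.lit 1)))))))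

/-- Append a triple if the load of the state has been improved. -/
def appendIfImproved : Code :=
  .ite (.minus (.cell 18 (.var 13)) (.cell 19 (.var 13))) appendTriple .skip

/-- A step of the iteration for the safe loads. -/
def safeRow : Code := .loop 13 2 (.seq (best 17) safeResult)

/-- A step of the iteration for positive reachability. -/
def posRow : Code := .loop 13 2 (.seq (best 18) (.seq posResult appendIfImproved))

/-- Compute the safe loads. -/
def safePhase : Code :=
  .seq (perState 17 (.var 5)) (.loop 12 2 (.seq safeRow (perState 17 (.cell 19 (.var 13)))))

/-- Compute the loads for positive reachability. -/
def posPhase : Code :=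
  .seq (perState 18 (.var 5)) (.seq (.store 25 (.lit 0) (.lit 0))
    (.loop 12 4 (.seq posRow (perState 18 (.cell 19 (.var 13))))))

/-- Remove the reload states from which the target is not reachable. -/
def pruneStates : Code :=
  .loop 13 2 (.ite (.cell 16 (.var 13))
    (.ite (.minus (.var 5) (.cell 18 (.var 13))) .skip (.store 16 (.var 13) (.lit 2))) .skip)

/-- Compute the reload states that are kept in the end and the resulting loads. -/
def main : Code :=
  .seq (perState 16 (.cell 0 (.plus (.var 7) (.var 13))))
    (.seq (.loop 11 2 (.seq safePhase (.seq posPhase pruneStates))) (.seq safePhase posPhase))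

end Code

/-- Array `d` changes during the loop, so the value of `e` has to be determined by the loop variable
and the other arrays. -/
theorem run_perState {d : ℕ} {e : Expr} {m : Memory} {g : ℕ → ℕ} (hd : d ≠ 13)
    (he : ∀ i < m 2 0, ∀ m' : Memory, m' 13 0 = i → (∀ a, a ≠ 13 → a ≠ d → m' a = m a) →
      e.eval m' = g i) :
    ∀ i < m 2 0, (Code.perState d e).run m d i = g i := by
  refine Code.loop_inv (x := 13) (b := 2) (c := .store d (.var 13) e) (m := m)
    (fun i m' => ∀ j < i, m' d j = g j) (by simp) ?_
  intro i hi m' hi' hf ih j hj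
  have he' := he i hi m' hi' fun a h h' =>
    hf a (by simp [Code.touches, Ne.symm h, Ne.symm h'])
  rw [Memory.write_of_ne _ hd]
  simp only [Code.run, Expr.eval, hi', he', Memory.write_apply, true_and]
  split_ifs with h
  · rw [h]
  · exact ih j (by omega)

variable {n k : ℕ} {M : CMDP (Fin n) (Fin k)} {T K : Finset (Fin n)} {m : Memory}
  {v x : Fin n → ℕ}

/-- Array `16` represents the set of kept reload states. -/
def Keeps (M : CMDP (Fin n) (Fin k)) (K : Finset (Fin n)) (m : Memory) : Prop :=
  ∀ s : Fin n, m 16 s = if s ∈ M.reload then (if s ∈ K then 1 else 2) else 0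

/-- The results go to array `19` while array `17` keeps the old values, so all states are updated
simultaneously. -/
theorem run_safeRow (hE : Env M T m) (hK : Keeps M K m) (hv : ∀ t : Fin n, m 17 t = v t) :
    ∀ t : Fin n, Code.safeRow.run m 19 t = M.safeStep T K v t := by
  have hn := hE.states
  have key := Code.loop_inv (x := 13) (b := 2) (c := .seq (Code.best 17) Code.safeResult) (m := m)
    (fun i m' => ∀ t : Fin n, (t : ℕ) < i → m' 19 t = M.safeStep T K v t) (by simp) ?_
  · rw [hn] at key
    exact fun t => key t t.2
  · intro i hi m' hi' hf ih t ht
    rw [hn] at hi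
    have hE' : Env M T m' := hE.congr fun a ha => hf a
      (Code.KeepsInput.of_lt (c := Code.safeRow) rfl rfl rfl rfl rfl rfl rfl rfl rfl a ha)
    have e16 : m' 16 = m 16 := hf 16 rfl
    have e17 : m' 17 = m 17 := hf 17 rfl
    set s : Fin n := ⟨i, hi⟩ with hs
    obtain ⟨h20, -⟩ := run_best (xa := 17) (s := s) (v := v) (x := v) hE' hi'
      (fun t => by rw [e17]; exact hv t) (Or.inl rfl) (fun t => by rw [e17]; exact hv t)
    set m₁ := (Code.best 17).run m' with hm₁
    have hf₁ : ∀ b, (Code.best 17).touches b = false → m₁ b = m' b := fun b hb =>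
      Code.run_eq_of_not_touches hb m'
    have hE₁ : Env M T m₁ := hE'.run (best_keepsInput 17)
    have f13 : m₁ 13 0 = i := by rw [hf₁ 13 rfl, hi']
    have f16 : m₁ 16 i = m 16 i := by rw [hf₁ 16 rfl, e16]
    have f19 : m₁ 19 = m' 19 := hf₁ 19 rfl
    have hKs : m 16 i = _ := hK s
    rw [Memory.write_of_ne _ (show (19 : ℕ) ≠ 13 by decide)]
    simp only [Code.safeResult, Code.run, Expr.eval, ← hm₁, Code.branch_apply, Memory.write_apply,
      f13, f16, hE₁.cap, h20, f19, hKs, true_and]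
    by_cases hti : (t : ℕ) = i
    · obtain rfl : t = s := Fin.ext hti
      simp only [hti, if_true, safeStep]
      by_cases hr : s ∈ M.reload
      · by_cases hk : s ∈ K <;> simp [hr, hk]
      · simp [hr]
    · simp only [hti, if_false, ite_self]
      exact ih t (by omega)

theorem run_copy {d : ℕ} (hd : d ≠ 13) (hd' : d ≠ 19) (hn : m 2 0 = n)
    (hy : ∀ t : Fin n, m 19 t = v t) (t : Fin n) :
    (Code.perState d (.cell 19 (.var 13))).run m d t = v t := by
  rw [← hy]
  refine run_perState (g := fun i => m 19 i) hd (fun i _ m' hi' hf => ?_) t (hn ▸ t.2)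
  simp only [Expr.eval, hi', hf 19 (by decide) hd'.symm]

theorem run_fill {d : ℕ} (hd : d ≠ 13) (hd' : d ≠ 5) (hE : Env M T m) (t : Fin n) :
    (Code.perState d (.var 5)).run m d t = M.cap + 1 := by
  refine run_perState (g := fun _ => M.cap + 1) hd (fun i _ m' hi' hf => ?_) t
    (hE.states ▸ t.2)
  simp only [Expr.eval, hf 5 (by decide) hd'.symm, hE.cap]

theorem safePhase_keepsInput : Code.safePhase.KeepsInput :=
  .of_lt rfl rfl rfl rfl rfl rfl rfl rfl rfl

theorem posPhase_keepsInput : Code.posPhase.KeepsInput :=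
  .of_lt rfl rfl rfl rfl rfl rfl rfl rfl rfl

theorem run_safePhase (hE : Env M T m) (hK : Keeps M K m) (t : Fin n) :
    Code.safePhase.run m 17 t = M.safeVal T K t := by
  set m₀ := (Code.perState 17 (.var 5)).run m with hm₀
  have hf₀ : ∀ b, (Code.perState 17 (.var 5)).touches b = false → m₀ b = m b := fun b hb =>
    Code.run_eq_of_not_touches hb m
  have hE₀ : Env M T m₀ := hE.run (.of_lt rfl rfl rfl rfl rfl rfl rfl rfl rfl)
  have hK₀ : Keeps M K m₀ := fun s => by rw [hf₀ 16 rfl]; exact hK s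
  have key := Code.loop_inv (x := 12) (b := 2)
    (c := .seq Code.safeRow (Code.perState 17 (.cell 19 (.var 13)))) (m := m₀)
    (fun i m' => ∀ t : Fin n, m' 17 t = M.safeIter T K i t) ?_ ?_
  · rw [hE₀.states] at key
    refine (key t).trans ?_
    rw [safeVal, Fintype.card_fin]
  · intro t
    rw [Memory.write_of_ne _ (show (17 : ℕ) ≠ 12 by decide), hm₀,
      run_fill (by decide) (by decide) hE]
    rfl
  · intro i hi m' hi' hf ih t
    have hE' : Env M T m' := hE₀.congr fun a ha => hf a
      (Code.KeepsInput.of_lt (c := .loop 12 2 (.seq Code.safeRow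
        (Code.perState 17 (.cell 19 (.var 13))))) rfl rfl rfl rfl rfl rfl rfl rfl rfl a ha)
    have hK' : Keeps M K m' := fun s => by rw [hf 16 rfl]; exact hK₀ s
    rw [Memory.write_of_ne _ (show (17 : ℕ) ≠ 12 by decide), Code.run]
    rw [run_copy (by decide) (by decide)
      (hE'.run (.of_lt rfl rfl rfl rfl rfl rfl rfl rfl rfl)).states (run_safeRow hE' hK' ih),
      safeIter_succ]

/-- The list is written in the output. -/
def Written (m : Memory) (L : List (Fin n × M.Level × Fin k)) : Prop :=
  m 25 0 = L.length ∧ ∀ c e, L[c]? = some e → m 1 (n + 1 + 3 * c) = e.1 ∧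
    m 1 (n + 1 + 3 * c + 1) = e.2.1 ∧ m 1 (n + 1 + 3 * c + 2) = e.2.2

theorem Written.congr {m' : Memory} {L : List (Fin n × M.Level × Fin k)} (h : Written m L)
    (h1 : m' 1 = m 1) (h25 : m' 25 = m 25) : Written m' L := by
  unfold Written at *
  rwa [h1, h25]

theorem run_posResult (hE : Env M T m) (hK : Keeps M K m) (s : Fin n) (hs : m 13 0 = s)
    (hb : m 20 0 = M.best T v x s) (i : ℕ) :
    Code.posResult.run m 19 i = if i = s then M.posStep T K v x s else m 19 i := by
  have hKs := hK s
  simp only [Code.posResult, Code.run, Expr.eval, Code.branch_apply, Memory.write_apply, hs, hb,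
    hE.cap, hKs, true_and, posStep]
  by_cases hi : i = s
  · simp only [hi, if_true]
    by_cases hr : s ∈ M.reload
    · by_cases hk : s ∈ K
      · simp [hr, hk]
        split_ifs <;> omega
      · simp [hr, hk]
    · simp [hr]
  · simp only [hi, if_false, ite_self]

/-- The counter is increased through a truncated expression to keep the program static; by `hlen`
the truncation has no effect. The triples start at cell `n + 1`, after the output length and the `n`
initial levels. -/
theorem run_appendTriple (hE : Env M T m) {L : List (Fin n × M.Level × Fin k)}
    (hL : Written m L) (hlen : L.length < rounds (Fin n) * n) (s : Fin n) (l : M.Level)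
    (a : Fin k) (hs : m 13 0 = s) (hl : m 19 s = l) (ha : m 21 0 = a) :
    Written (Code.appendTriple.run m) (L ++ [(s, l, a)]) := by
  obtain ⟨h25, hc⟩ := hL
  have hlim := hE.limit
  have hn := hE.states
  have e25 : Code.appendTriple.run m 25 0 = L.length + 1 := by
    simp only [Code.appendTriple, Code.run, Expr.eval, Memory.write_apply]
    simp only [reduceIte, Nat.reduceEqDiff, false_and, and_true, hlim, h25]
    omega
  have e1 : ∀ j, Code.appendTriple.run m 1 j =
      if j = n + 1 + 3 * L.length + 2 then (a : ℕ) else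
      if j = n + 1 + 3 * L.length + 1 then (l : ℕ) else
      if j = n + 1 + 3 * L.length then (s : ℕ) else m 1 j := by
    intro j
    simp only [Code.appendTriple, Code.run, Expr.eval, Code.nextTriple, Memory.write_apply]
    simp only [reduceIte, Nat.reduceEqDiff, false_and, true_and, h25, hn, hs, hl, ha]
  refine ⟨by rw [e25]; simp, fun c e he => ?_⟩
  rw [e1, e1, e1]
  rcases lt_trichotomy c L.length with h | h | h
  · rw [List.getElem?_append_left h] at he
    obtain ⟨h1, h2, h3⟩ := hc c e he
    rw [if_neg (by omega), if_neg (by omega), if_neg (by omega), if_neg (by omega),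
      if_neg (by omega), if_neg (by omega), if_neg (by omega), if_neg (by omega),
      if_neg (by omega)]
    exact ⟨h1, h2, h3⟩
  · subst h
    simp only [List.getElem?_append_right le_rfl, Nat.sub_self, List.getElem?_cons_zero,
      Option.some.injEq] at he
    subst he
    rw [if_neg (by omega), if_neg (by omega), if_pos rfl, if_neg (by omega), if_pos rfl,
      if_pos rfl]
    exact ⟨rfl, rfl, rfl⟩
  · rw [List.getElem?_eq_none (by simp; omega)] at he
    simp at he

/-- A triple is appended exactly when a value drops, hence at most one per state and round; this
keeps the counter within its limit. -/
theorem run_posRow (hE : Env M T m) (hK : Keeps M K m)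
    (hv : ∀ t : Fin n, m 17 t = M.safeVal T K t) {J : ℕ} (hJ : J < rounds (Fin n))
    (hx : ∀ t : Fin n, m 18 t = M.posIter T K J t)
    (hL : ∃ L, Written (M := M) m L ∧ SelList M T K J 0 L) :
    (∀ t : Fin n, Code.posRow.run m 19 t = M.posIter T K (J + 1) t) ∧
      ∃ L, Written (M := M) (Code.posRow.run m) L ∧ SelList M T K (J + 1) 0 L := by
  have hn := hE.states
  have key := Code.loop_inv (x := 13) (b := 2)
    (c := .seq (Code.best 18) (.seq Code.posResult Code.appendIfImproved)) (m := m)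
    (fun i m' => (∀ t : Fin n, (t : ℕ) < i → m' 19 t = M.posIter T K (J + 1) t) ∧
      ∃ L, Written (M := M) m' L ∧ SelList M T K J i L) ?_ ?_
  · rw [hn] at key
    obtain ⟨h1, L, h2, h3⟩ := key
    exact ⟨fun t => h1 t t.2, L, h2, h3.next_round⟩
  · obtain ⟨L, h1, h2⟩ := hL
    exact ⟨by simp, L, h1.congr (Memory.write_of_ne _ (by decide) _ _)
      (Memory.write_of_ne _ (by decide) _ _), h2⟩
  · intro i hi m' hi' hf ⟨ih, L, hL, hS⟩
    rw [hn] at hi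
    have hE' : Env M T m' := hE.congr fun a ha => hf a
      (Code.KeepsInput.of_lt (c := Code.posRow) rfl rfl rfl rfl rfl rfl rfl rfl rfl a ha)
    have e17 : m' 17 = m 17 := hf 17 rfl
    have e18 : m' 18 = m 18 := hf 18 rfl
    set s : Fin n := ⟨i, hi⟩ with hs
    obtain ⟨h20, h21⟩ := run_best (xa := 18) (s := s) (v := M.safeVal T K)
      (x := M.posIter T K J) hE' hi' (fun t => by rw [e17]; exact hv t) (Or.inr rfl)
      (fun t => by rw [e18]; exact hx t)
    set m₁ := (Code.best 18).run m' with hm₁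
    have hf₁ : ∀ b, (Code.best 18).touches b = false → m₁ b = m' b := fun b hb =>
      Code.run_eq_of_not_touches hb m'
    have hE₁ : Env M T m₁ := hE'.run (best_keepsInput 18)
    have hK₁ : Keeps M K m₁ := fun t => by rw [hf₁ 16 rfl, hf 16 rfl]; exact hK t
    set m₂ := Code.posResult.run m₁ with hm₂
    have hf₂ : ∀ b, Code.posResult.touches b = false → m₂ b = m₁ b := fun b hb =>
      Code.run_eq_of_not_touches hb m₁
    have hE₂ : Env M T m₂ := hE₁.run (.of_lt rfl rfl rfl rfl rfl rfl rfl rfl rfl)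
    have h19 : ∀ j, m₂ 19 j = if j = s then M.posIter T K (J + 1) s else m' 19 j := by
      intro j
      rw [posIter_succ, hm₂, run_posResult hE₁ hK₁ s (by rw [hf₁ 13 rfl, hi']) h20 j, hf₁ 19 rfl]
    have g13 : m₂ 13 0 = s := by rw [hf₂ 13 rfl, hf₁ 13 rfl, hi']
    have g18 : m₂ 18 s = M.posIter T K J s := by rw [hf₂ 18 rfl, hf₁ 18 rfl, e18]; exact hx s
    have g21 : m₂ 21 = m₁ 21 := hf₂ 21 rfl
    have hL₂ : Written m₂ L := hL.congr (by rw [hf₂ 1 rfl, hf₁ 1 rfl])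
      (by rw [hf₂ 25 rfl, hf₁ 25 rfl])
    set m₃ := Code.appendIfImproved.run m₂ with hm₃
    have hrun : (Code.seq (Code.best 18) (.seq Code.posResult Code.appendIfImproved)).run m' =
      m₃ := rfl
    rw [hrun]
    refine ⟨fun t ht => ?_, ?_⟩
    · rw [Memory.write_of_ne _ (show (19 : ℕ) ≠ 13 by decide), hm₃,
        Code.run_eq_of_not_touches rfl, h19]
      split_ifs with h
      · rw [Fin.ext h]
      · exact ih t (by simp only [hs] at h; omega)
    · have hm₃' : m₃ = if M.posIter T K J s - M.posIter T K (J + 1) s = 0 then m₂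
          else Code.appendTriple.run m₂ := by
        rw [hm₃, Code.appendIfImproved, Code.run, Code.branch]
        simp only [Expr.eval, g13, g18, h19, if_true, Code.run]
      by_cases hlt : M.posIter T K (J + 1) s < M.posIter T K J s
      · rw [hm₃', if_neg (by omega)]
        -- After a strict drop the value is at most `cap`, so `best` is too, and array `21` holds a
        -- good action.
        have hle : M.posIter T K (J + 1) s ≤ M.cap := by
          have := M.posIter_le T K J s
          omega
        have hb : M.best T (M.safeVal T K) (M.posIter T K J) s ≤ M.cap := by
          rw [posIter_succ, posStep] at hle
          by_cases hr : s ∈ M.reload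
          · rw [if_pos hr] at hle
            by_contra hc
            rw [if_neg fun h => hc h.2] at hle
            omega
          · rwa [if_neg hr] at hle
        obtain ⟨a, ha, hg⟩ := h21 hb
        set l : M.Level := ⟨M.posIter T K (J + 1) s, by omega⟩ with hl
        have hlen : L.length < rounds (Fin n) * n := by
          have := hS.length
          have := Nat.mul_le_mul_right n (show J + 1 ≤ rounds (Fin n) from hJ)
          rw [add_mul] at this
          omega
        refine ⟨L ++ [(s, l, a)], ?_, hS.append hi rfl hlt hg⟩
        refine (run_appendTriple hE₂ hL₂ hlen s l a g13 (by rw [h19, if_pos rfl])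
          (by rw [g21, ha])).congr (Memory.write_of_ne _ (by decide) _ _)
          (Memory.write_of_ne _ (by decide) _ _)
      · rw [hm₃', if_pos (by omega)]
        exact ⟨L, hL₂.congr (Memory.write_of_ne _ (by decide) _ _)
          (Memory.write_of_ne _ (by decide) _ _), hS.skip hi hlt⟩

/-- Each phase resets the counter in array `25`, so triples left over from an earlier phase do not
count. -/
theorem run_posPhase (hE : Env M T m) (hK : Keeps M K m)
    (hv : ∀ t : Fin n, m 17 t = M.safeVal T K t) :
    (∀ t : Fin n, Code.posPhase.run m 18 t = M.posVal T K t) ∧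
      ∃ L, Written (M := M) (Code.posPhase.run m) L ∧ SelList M T K (rounds (Fin n)) 0 L := by
  set m₁ := (Code.perState 18 (.var 5)).run m with hm₁
  have hf₁ : ∀ b, (Code.perState 18 (.var 5)).touches b = false → m₁ b = m b := fun b hb =>
    Code.run_eq_of_not_touches hb m
  set m₀ := m₁.write 25 0 0 with hm₀
  have hf₀ : ∀ b, b ≠ 25 → m₀ b = m₁ b := fun b hb => Memory.write_of_ne _ hb _ _
  have hE₁ : Env M T m₁ := hE.run (.of_lt rfl rfl rfl rfl rfl rfl rfl rfl rfl)
  have hE₀ : Env M T m₀ := hE₁.congr fun a ha => hf₀ a (by rintro rfl; simp [isInput] at ha)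
  have hK₀ : Keeps M K m₀ := fun s => by
    rw [hf₀ 16 (by decide), hf₁ 16 rfl]; exact hK s
  have hv₀ : ∀ t : Fin n, m₀ 17 t = M.safeVal T K t := fun t => by
    rw [hf₀ 17 (by decide), hf₁ 17 rfl]; exact hv t
  have key := Code.loop_inv (x := 12) (b := 4)
    (c := .seq Code.posRow (Code.perState 18 (.cell 19 (.var 13)))) (m := m₀)
    (fun i m' => (∀ t : Fin n, m' 18 t = M.posIter T K i t) ∧
      ∃ L, Written (M := M) m' L ∧ SelList M T K i 0 L) ?_ ?_
  · rw [hE₀.rounds] at key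
    exact key
  · refine ⟨fun t => ?_, [], ⟨?_, by simp⟩, SelList.nil⟩
    · rw [Memory.write_of_ne _ (show (18 : ℕ) ≠ 12 by decide), hf₀ 18 (by decide), hm₁,
        run_fill (by decide) (by decide) hE]
      rfl
    · rw [Memory.write_of_ne _ (show (25 : ℕ) ≠ 12 by decide), hm₀, Memory.write_same]
      rfl
  · intro i hi m' hi' hf ⟨ih, hL⟩
    rw [hE₀.rounds] at hi
    have hE' : Env M T m' := hE₀.congr fun a ha => hf a
      (Code.KeepsInput.of_lt (c := .loop 12 4 (.seq Code.posRow
        (Code.perState 18 (.cell 19 (.var 13))))) rfl rfl rfl rfl rfl rfl rfl rfl rfl a ha)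
    have hK' : Keeps M K m' := fun s => by rw [hf 16 rfl]; exact hK₀ s
    obtain ⟨h1, L, h2, h3⟩ := run_posRow hE' hK' (fun t => by rw [hf 17 rfl]; exact hv₀ t) hi
      ih hL
    refine ⟨fun t => ?_, L, ?_, h3⟩
    · rw [Memory.write_of_ne _ (show (18 : ℕ) ≠ 12 by decide), Code.run]
      exact run_copy (by decide) (by decide)
        (hE'.run (.of_lt rfl rfl rfl rfl rfl rfl rfl rfl rfl)).states h1 t
    · refine h2.congr ?_ ?_
      · rw [Memory.write_of_ne _ (by decide), Code.run, Code.run_eq_of_not_touches rfl]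
      · rw [Memory.write_of_ne _ (by decide), Code.run, Code.run_eq_of_not_touches rfl]

theorem run_pruneStates (hE : Env M T m) (hK : Keeps M K m)
    (hx : ∀ t : Fin n, m 18 t = M.posVal T K t) :
    Keeps M (M.prune T K) (Code.pruneStates.run m) := by
  have hn := hE.states
  have key := Code.loop_inv (x := 13) (b := 2)
    (c := .ite (.cell 16 (.var 13)) (.ite (.minus (.var 5) (.cell 18 (.var 13))) .skip
      (.store 16 (.var 13) (.lit 2))) .skip) (m := m)
    (fun i m' => ∀ t : Fin n, m' 16 t = if t ∈ M.reload then
      (if t ∈ K ∧ ((t : ℕ) < i → M.posVal T K t ≤ M.cap) then 1 else 2) else 0) ?_ ?_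
  · rw [hn] at key
    intro t
    have := key t
    simp only [t.2, forall_const] at this
    simp only [prune, Finset.mem_filter]
    exact this
  · intro t
    rw [Memory.write_of_ne _ (show (16 : ℕ) ≠ 13 by decide), hK t]
    simp
  · intro i hi m' hi' hf ih t
    rw [hn] at hi
    set s : Fin n := ⟨i, hi⟩ with hs
    have e5 : m' 5 0 = M.cap + 1 := by rw [hf 5 rfl, hE.cap]
    have e18 : m' 18 i = M.posVal T K s := by rw [hf 18 rfl]; exact hx s
    have e16 : m' 16 i = _ := ih s
    rw [Memory.write_of_ne _ (show (16 : ℕ) ≠ 13 by decide)]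
    simp only [Code.run, Expr.eval, Code.branch_apply, Memory.write_apply, hi', e5, e18, true_and]
    by_cases hti : (t : ℕ) = i
    · obtain rfl : t = s := Fin.ext hti
      simp only [hti, if_true, e16]
      by_cases hr : s ∈ M.reload
      · by_cases hk : s ∈ K
        · simp [hr, hk]
          split_ifs <;> omega
        · simp [hr, hk]
      · simp [hr]
    · simp only [hti, if_false, ite_self, ih t]
      have : (t : ℕ) < i + 1 ↔ (t : ℕ) < i := by omega
      simp only [this]

/-- Pruning `n` times reaches `kept`; the phases are then run once more, to obtain the loads and the
triples for this final set. -/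
theorem run_main (hE : Env M T m) :
    Env M T (Code.main.run m) ∧
      (∀ t : Fin n, Code.main.run m 17 t = M.safeVal T (M.kept T) t) ∧
      ∃ L, Written (M := M) (Code.main.run m) L ∧
        SelList M T (M.kept T) (rounds (Fin n)) 0 L := by
  set m₁ := (Code.perState 16 (.cell 0 (.plus (.var 7) (.var 13)))).run m with hm₁
  have hE₁ : Env M T m₁ := hE.run (.of_lt rfl rfl rfl rfl rfl rfl rfl rfl rfl)
  have hK₁ : Keeps M M.reload m₁ := by
    intro s
    refine (run_perState (g := fun i => m 0 (m 7 0 + i)) (by decide)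
      (fun i _ m' hi' hf => ?_) s (hE.states ▸ s.2)).trans ?_
    · simp only [Expr.eval, hi', hf 0 (by decide) (by decide), hf 7 (by decide) (by decide)]
    · simp only [hE.reload]
      by_cases hr : s ∈ M.reload <;> simp [hr]
  set body : Code := .seq Code.safePhase (.seq Code.posPhase Code.pruneStates) with hbody
  have key := Code.loop_inv (x := 11) (b := 2) (c := body) (m := m₁)
    (fun i m' => Keeps M ((M.prune T)^[i] M.reload) m') ?_ ?_
  · set m₂ := (Code.loop 11 2 body).run m₁ with hm₂
    have hE₂ : Env M T m₂ := hE₁.run (.of_lt rfl rfl rfl rfl rfl rfl rfl rfl rfl)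
    rw [hE₁.states] at key
    have hK₂ : Keeps M (M.kept T) m₂ := by
      rw [kept, Fintype.card_fin]
      exact key
    have hv := run_safePhase hE₂ hK₂
    have hE₃ := hE₂.run safePhase_keepsInput
    have hK₃ : Keeps M (M.kept T) (Code.safePhase.run m₂) := fun s => by
      rw [Code.run_eq_of_not_touches rfl]; exact hK₂ s
    have hrun : Code.main.run m = Code.posPhase.run (Code.safePhase.run m₂) := rfl
    rw [hrun]
    refine ⟨hE₃.run posPhase_keepsInput, fun t => ?_, (run_posPhase hE₃ hK₃ hv).2⟩
    rw [Code.run_eq_of_not_touches rfl]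
    exact hv t
  · intro s
    rw [Memory.write_of_ne _ (show (16 : ℕ) ≠ 11 by decide)]
    exact hK₁ s
  · intro i hi m' hi' hf ih
    have hE' : Env M T m' := hE₁.congr fun a ha => hf a
      (Code.KeepsInput.of_lt (c := .loop 11 2 body) rfl rfl rfl rfl rfl rfl rfl rfl rfl a ha)
    have hv := run_safePhase hE' ih
    have hE₃ := hE'.run safePhase_keepsInput
    have hK₃ : Keeps M ((M.prune T)^[i] M.reload) (Code.safePhase.run m') := fun s => by
      rw [Code.run_eq_of_not_touches rfl]; exact ih s
    have hx := (run_posPhase hE₃ hK₃ hv).1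
    have hE₄ := hE₃.run posPhase_keepsInput
    have hK₄ : Keeps M ((M.prune T)^[i] M.reload)
        (Code.posPhase.run (Code.safePhase.run m')) := fun s => by
      rw [Code.run_eq_of_not_touches rfl]; exact hK₃ s
    have := run_pruneStates hE₄ hK₄ hx
    intro s
    rw [Memory.write_of_ne _ (show (16 : ℕ) ≠ 11 by decide), Function.iterate_succ_apply']
    exact this s

end RAM

namespace CMDP

/-- Passing from a selector to a strategy needs some action `a₀`; a value within the capacity is
witnessed by a good action. -/
theorem nonempty_action_of_safeVal_le {S A : Type} [DecidableEq S] [Fintype S] {M : CMDP S A}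
    {T K : Finset S} (hK : M.prune T K = K) {s : S} (hs : M.safeVal T K s ≤ M.cap) :
    Nonempty A := by
  have h := (posVal_le_safeVal hK s).trans hs
  have hb : M.best T (M.safeVal T K) (M.posVal T K) s ≤ M.cap := by
    rw [← M.posStep_posVal, posStep] at h
    by_cases hr : s ∈ M.reload
    · rw [if_pos hr] at h
      by_contra hc
      rw [if_neg fun h => hc h.2] at h
      exact absurd h (Nat.not_succ_le_self _)
    · rwa [if_neg hr] at h
  obtain ⟨a, -⟩ := (M.best_le_iff T hb).1 le_rfl
  exact ⟨a⟩

end CMDP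

namespace RAM

/-! ### Polynomial time -/

theorem length_le_bitSize (x : List ℕ) : x.length ≤ bitSize x := by
  induction x with
  | nil => simp
  | cons a x ih =>
    simp only [bitSize, List.length_cons, List.map_cons, List.sum_cons] at *
    omega

theorem size_le_bitSize {x : List ℕ} {a : ℕ} (h : a ∈ x) : a.size ≤ bitSize x :=
  (Nat.le_succ _).trans (List.single_le_sum (by simp) _ (List.mem_map_of_mem h))

theorem size_le_self (a : ℕ) : a.size ≤ a := Nat.size_le.2 Nat.lt_two_pow_self

theorem input_bounded (x : List ℕ) : Memory.Bounded (input x) (bitSize x) := by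
  intro a i
  unfold input
  split_ifs
  · cases i with
    | zero => exact (size_le_self _).trans (length_le_bitSize x)
    | succ i =>
      rw [List.getD_cons_succ, List.getD_eq_getElem?_getD]
      cases h : x[i]? with
      | none => simp
      | some b => exact size_le_bitSize (List.mem_of_getElem? h)
  · simp

theorem bitSize_output_le {m : Memory} {B : ℕ} (hm : m.Bounded B) :
    bitSize (output m) ≤ m 1 0 * (B + 1) := by
  have := List.sum_le_card_nsmul ((output m).map fun n => n.size + 1) (B + 1) (by
    intro b hb
    simp only [output, List.map_map, List.mem_map, Function.comp] at hb
    obtain ⟨i, -, rfl⟩ := hb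
    exact Nat.succ_le_succ (hm _ _))
  simpa [bitSize, output] using this

/-- A straight preparation, a static main part and a straight conclusion give a polynomial time
algorithm. -/
theorem solvableInPolyTime_of_code {ι : Type} {dom : ι → Prop} {enc : ι → List ℕ}
    {sol : ι → List ℕ → Prop} {c₁ c₂ c₃ : Code} (h₁ : c₁.straight = true) (h₂ : c₂.static = true)
    (h₃ : c₃.straight = true) (P P' : Polynomial ℕ)
    (hP : ∀ I, dom I → ∀ b, isSmall b = true →
      c₁.run (input (enc I)) b 0 ≤ P.eval (bitSize (enc I)))
    (hP' : ∀ I, dom I →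
      c₃.run (c₂.run (c₁.run (input (enc I)))) 1 0 ≤ P'.eval (bitSize (enc I)))
    (hsol : ∀ I, dom I → sol I (output (c₃.run (c₂.run (c₁.run (input (enc I))))))) :
    SolvableInPolyTime dom enc sol := by
  obtain ⟨T₁, hT₁⟩ := Code.exec_of_straight h₁ Polynomial.X
  -- The summand `2` leaves room for the literals up to `3` that static programs may store.
  obtain ⟨T₂, hT₂⟩ := Code.exec_of_static h₂ P (T₁ + 2)
  obtain ⟨T₃, hT₃⟩ := Code.exec_of_straight h₃ (T₁ + 2)
  refine ⟨.seq c₁.compile (.seq c₂.compile c₃.compile), T₁ + T₂ + T₃ + P' * (T₃ + 1),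
    fun I hI => ?_⟩
  set y := bitSize (enc I)
  obtain ⟨t₁, ht₁, hE₁, hb₁⟩ := hT₁ y (input (enc I)) (by
    rw [Polynomial.eval_X]; exact input_bounded _)
  obtain ⟨t₂, ht₂, hE₂, hb₂⟩ := hT₂ y _ (hb₁.mono (by simp)) (by simp) (hP I hI)
  obtain ⟨t₃, ht₃, hE₃, hb₃⟩ := hT₃ y _ hb₂
  refine ⟨_, _, Exec.seq hE₁ (Exec.seq hE₂ hE₃), ?_, ?_, hsol I hI⟩
  · simp only [Polynomial.eval_add]
    omega
  · refine (bitSize_output_le hb₃).trans ?_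
    simp only [Polynomial.eval_add, Polynomial.eval_mul, Polynomial.eval_one]
    exact (Nat.mul_le_mul_right _ (hP' I hI)).trans (Nat.le_add_left _ _)

/-! ### Reading the input -/

/-- A flattened table with rows of length `b` is addressed by row and column; nesting this locates
the entries of the three-dimensional part of the encoding. -/
theorem getElem?_flatMap_of_length {α : Type} {f : α → List ℕ} {b : ℕ}
    (hf : ∀ a, (f a).length = b) {l : List α} {i j : ℕ} {a : α} (hi : l[i]? = some a)
    (hj : j < b) : (l.flatMap f)[i * b + j]? = (f a)[j]? := by
  induction l generalizing i with
  | nil => simp at hi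
  | cons c l ih =>
    rw [List.flatMap_cons]
    cases i with
    | zero =>
      simp only [List.getElem?_cons_zero, Option.some.injEq] at hi
      subst hi
      rw [zero_mul, zero_add, List.getElem?_append_left (by rw [hf]; exact hj)]
    | succ i =>
      rw [List.getElem?_cons_succ] at hi
      rw [List.getElem?_append_right (by rw [hf, add_mul]; omega), hf, ← ih hi]
      congr 1
      rw [add_mul]
      omega

theorem length_flatMap_of_length {α : Type} {f : α → List ℕ} {b : ℕ}
    (hf : ∀ a, (f a).length = b) (l : List α) : (l.flatMap f).length = l.length * b := by
  induction l with
  | nil => simp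
  | cons c l ih => rw [List.flatMap_cons, List.length_append, hf, ih, List.length_cons]; ring

theorem getElem?_finRange {n : ℕ} (s : Fin n) : (List.finRange n)[(s : ℕ)]? = some s := by
  simp

variable (I : BuchiInstance)

/-- Positions shift by one because cell `0` holds the length. -/
theorem input_encode (i v : ℕ) (h : I.encode[i]? = some v) : input I.encode 0 (i + 1) = v := by
  simp [input, h]

/-- The parts of the encoding. -/
theorem exists_encode : ∃ A B C D : List ℕ,
    I.encode = [I.n, I.k, I.M.cap, (I.initial : ℕ), (I.load : ℕ)] ++ A ++ B ++ C ++ D ∧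
    A.length = I.n * I.k ∧ B.length = I.n * I.k * I.n * 2 ∧ C.length = I.n ∧ D.length = I.n ∧
    (∀ (s : Fin I.n) (a : Fin I.k), A[(s : ℕ) * I.k + a]? = some (I.M.cons s a)) ∧
    (∀ (s : Fin I.n) (a : Fin I.k) (t : Fin I.n),
      B[(((s : ℕ) * I.k + a) * I.n + t) * 2]? = some (I.rat s a t).num) ∧
    (∀ s : Fin I.n, C[(s : ℕ)]? = some (if s ∈ I.M.reload then 1 else 0)) ∧
    (∀ s : Fin I.n, D[(s : ℕ)]? = some (if s ∈ I.target then 1 else 0)) := by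
  refine ⟨_, _, _, _, rfl, ?_, ?_, by simp, by simp, fun s a => ?_, fun s a t => ?_,
    fun s => ?_, fun s => ?_⟩
  · rw [length_flatMap_of_length (b := I.k) (by simp)]
    simp
  · rw [length_flatMap_of_length (b := I.k * (I.n * 2))]
    · simp only [List.length_finRange]
      ring
    · intro s
      rw [length_flatMap_of_length (b := I.n * 2)]
      · simp
      · intro a
        rw [length_flatMap_of_length (b := 2) (by simp)]
        simp
  · rw [getElem?_flatMap_of_length (b := I.k) (by simp) (getElem?_finRange s) a.2]
    simp
  · have h2 : (t : ℕ) * 2 + 0 < I.n * 2 := by have := t.2; omega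
    have h1 : (a : ℕ) * (I.n * 2) + (t * 2 + 0) < I.k * (I.n * 2) := by
      have := Nat.mul_le_mul_right (I.n * 2) (show (a : ℕ) + 1 ≤ I.k from a.2)
      rw [add_mul] at this
      omega
    have e : (((s : ℕ) * I.k + a) * I.n + t) * 2 =
        s * (I.k * (I.n * 2)) + (a * (I.n * 2) + (t * 2 + 0)) := by ring
    rw [e, getElem?_flatMap_of_length (b := I.k * (I.n * 2)) ?_ (getElem?_finRange s) h1,
      getElem?_flatMap_of_length (b := I.n * 2) ?_ (getElem?_finRange a) h2,
      getElem?_flatMap_of_length (b := 2) (by simp) (getElem?_finRange t) (by omega)]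
    · simp
    · intro a
      rw [length_flatMap_of_length (b := 2) (by simp)]
      simp
    · intro s
      rw [length_flatMap_of_length (b := I.n * 2)]
      · simp
      · intro a
        rw [length_flatMap_of_length (b := 2) (by simp)]
        simp
  · simp
  · simp

/-- The algorithm uses the probabilities only through their supports, and for these the numerators
suffice. -/
theorem mem_succ_iff (s : Fin I.n) (a : Fin I.k) (t : Fin I.n) :
    (I.rat s a t).num ≠ 0 ↔ t ∈ I.M.Succ s a := by
  rw [CMDP.Succ, Set.mem_ofPred_eq, I.trans_eq, NNRat.num_ne_zero, pos_iff_ne_zero]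
  simp

/-! ### Preparation of the memory and production of the output -/

namespace Code

open RAM.Expr

/-- Compute the sizes and the positions of the parts of the input. -/
def prepare : Code :=
  .seq (.store 2 (.lit 0) (.cell 0 (.lit 1)))
    (.seq (.store 3 (.lit 0) (.cell 0 (.lit 2)))
      (.seq (.store 4 (.lit 0) (.times (.plus (.var 2) (.lit 1)) (.plus (.var 2) (.lit 1))))
        (.seq (.store 5 (.lit 0) (.plus (.cell 0 (.lit 3)) (.lit 1)))
          (.seq (.store 6 (.lit 0) (.plus (.lit 6) (.times (.var 2) (.var 3))))
            (.seq (.store 7 (.lit 0) (.plus (.var 6)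
                (.times (.times (.times (.var 2) (.var 3)) (.var 2)) (.lit 2))))
              (.seq (.store 8 (.lit 0) (.plus (.var 7) (.var 2)))
                (.store 9 (.lit 0) (.times (.var 4) (.var 2)))))))))

/-- Output whether the initial load is at least the safe load. -/
def answer : Code :=
  .seq (.store 1 (.lit 0) (.lit 1))
    (.ite (.minus (.plus (.cell 0 (.lit 5)) (.lit 1)) (.cell 17 (.cell 0 (.lit 4))))
      (.store 1 (.lit 1) (.lit 1)) (.store 1 (.lit 1) (.lit 0)))

/-- Write the initial loads. -/
def initialLoads : Code :=
  .loop 13 2 (.store 1 (.plus (.var 13) (.lit 1)) (.cell 0 (.lit 5)))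

/-- Write the length of the output. -/
def outputLength : Code := .store 1 (.lit 0) (.plus (.var 2) (.times (.lit 3) (.var 25)))

end Code

/-- The offset `6` is the length cell plus five header numbers. Then come `n * k` consumptions, two
numbers for each of the `n * k * n` probabilities, and the two characteristic vectors. -/
theorem run_prepare : Env I.M I.target (Code.prepare.run (input I.encode)) ∧
    Code.prepare.run (input I.encode) 0 4 = I.initial ∧
    Code.prepare.run (input I.encode) 0 5 = I.load := by
  obtain ⟨A, B, C, D, hI, hA, hB, hC, hD, hA', hB', hC', hD'⟩ := exists_encode I
  set m := input I.encode with hm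
  have h1 : m 0 1 = I.n := input_encode I 0 _ (by simp [hI])
  have h2 : m 0 2 = I.k := input_encode I 1 _ (by simp [hI])
  have h3 : m 0 3 = I.M.cap := input_encode I 2 _ (by simp [hI])
  have h4 : m 0 4 = I.initial := input_encode I 3 _ (by simp [hI])
  have h5 : m 0 5 = I.load := input_encode I 4 _ (by simp [hI])
  have r0 : Code.prepare.run m 0 = m 0 := Code.run_eq_of_not_touches rfl m
  have r2 : Code.prepare.run m 2 0 = I.n := by
    simp [Code.prepare, Code.run, Expr.eval, Memory.write_apply, h1]
  have r3 : Code.prepare.run m 3 0 = I.k := by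
    simp [Code.prepare, Code.run, Expr.eval, Memory.write_apply, h2]
  have r4 : Code.prepare.run m 4 0 = (I.n + 1) * (I.n + 1) := by
    simp [Code.prepare, Code.run, Expr.eval, Memory.write_apply, h1]
  have r5 : Code.prepare.run m 5 0 = I.M.cap + 1 := by
    simp [Code.prepare, Code.run, Expr.eval, Memory.write_apply, h3]
  have r6 : Code.prepare.run m 6 0 = 6 + I.n * I.k := by
    simp [Code.prepare, Code.run, Expr.eval, Memory.write_apply, h1, h2]
  have r7 : Code.prepare.run m 7 0 = 6 + I.n * I.k + I.n * I.k * I.n * 2 := by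
    simp [Code.prepare, Code.run, Expr.eval, Memory.write_apply, h1, h2]
  have r8 : Code.prepare.run m 8 0 = 6 + I.n * I.k + I.n * I.k * I.n * 2 + I.n := by
    simp [Code.prepare, Code.run, Expr.eval, Memory.write_apply, h1, h2]
  have r9 : Code.prepare.run m 9 0 = (I.n + 1) * (I.n + 1) * I.n := by
    simp [Code.prepare, Code.run, Expr.eval, Memory.write_apply, h1]
  have hpair : ∀ (s : Fin I.n) (a : Fin I.k), (s : ℕ) * I.k + a < I.n * I.k := fun s a => by
    have := Nat.mul_le_mul_right I.k (show (s : ℕ) + 1 ≤ I.n from s.2)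
    rw [add_mul] at this
    omega
  have htriple : ∀ (s : Fin I.n) (a : Fin I.k) (t : Fin I.n),
      (((s : ℕ) * I.k + a) * I.n + t) * 2 < I.n * I.k * I.n * 2 := fun s a t => by
    have := Nat.mul_le_mul_right I.n (hpair s a)
    rw [Nat.succ_mul] at this
    omega
  refine ⟨⟨r2, r3, ?_, r5, ?_, fun s a => ?_, fun s a t => ?_, fun s => ?_, fun s => ?_⟩,
    r0 ▸ h4, r0 ▸ h5⟩
  · rw [r4, CMDP.rounds, Fintype.card_fin]
  · rw [r9, CMDP.rounds, Fintype.card_fin]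
  · rw [r0, show 6 + ((s : ℕ) * I.k + a) = 5 + ((s : ℕ) * I.k + a) + 1 by omega]
    refine input_encode I _ _ ?_
    have := hpair s a
    rw [hI, List.getElem?_append_left (by simp [hA, hB, hC]; omega),
      List.getElem?_append_left (by simp [hA, hB]; omega),
      List.getElem?_append_left (by simp [hA]; omega),
      List.getElem?_append_right (by simp), ← hA' s a]
    congr 1
    simp
  · rw [r0, r6, ← mem_succ_iff]
    refine Iff.of_eq (congrArg (· ≠ 0) ?_)
    rw [show 6 + I.n * I.k + 2 * (((s : ℕ) * I.k + a) * I.n + t) =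
      5 + I.n * I.k + (((s : ℕ) * I.k + a) * I.n + t) * 2 + 1 by ring]
    refine input_encode I _ _ ?_
    have := htriple s a t
    rw [hI, List.getElem?_append_left (by simp [hA, hB, hC]; omega),
      List.getElem?_append_left (by simp [hA, hB]; omega),
      List.getElem?_append_right (by simp [hA]; omega), ← hB' s a t]
    congr 1
    simp [hA]
    omega
  · rw [r0, r7, show 6 + I.n * I.k + I.n * I.k * I.n * 2 + (s : ℕ) =
      5 + I.n * I.k + I.n * I.k * I.n * 2 + s + 1 by ring]
    refine input_encode I _ _ ?_
    rw [hI, List.getElem?_append_left (by simp [hA, hB, hC]; omega),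
      List.getElem?_append_right (by simp [hA, hB]; omega), ← hC' s]
    congr 1
    simp [hA, hB]
    omega
  · rw [r0, r8]
    have : m 0 (6 + I.n * I.k + I.n * I.k * I.n * 2 + I.n + (s : ℕ)) =
        if s ∈ I.target then 1 else 0 := by
      rw [show 6 + I.n * I.k + I.n * I.k * I.n * 2 + I.n + (s : ℕ) =
        5 + I.n * I.k + I.n * I.k * I.n * 2 + I.n + s + 1 by ring]
      refine input_encode I _ _ ?_
      rw [hI, List.getElem?_append_right (by simp [hA, hB, hC]; omega), ← hD' s]
      congr 1
      simp [hA, hB, hC]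
      omega
    rw [this]
    split_ifs with h <;> simp [h]

theorem states_le_bitSize : I.n ≤ bitSize I.encode := by
  obtain ⟨A, B, C, D, hI, -, -, hC, -⟩ := exists_encode I
  refine le_trans ?_ (length_le_bitSize _)
  rw [hI]
  simp only [List.length_append]
  omega

theorem actions_le_bitSize : I.k ≤ bitSize I.encode := by
  obtain ⟨A, B, C, D, hI, hA, -⟩ := exists_encode I
  refine le_trans ?_ (length_le_bitSize _)
  -- The initial state shows that `n` is positive, so the `n * k` consumptions alone make the
  -- encoding at least `k` long.
  have := Nat.le_mul_of_pos_left I.k (Fin.pos I.initial)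
  rw [hI]
  simp only [List.length_append]
  omega

theorem prepare_small (b : ℕ) (hb : isSmall b = true) :
    Code.prepare.run (input I.encode) b 0 ≤
      ((Polynomial.X + 1) * (Polynomial.X + 1) : Polynomial ℕ).eval (bitSize I.encode) := by
  have hE := (run_prepare I).1
  have h1 := states_le_bitSize I
  have h2 := actions_le_bitSize I
  simp only [Polynomial.eval_mul, Polynomial.eval_add, Polynomial.eval_X, Polynomial.eval_one]
  simp only [isSmall, decide_eq_true_eq] at hb
  obtain ⟨hl, hu⟩ := hb
  interval_cases b
  · rw [hE.states]; nlinarith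
  · rw [hE.actions]; nlinarith
  · rw [hE.rounds, CMDP.rounds, Fintype.card_fin]
    exact Nat.mul_le_mul (by omega) (by omega)

theorem run_answer {m : Memory} {s d : ℕ} (h4 : m 0 4 = s) (h5 : m 0 5 = d) :
    output (Code.answer.run m) = [if m 17 s ≤ d then 1 else 0] := by
  have e0 : Code.answer.run m 1 0 = 1 := by
    simp [Code.answer, Code.run, Code.branch_apply, Expr.eval, Memory.write_apply]
  have e1 : Code.answer.run m 1 1 = if m 17 s ≤ d then 1 else 0 := by
    simp only [Code.answer, Code.run, Code.branch_apply, Expr.eval, Memory.write_apply]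
    simp only [reduceIte, Nat.reduceEqDiff, false_and, true_and, h4, h5]
    split_ifs <;> omega
  simp [output, e0, e1, List.range_succ]

theorem map_range_eq_flatMap {α : Type} {f : α → ℕ × ℕ × ℕ} {g : ℕ → ℕ} {L : List α}
    (h : ∀ c e, L[c]? = some e → g (3 * c) = (f e).1 ∧ g (3 * c + 1) = (f e).2.1 ∧
      g (3 * c + 2) = (f e).2.2) :
    (List.range (3 * L.length)).map g = L.flatMap fun e => [(f e).1, (f e).2.1, (f e).2.2] := by
  induction L generalizing g with
  | nil => simp
  | cons e L ih =>
    rw [List.flatMap_cons, ← ih (g := fun i => g (3 + i)) fun c e' he => ?_,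
      List.length_cons, show 3 * (L.length + 1) = 3 + 3 * L.length by ring, List.range_add]
    · obtain ⟨h1, h2, h3⟩ := h 0 e rfl
      simp only [mul_zero, zero_add] at h1 h2 h3
      simp [List.range_succ, h1, h2, h3, Function.comp_def]
    · obtain ⟨h1, h2, h3⟩ := h (c + 1) e' (by simpa using he)
      exact ⟨by rw [← h1]; congr 1; ring, by rw [← h2]; congr 1; ring,
        by rw [← h3]; congr 1; ring⟩

/-- The cells beyond `n` have to survive, as they hold the triples written before. -/
theorem run_initialLoads {m : Memory} {d : ℕ} (h5 : m 0 5 = d) :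
    (∀ i < m 2 0, Code.initialLoads.run m 1 (i + 1) = d) ∧
      ∀ j, m 2 0 < j → Code.initialLoads.run m 1 j = m 1 j := by
  refine Code.loop_inv (x := 13) (b := 2)
    (c := .store 1 (.plus (.var 13) (.lit 1)) (.cell 0 (.lit 5))) (m := m)
    (fun i m' => (∀ j < i, m' 1 (j + 1) = d) ∧ ∀ j, m 2 0 < j → m' 1 j = m 1 j) ?_ ?_
  · exact ⟨by simp, fun j _ => by rw [Memory.write_of_ne _ (show (1 : ℕ) ≠ 13 by decide)]⟩
  · intro i hi m' hi' hf ⟨h1, h2⟩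
    have e0 : m' 0 = m 0 := hf 0 rfl
    rw [Memory.write_of_ne _ (show (1 : ℕ) ≠ 13 by decide)]
    simp only [Code.run, Expr.eval, hi', e0, h5, Memory.write_apply, true_and]
    refine ⟨fun j hj => ?_, fun j hj => ?_⟩
    · split_ifs with h
      · rfl
      · exact h1 j (by omega)
    · rw [if_neg (by omega)]
      exact h2 j hj

theorem output_of_written {n k : ℕ} {M : CMDP (Fin n) (Fin k)} {m : Memory} {d : ℕ}
    (hn : m 2 0 = n) (h5 : m 0 5 = d) {L : List (Fin n × M.Level × Fin k)} (hL : Written m L) :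
    Code.outputLength.run (Code.initialLoads.run m) 1 0 = n + 3 * L.length ∧
    output (Code.outputLength.run (Code.initialLoads.run m)) =
      ((List.finRange n).map fun _ => d) ++
        L.flatMap fun e => [(e.1 : ℕ), (e.2.1 : ℕ), (e.2.2 : ℕ)] := by
  obtain ⟨h1, h2⟩ := run_initialLoads h5
  rw [hn] at h1 h2
  set m₁ := Code.initialLoads.run m with hm₁
  have f2 : m₁ 2 0 = n := by rw [hm₁, Code.run_eq_of_not_touches rfl, hn]
  have f25 : m₁ 25 0 = L.length := by rw [hm₁, Code.run_eq_of_not_touches rfl, hL.1]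
  have e0 : Code.outputLength.run m₁ 1 0 = n + 3 * L.length := by
    simp [Code.outputLength, Code.run, Expr.eval, Memory.write_apply, f2, f25]
  have e1 : ∀ j, Code.outputLength.run m₁ 1 (j + 1) = m₁ 1 (j + 1) := fun j => by
    simp [Code.outputLength, Code.run, Expr.eval, Memory.write_apply]
  refine ⟨e0, ?_⟩
  rw [output, e0, List.range_add, List.map_append]
  congr 1
  · rw [List.map_congr_left (g := fun _ => d) fun i hi => by
      rw [e1, h1 i (List.mem_range.1 hi)]]
    simp
  · rw [List.map_map]
    refine map_range_eq_flatMap (f := fun e : Fin n × M.Level × Fin k =>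
      ((e.1 : ℕ), (e.2.1 : ℕ), (e.2.2 : ℕ))) fun c e he => ?_
    obtain ⟨h3, h4, h5⟩ := hL.2 c e he
    simp only [Function.comp, e1]
    rw [← h3, ← h4, ← h5, h2 _ (by omega), h2 _ (by omega), h2 _ (by omega)]
    exact ⟨by congr 1; ring, by congr 1; ring, by congr 1; ring⟩

end RAM

/-! ### The two algorithms -/

open RAM CMDP in
theorem theorem1 :
    -- deciding whether a strategy exists
    RAM.SolvableInPolyTime (fun I : BuchiInstance => I.M.Decreasing) BuchiInstance.encode
      (fun I y => ((∃ σ, I.IsWinning σ) ∧ y = [1]) ∨ ((¬ ∃ σ, I.IsWinning σ) ∧ y = [0])) ∧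
    -- computing a counter selector (and initial levels) of a strategy, if one exists
    RAM.SolvableInPolyTime (fun I : BuchiInstance => I.M.Decreasing ∧ ∃ σ, I.IsWinning σ)
      BuchiInstance.encode
      (fun I y => ∃ (Γ : I.M.CounterSelector) (r : Fin I.n → I.M.Level),
        I.Represents y Γ r ∧ ∀ a₀ : Fin I.k, I.IsWinning (I.M.counterStrategy Γ r a₀)) := by
  constructor
  · refine solvableInPolyTime_of_code (c₁ := Code.prepare) (c₂ := Code.main) (c₃ := Code.answer)
      rfl rfl rfl _ 1 (fun I _ => prepare_small I) (fun I _ => ?_) (fun I hI => ?_)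
    · simp [Code.answer, Code.run, Code.branch_apply, Expr.eval, Memory.write_apply]
    · obtain ⟨hE, h4, h5⟩ := run_prepare I
      obtain ⟨hE', hv, L, -, hS⟩ := run_main hE
      have h6 := Code.run_eq_of_not_touches (c := Code.main) (a := 0) rfl
          (Code.prepare.run (input I.encode))
      rw [run_answer ((congrFun h6 4).trans h4) ((congrFun h6 5).trans h5), hv]
      by_cases hd : I.M.safeVal I.target (I.M.kept I.target) I.initial ≤ I.load
      · rw [if_pos hd]
        -- The list of triples, which this algorithm does not output, provides the winning strategy
        -- behind a positive answer.
        obtain ⟨Γ, -, hΓ⟩ := hS.exists_selector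
        have hK := I.M.prune_kept I.target
        obtain ⟨a₀⟩ := nonempty_action_of_safeVal_le hK
          (hd.trans (Nat.lt_succ_iff.1 I.load.2))
        exact Or.inl ⟨⟨_, hΓ.isBuchiSafe (a₀ := a₀) hK hd⟩, rfl⟩
      · rw [if_neg hd]
        refine Or.inr ⟨fun ⟨σ, hσ⟩ => hd ?_, rfl⟩
        exact IsBuchiSafe.safeVal_kept_le hσ hI
  -- `initialLoads` contains a loop and belongs to the static part; the output length is not a
  -- bounded expression and is left to the straight conclusion.
  · refine solvableInPolyTime_of_code (c₁ := Code.prepare)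
      (c₂ := .seq Code.main Code.initialLoads) (c₃ := Code.outputLength)
      rfl rfl rfl _ (Polynomial.X + 3 * ((Polynomial.X + 1) * (Polynomial.X + 1) * Polynomial.X))
      (fun I _ => prepare_small I) (fun I _ => ?_) (fun I ⟨hI, σ, hσ⟩ => ?_)
    · obtain ⟨hE, -, h5⟩ := run_prepare I
      obtain ⟨hE', -, L, hL, hS⟩ := run_main hE
      have h6 := Code.run_eq_of_not_touches (c := Code.main) (a := 0) rfl
          (Code.prepare.run (input I.encode))
      rw [Code.run, (output_of_written hE'.states ((congrFun h6 5).trans h5) hL).1]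
      have h1 := states_le_bitSize I
      have h2 := hS.length
      rw [CMDP.rounds, Fintype.card_fin, add_zero] at h2
      simp only [Polynomial.eval_add, Polynomial.eval_mul, Polynomial.eval_X, Polynomial.eval_one,
        Polynomial.eval_ofNat]
      have h3 : (I.n + 1) * (I.n + 1) * I.n ≤ (bitSize I.encode + 1) * (bitSize I.encode + 1) *
          bitSize I.encode := Nat.mul_le_mul (Nat.mul_le_mul (by omega) (by omega)) h1
      omega
    · obtain ⟨hE, -, h5⟩ := run_prepare I
      obtain ⟨hE', -, L, hL, hS⟩ := run_main hE
      obtain ⟨Γ, hΓL, hΓ⟩ := hS.exists_selector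
      -- Only the entry of `r` at the initial state matters, so a constant vector will do.
      refine ⟨Γ, fun _ => I.load, ⟨L, hΓL, ?_⟩, fun a₀ => ?_⟩
      · have h6 := Code.run_eq_of_not_touches (c := Code.main) (a := 0) rfl
          (Code.prepare.run (input I.encode))
        rw [Code.run]
        exact (output_of_written hE'.states ((congrFun h6 5).trans h5) hL).2
      · exact hΓ.isBuchiSafe (I.M.prune_kept I.target) (IsBuchiSafe.safeVal_kept_le hσ hI)
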